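/- **Setting.** A germ at $0$ of a function $\mathbb R^n\to\mathbb R$ is *weakly $C^\infty$* if for every $p$ it has a $C^p$ representative; $\mathcal W_n$ is the algebra of these germs. For $H:\mathbb R\to\mathbb R$ with weakly $C^\infty$ germ at $0$, $(\mathcal A_n(H))_{n\ge 0}$ is the smallest family of subalgebras $\mathcal A_n(H)\subset\mathcal W_n$ such that: the germ of $H$ is in $\mathcal A_1(H)$ and polynomial germs are in $\mathcal A_n(H)$; if $f\in\mathcal A_n(H)$ vanishes on $x_i=0$, the germ extending $f/x_i$ continuously is in $\mathcal A_n(H)$; if $f\in\mathcal A_m(H)$, $g_1,\dots,g_m\in\mathcal A_n(H)$ and all $g_i(0)=0$, then $f(g_1,\dots,g_m)\in\mathcal A_n(H)$; if $f\in\mathcal A_n(H)$, $f(0)=0$ and $\frac{\partial f}{\partial x_n}(0)\ne0$, the germ $\varphi\in\mathcal W_{n-1}$ with $\varphi(0)=0$ and $f(x',\varphi(x'))=0$ is in $\mathcal A_{n-1}(H)$. Let $\mathcal T:\mathcal A_n(H)\to\mathbb R[[X_1,\dots,X_n]]$ be the Taylor series at $0$. Fix $H$ such that the germ of $H$ at $0$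 is weakly $C^\infty$ but not $C^\infty$, $H$ is piecewise given by finitely many polynomials on the complement of any neighbourhood of $0$, and $\mathcal T$ is injective on $\mathcal A_n(H)$ for every $n$. **Elementary transformations** $x'\mapsto x$ of $\mathbb R^n$ near $0$ (coordinates not mentioned are unchanged): - blow-up charts ($i\ne j$): $\pi_{i,j}^\lambda$, $\lambda\in\mathbb R$, with $x_i=x_j'(\lambda+x_i')$ and *critical variable* $X_j$; and $\pi_{i,j}^\infty=\pi_{j,i}^0$, with critical variable $X_i$; - Tschirnhausen translations $\tau_h$ ($n\ge1$, $h\in\mathcal A_{n-1}(H)$, $h(0)=0$): $x_n=x_n'+h(x_1',\dots,x_{n-1}')$; - shears $L_{i,c}$ ($c\in\mathbb R^{i-1}$): $x_k=x_k'+c_kx_i'$ for $k<i$; - ramifications $r_i^{d,\pm}$ ($d\ge1$): $x_i=\pm x_i'^{\,d}$. **Trees.** An *elementary tree* is a root with one edge to a leaf for each transformation in one of the families $(\pi_{i,j}^\lambda)_{\lambda\in\mathbb R\cup\{\infty\}}$, $(\tau_h)$, $(L_{i,c})$, $(r_i^{d,+},r_i^{d,-})$. *Admissible trees* of height at most an ordinal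 $h$ are defined by induction on $h$: a single vertex has height $0$ (hence at most $h$ for every $h$); for $h\ge1$, an elementary tree with admissible trees of height $<h$ attached to its leaves has height at most $h$. Every branch $(\nu_1,\dots,\nu_k)$ from the root to a leaf is finite and induces $\rho=\nu_1\circ\dots\circ\nu_k$ (the identity if $k=0$), and one sets $F\circ\rho=F(\mathcal T(\rho_1),\dots,\mathcal T(\rho_n))$ for a series $F$. A series is *normal* if it is $X^\alpha U$ with $\alpha\in\mathbb N^n$ and $U$ an invertible series. A tree $T$ *monomializes* $F_1,\dots,F_p$ if $F_1\circ\rho,\dots,F_p\circ\rho$ are normal for every $\rho$ induced by a branch of $T$. It *$*$-monomializes* them if, moreover, for every blow-up chart $\nu$ in $T$, the sub-tree of $T$ below $\nu$ monomializes the critical variable of $\nu$. **Theorem.** Let $F_1,\dots,F_p\in\mathcal T(\mathcal A_n(H))$ be non-zero series. Then there are an ordinal $h$ and an admissible tree $T$ of height at most $h$ that $*$-monomializes $F_1,\dots,F_p$. -/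

import Mathlib

open Filter Topology
open scoped ContDiff

noncomputable section

namespace HGerm

/-- The function `f` has a weakly `C^∞` germ at `0`: for every `p` it is `C^p` on some neighbourhood
of `0`, which may shrink as `p` grows. -/
def WeaklySmooth {n : ℕ} (f : (Fin n → ℝ) → ℝ) : Prop :=
  ∀ p : ℕ, ContDiffAt ℝ p f 0

/-- The partial derivative `∂f/∂x_i`. -/
def partialDeriv {n : ℕ} (i : Fin n) (f : (Fin n → ℝ) → ℝ) : (Fin n → ℝ) → ℝ :=
  fun x => fderiv ℝ f x (Pi.single i 1)

/-- The iterated partial derivative `∂^|α| f / ∂x^α`. -/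
def iterPartialDeriv {n : ℕ} (α : Fin n →₀ ℕ) (f : (Fin n → ℝ) → ℝ) : (Fin n → ℝ) → ℝ :=
  (List.finRange n).foldr (fun i g => (partialDeriv i)^[α i] g) f

/-- The Taylor series at `0`: the coefficient of `X^α` is `(∂^|α| f / ∂x^α)(0) / α!`. -/
def taylor {n : ℕ} (f : (Fin n → ℝ) → ℝ) : MvPowerSeries (Fin n) ℝ :=
  fun α => iterPartialDeriv α f 0 / ∏ i, ((α i).factorial : ℝ)

/-- `InAlg H n f` says that the germ at `0` of `f` belongs to `𝒜_n(H)`. The family `𝒜_n(H)` is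
the smallest family of algebras of germs that contains the germ of `H` and the polynomials and is
stable under division by a coordinate, composition, and implicit functions. Germs are handled
through representatives, two of which are identified by `congr`. -/
inductive InAlg (H : ℝ → ℝ) : (n : ℕ) → ((Fin n → ℝ) → ℝ) → Prop
  | congr {n : ℕ} {f g : (Fin n → ℝ) → ℝ} (hf : InAlg H n f) (hfg : f =ᶠ[𝓝 0] g) : InAlg H n g
  | self : InAlg H 1 (fun x => H (x 0))
  | poly {n : ℕ} (P : MvPolynomial (Fin n) ℝ) : InAlg H n (fun x => MvPolynomial.eval x P)
  | add {n : ℕ} {f g : (Fin n → ℝ) → ℝ} (hf : InAlg H n f) (hg : InAlg H n g) :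
      InAlg H n (fun x => f x + g x)
  | mul {n : ℕ} {f g : (Fin n → ℝ) → ℝ} (hf : InAlg H n f) (hg : InAlg H n g) :
      InAlg H n (fun x => f x * g x)
  /-- If `f` vanishes on `x_i = 0`, the germ that extends `f / x_i` continuously. -/
  | div {n : ℕ} {f g : (Fin n → ℝ) → ℝ} (i : Fin n) (hf : InAlg H n f)
      (hzero : ∀ᶠ x in 𝓝 (0 : Fin n → ℝ), x i = 0 → f x = 0)
      (hcont : ∀ᶠ x in 𝓝 (0 : Fin n → ℝ), ContinuousAt g x)
      (hquot : ∀ᶠ x in 𝓝 (0 : Fin n → ℝ), x i ≠ 0 → g x = f x / x i) : InAlg H n g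
  | comp {m n : ℕ} {f : (Fin m → ℝ) → ℝ} {g : Fin m → (Fin n → ℝ) → ℝ} (hf : InAlg H m f)
      (hg : ∀ i, InAlg H n (g i)) (hg0 : ∀ i, g i 0 = 0) : InAlg H n (fun x => f (fun i => g i x))
  /-- The germ `φ` with `φ(0) = 0` that solves `f(x', φ(x')) = 0`. -/
  | implicit {n : ℕ} {f : (Fin (n + 1) → ℝ) → ℝ} {φ : (Fin n → ℝ) → ℝ} (hf : InAlg H (n + 1) f)
      (hf0 : f 0 = 0) (hderiv : partialDeriv (Fin.last n) f 0 ≠ 0) (hφ : WeaklySmooth φ)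
      (hφ0 : φ 0 = 0)
      (hsol : ∀ᶠ x in 𝓝 (0 : Fin n → ℝ), f (Fin.snoc (α := fun _ => ℝ) x (φ x)) = 0) :
      InAlg H n φ

/-- The standing assumptions on `H`. -/
structure IsQuasianalyticGenerator (H : ℝ → ℝ) : Prop where
  /-- The germ of `H` at `0` is weakly `C^∞`. -/
  weaklySmooth : ∀ p : ℕ, ContDiffAt ℝ p H 0
  /-- The germ of `H` at `0` has no `C^∞` representative. -/
  not_smooth : ¬ ∃ U : Set ℝ, IsOpen U ∧ (0 : ℝ) ∈ U ∧ ContDiffOn ℝ ∞ H U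
  /-- Away from any neighbourhood of `0`, `H` is piecewise given by finitely many polynomials:
  the complement of the neighbourhood is covered by finitely many intervals, and on the part of each
  of them outside the neighbourhood `H` is a polynomial. -/
  piecewise_polynomial : ∀ U ∈ 𝓝 (0 : ℝ), ∃ (N : ℕ) (I : Fin N → Set ℝ)
    (P : Fin N → Polynomial ℝ), (∀ k, (I k).OrdConnected) ∧ Uᶜ ⊆ (⋃ k, I k) ∧
      ∀ k, ∀ x ∈ I k, x ∉ U → H x = (P k).eval x
  /-- Every germ in `𝒜_n(H)` is determined by its Taylor series. -/
  quasianalytic : ∀ (n : ℕ) (f g : (Fin n → ℝ) → ℝ), InAlg H n f → InAlg H n g →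
    taylor f = taylor g → f =ᶠ[𝓝 0] g

/-- The blow-up chart `π_{i,j}^l` for a real `l`: `x_i = x_j' (l + x_i')`. -/
def blowUpChart {n : ℕ} (i j : Fin n) (l : ℝ) (x : Fin n → ℝ) : Fin n → ℝ :=
  Function.update x i (x j * (l + x i))

/-- The Tschirnhausen translation `τ_h`, which acts on the last variable. -/
def tschirnhausen {n : ℕ} (h : (Fin n → ℝ) → ℝ) (x : Fin (n + 1) → ℝ) : Fin (n + 1) → ℝ :=
  Function.update x (Fin.last n) (x (Fin.last n) + h (fun k => x k.castSucc))

/-- The shear transformation `L_{i,c}`: `x_k = x_k' + c_k x_i'` for `k < i`. -/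
def shear {n : ℕ} (i : Fin n) (c : Set.Iio i → ℝ) (x : Fin n → ℝ) : Fin n → ℝ :=
  fun k => if hk : k < i then x k + c ⟨k, hk⟩ * x i else x k

/-- The ramification `r_i^{d,s}` for a sign `s`: `x_i = s x_i'^d`. -/
def ramification {n : ℕ} (i : Fin n) (d : ℕ) (s : ℤˣ) (x : Fin n → ℝ) : Fin n → ℝ :=
  Function.update x i (((s : ℤ) : ℝ) * x i ^ d)

/-- The elementary trees in `n` variables. -/
inductive ElementaryTree (H : ℝ → ℝ) : ℕ → Type
  | blowUp {n : ℕ} (i j : Fin n) (hij : i ≠ j) : ElementaryTree H n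
  | tschirnhausen {n : ℕ} (h : (Fin n → ℝ) → ℝ) (hh : InAlg H n h) (h0 : h 0 = 0) :
      ElementaryTree H (n + 1)
  | shear {n : ℕ} (i : Fin n) (c : Set.Iio i → ℝ) : ElementaryTree H n
  | ramification {n : ℕ} (i : Fin n) (d : ℕ) (hd : 1 ≤ d) : ElementaryTree H n

namespace ElementaryTree

variable {H : ℝ → ℝ}

/-- The index set of the edges of an elementary tree: `ℝ ∪ {∞}` for a blow-up, the two signs for a
ramification, and one element otherwise. -/
def Edge : {n : ℕ} → ElementaryTree H n → Type
  | _, blowUp _ _ _ => OnePoint ℝ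
  | _, tschirnhausen _ _ _ => Unit
  | _, shear _ _ => Unit
  | _, ramification _ _ _ => ℤˣ

/-- The elementary transformation attached to an edge; `π_{i,j}^∞` is `π_{j,i}^0`. -/
def transformation : {n : ℕ} → (E : ElementaryTree H n) → E.Edge → (Fin n → ℝ) → (Fin n → ℝ)
  | _, blowUp i j _, l => OnePoint.elim l (blowUpChart j i 0) (blowUpChart i j)
  | _, tschirnhausen h _ _, _ => HGerm.tschirnhausen h
  | _, shear i c, _ => HGerm.shear i c
  | _, ramification i d _, s => HGerm.ramification i d s

/-- The (index of the) critical variable of an edge that is a blow-up chart: `X_j` for `π_{i,j}^l`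
with `l` real, and `X_i` for `π_{i,j}^∞`. Other edges have none. -/
def criticalVariable : {n : ℕ} → (E : ElementaryTree H n) → E.Edge → Option (Fin n)
  | _, blowUp i j _, l => OnePoint.elim l (some i) (fun _ => some j)
  | _, tschirnhausen _ _ _, _ => none
  | _, shear _ _, _ => none
  | _, ramification _ _ _, _ => none

end ElementaryTree

/-- Admissible trees: a single vertex, or an elementary tree with an admissible tree attached to
each of its leaves. -/
inductive AdmissibleTree (H : ℝ → ℝ) (n : ℕ) : Type
  | vertex : AdmissibleTree H n
  | node (E : ElementaryTree H n) (child : E.Edge → AdmissibleTree H n) : AdmissibleTree H n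

/-- A series is normal when it is a monomial times an invertible series. -/
def IsNormal {n : ℕ} (F : MvPowerSeries (Fin n) ℝ) : Prop :=
  ∃ (α : Fin n →₀ ℕ) (U : MvPowerSeries (Fin n) ℝ), IsUnit U ∧ F = MvPowerSeries.monomial α 1 * U

/-- The series `F ∘ ρ = F(𝒯(ρ_1), …, 𝒯(ρ_n))`. -/
def compTransformation {n : ℕ} (F : MvPowerSeries (Fin n) ℝ) (ρ : (Fin n → ℝ) → (Fin n → ℝ)) :
    MvPowerSeries (Fin n) ℝ :=
  MvPowerSeries.subst (fun i => taylor (fun x => ρ x i)) F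

namespace AdmissibleTree

variable {H : ℝ → ℝ} {n : ℕ}

/-- The tree has height at most the ordinal `h`. -/
def HeightAtMost : AdmissibleTree H n → Ordinal.{0} → Prop
  | vertex, _ => True
  | node _ child, h => ∀ e, ∃ h' < h, (child e).HeightAtMost h'

/-- The branches of a tree, from its root to a leaf. -/
inductive Branch : AdmissibleTree H n → Type
  | nil : Branch vertex
  | cons {E : ElementaryTree H n} {child : E.Edge → AdmissibleTree H n} (e : E.Edge)
      (β : Branch (child e)) : Branch (node E child)

/-- The admissible transformation `ν_1 ∘ ⋯ ∘ ν_k` induced by a branch `(ν_1, …, ν_k)`. -/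
def Branch.transformation : {T : AdmissibleTree H n} → T.Branch → (Fin n → ℝ) → (Fin n → ℝ)
  | _, .nil => id
  | _, .cons (E := E) e β => E.transformation e ∘ β.transformation

/-- `T` monomializes `F_1, …, F_p`. -/
def Monomializes (T : AdmissibleTree H n) {p : ℕ} (F : Fin p → MvPowerSeries (Fin n) ℝ) : Prop :=
  ∀ β : T.Branch, ∀ k, IsNormal (compTransformation (F k) β.transformation)

/-- For every blow-up chart in `T`, the sub-tree of `T` below it monomializes its critical
variable. -/
def MonomializesCritical : AdmissibleTree H n → Prop
  | vertex => True
  | node E child => ∀ e, (∀ w, E.criticalVariable e = some w →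
      (child e).Monomializes ![MvPowerSeries.X w]) ∧ (child e).MonomializesCritical

/-- `T` `*`-monomializes `F_1, …, F_p`. -/
def StarMonomializes (T : AdmissibleTree H n) {p : ℕ} (F : Fin p → MvPowerSeries (Fin n) ℝ) :
    Prop :=
  T.Monomializes F ∧ T.MonomializesCritical

end AdmissibleTree

end HGerm

end

/-!
The proof takes place in the rings `S_n` of the Taylor series of the germs in `𝒜_n(H)`
(`IsAlgSeries`). They are stable under ring operations and substitution, under division by a
variable (`IsAlgSeries.of_X_mul`) and under the implicit function theorem
(`IsAlgSeries.exists_implicit`). Division is where quasianalyticity enters: a germ whose Taylor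
series is divisible by `X_i` restricts to the germ `0` on `x_i = 0`. The link between germs and
series is that the Taylor series is the unique formal series that is an asymptotic expansion of
the germ (`HasExpansion`), which makes it compatible with products and compositions.

Trees are replaced by an inductive predicate on series: `F` is `Monomializable` if it is normal,
or if, for some elementary tree, the product of `F ∘ ν` and of the critical variable of `ν` is
monomializable for every edge `ν`. Since the divisors of a normal series are normal, a tree that
monomializes this product monomializes both factors, so that the condition on critical variables
takes care of itself (`Monomializable.exists_tree`), and several series are monomialized together
by monomializing their product.

Every nonzero series of `S_n` is monomializable, by induction on `n`. After a shear, the series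
`F` in `n + 1` variables has a finite order along the last axis, and a second induction is on this
order, for products `A F` with `A ≠ 0` a series in the first `n` variables
(`Monomializable.of_coeff_ne_zero`). A Tschirnhausen translation brings `F` of order `d + 1` to
`∑_{i < d} a_i(x') x_n ^ i + x_n ^ (d + 1) U` with `U` invertible
(`IsAlgSeries.exists_tschirnhausen`). The induction hypothesis on `n` monomializes the product of
`A`, of the nonzero `a_i` and of the nonzero differences of suitable powers of the `a_i`. The tree
so obtained is lifted to one more variable (`Monomializable.lift`); the translations
`x_{n-1} ↦ x_{n-1} + h`, which are no longer elementary there, are commutators of Tschirnhausen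
translations of the last variable and shears (`subst_commutator`). Now the `a_i` are monomials
times units and the exponents of their powers of equal weight are comparable; after a
ramification, `a_i` is `x' ^ ((d + 1 - i) β) b_i` and some `b_i` is invertible
(`Monomializable.of_isPrepared`). Blow-ups of `x_n` and the variables that occur in `x' ^ β` lower
`β` in the chart of `0`, give a normal series in the chart of `∞`, and give order at most `d`
along the last axis in the other charts, since the term of degree `d` is absent before the
blow-up. When `β = 0`, the order along the last axis is even less than `d`
(`Monomializable.of_prepared`).
-/

namespace HGerm

/-! ### Polynomial expansions of germs -/

/-- The germ `f` has the formal series `F` as its asymptotic expansion at `0`: for every `p`, the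
part of `F` of degree less than `p` approximates `f` up to `O(‖x‖ ^ p)`. -/
def HasExpansion {n : ℕ} (f : (Fin n → ℝ) → ℝ) (F : MvPowerSeries (Fin n) ℝ) : Prop :=
  ∀ p : ℕ, (fun x => f x - MvPolynomial.eval x (F.truncTotal p)) =O[𝓝 0] fun x => ‖x‖ ^ p

section Expansion

variable {n m : ℕ} {f g : (Fin n → ℝ) → ℝ} {F G : MvPowerSeries (Fin n) ℝ}

theorem norm_eval_monomial_le (α : Fin n →₀ ℕ) (c : ℝ) (x : Fin n → ℝ) :
    ‖MvPolynomial.eval x (MvPolynomial.monomial α c)‖ ≤ ‖c‖ * ‖x‖ ^ α.degree := by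
  rw [MvPolynomial.eval_monomial, norm_mul, Finsupp.prod_fintype _ _ (by simp), norm_prod]
  gcongr
  rw [Finsupp.degree_eq_sum, ← Finset.prod_pow_eq_pow_sum]
  refine Finset.prod_le_prod (fun _ _ => norm_nonneg _) fun i _ => ?_
  rw [norm_pow]
  exact pow_le_pow_left₀ (norm_nonneg _) (norm_le_pi_norm x i) _

theorem isBigO_norm_pow_of_le {p q : ℕ} (h : p ≤ q) :
    (fun x : Fin n → ℝ => ‖x‖ ^ q) =O[𝓝 0] fun x => ‖x‖ ^ p := by
  refine Asymptotics.IsBigO.of_bound 1 ?_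
  filter_upwards [Metric.ball_mem_nhds (0 : Fin n → ℝ) one_pos] with x hx
  have hx' : ‖x‖ ≤ 1 := by simpa using (mem_ball_zero_iff.1 hx).le
  rw [norm_pow, norm_pow, norm_norm, one_mul]
  exact pow_le_pow_of_le_one (norm_nonneg _) hx' h

/-- A polynomial without terms of degree less than `p` is `O(‖x‖ ^ p)`. -/
theorem isBigO_eval_of_coeff_eq_zero {p : ℕ} {P : MvPolynomial (Fin n) ℝ}
    (hP : ∀ α : Fin n →₀ ℕ, α.degree < p → P.coeff α = 0) :
    (fun x => MvPolynomial.eval x P) =O[𝓝 0] fun x => ‖x‖ ^ p := by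
  have : (fun x => MvPolynomial.eval x P) =
      fun x => ∑ α ∈ P.support, MvPolynomial.eval x (MvPolynomial.monomial α (P.coeff α)) := by
    funext x
    conv_lhs => rw [P.as_sum]
    rw [map_sum]
  rw [this]
  refine Asymptotics.IsBigO.fun_sum fun α hα => ?_
  refine Asymptotics.IsBigO.trans ?_ (isBigO_norm_pow_of_le (q := α.degree) ?_)
  · refine Asymptotics.IsBigO.of_bound ‖P.coeff α‖ (Eventually.of_forall fun x => ?_)
    rw [norm_pow, norm_norm]
    exact norm_eval_monomial_le _ _ _
  · by_contra h
    exact MvPolynomial.mem_support_iff.1 hα (hP α (not_le.1 h))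

/-- Any polynomial with the coefficients of `F` in degrees less than `p` may replace the truncation
of `F` in the condition of order `p`. -/
theorem HasExpansion.of_forall_exists
    (h : ∀ p : ℕ, ∃ P : MvPolynomial (Fin n) ℝ,
      (∀ α : Fin n →₀ ℕ, α.degree < p → P.coeff α = MvPowerSeries.coeff α F) ∧
      (fun x => f x - MvPolynomial.eval x P) =O[𝓝 0] fun x => ‖x‖ ^ p) :
    HasExpansion f F := by
  intro p
  obtain ⟨P, hP, hf⟩ := h p
  have h2 : (fun x => MvPolynomial.eval x (P - F.truncTotal p)) =O[𝓝 0]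
      fun x : Fin n → ℝ => ‖x‖ ^ p := by
    refine isBigO_eval_of_coeff_eq_zero fun α hα => ?_
    rw [MvPolynomial.coeff_sub, hP α hα, MvPowerSeries.coeff_truncTotal _ hα, sub_self]
  refine (hf.add h2).congr_left fun x => ?_
  simp

theorem HasExpansion.congr (hf : HasExpansion f F) (h : f =ᶠ[𝓝 0] g) : HasExpansion g F := by
  intro p
  refine (hf p).congr' ?_ EventuallyEq.rfl
  filter_upwards [h] with x hx
  rw [hx]

theorem HasExpansion.sub (hf : HasExpansion f F) (hg : HasExpansion g G) :
    HasExpansion (fun x => f x - g x) (F - G) := by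
  intro p
  refine ((hf p).sub (hg p)).congr_left fun x => ?_
  rw [map_sub, map_sub]
  ring

theorem HasExpansion.add (hf : HasExpansion f F) (hg : HasExpansion g G) :
    HasExpansion (fun x => f x + g x) (F + G) := by
  intro p
  refine ((hf p).add (hg p)).congr_left fun x => ?_
  rw [map_add, map_add]
  ring

theorem hasExpansion_eval (P : MvPolynomial (Fin n) ℝ) :
    HasExpansion (fun x => MvPolynomial.eval x P) (P : MvPowerSeries (Fin n) ℝ) := by
  refine HasExpansion.of_forall_exists fun p =>
    ⟨P, fun α _ => (MvPolynomial.coeff_coe _ _).symm, ?_⟩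
  simpa using Asymptotics.isBigO_zero _ _

theorem isBigO_one_eval (P : MvPolynomial (Fin n) ℝ) :
    (fun x => MvPolynomial.eval x P) =O[𝓝 (0 : Fin n → ℝ)] fun _ => (1 : ℝ) :=
  ((MvPolynomial.continuous_eval P).tendsto 0).isBigO_one ℝ

theorem HasExpansion.isBigO_one (hf : HasExpansion f F) : f =O[𝓝 0] fun _ => (1 : ℝ) := by
  have := (hf 0).congr_right (g₂ := fun _ => (1 : ℝ)) (by simp)
  refine (this.add (isBigO_one_eval (F.truncTotal 0))).congr_left fun x => ?_
  simp

theorem HasExpansion.mul (hf : HasExpansion f F) (hg : HasExpansion g G) :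
    HasExpansion (fun x => f x * g x) (F * G) := by
  refine HasExpansion.of_forall_exists fun p =>
    ⟨F.truncTotal p * G.truncTotal p, fun α hα => ?_, ?_⟩
  · exact MvPowerSeries.coeff_truncTotal_mul_truncTotal_eq_coeff_mul F G hα
  · have h1 := (hf p).mul hg.isBigO_one
    have h2 := (isBigO_one_eval (F.truncTotal p)).mul (hg p)
    simp only [one_mul, mul_one] at h1 h2
    refine (h1.add h2).congr_left fun x => ?_
    rw [map_mul]
    ring

theorem HasExpansion.apply_zero (hf : HasExpansion f F) :
    f 0 = MvPowerSeries.constantCoeff F := by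
  have h := ((hf 1).congr_right (g₂ := fun x => ‖x - 0‖ ^ 1) (by simp)).eq_zero_of_norm_pow
    one_ne_zero
  have h2 : MvPolynomial.eval 0 (F.truncTotal 1) = MvPowerSeries.constantCoeff F := by
    rw [MvPolynomial.eval_zero]
    exact MvPowerSeries.coeff_truncTotal F (by simp)
  simp only [h2] at h
  linarith [h]

theorem eval_smul_of_isHomogeneous {p : ℕ} {P : MvPolynomial (Fin n) ℝ} (hP : P.IsHomogeneous p)
    (t : ℝ) (v : Fin n → ℝ) : MvPolynomial.eval (t • v) P = t ^ p * MvPolynomial.eval v P := by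
  rw [MvPolynomial.eval_eq', MvPolynomial.eval_eq', Finset.mul_sum]
  refine Finset.sum_congr rfl fun α hα => ?_
  have hd : ∑ i, α i = p := by
    rw [← Finsupp.degree_eq_sum, Finsupp.degree_eq_weight_one (R := ℕ)]
    exact hP (MvPolynomial.mem_support_iff.1 hα)
  simp only [Pi.smul_apply, smul_eq_mul, mul_pow]
  rw [Finset.prod_mul_distrib, Finset.prod_pow_eq_pow_sum, hd]
  ring

/-- The homogeneous component argument behind uniqueness of expansions: a homogeneous polynomial of
degree `p` that is `O(‖x‖ ^ (p + 1))` vanishes, by restriction to lines. -/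
theorem eq_zero_of_isHomogeneous_of_isBigO {p : ℕ} {P : MvPolynomial (Fin n) ℝ}
    (hP : P.IsHomogeneous p)
    (h : (fun x => MvPolynomial.eval x P) =O[𝓝 0] fun x => ‖x‖ ^ (p + 1)) : P = 0 := by
  refine MvPolynomial.funext fun v => ?_
  rw [map_zero]
  have ht : Tendsto (fun t : ℝ => t • v) (𝓝[≠] 0) (𝓝 0) := by
    have : Tendsto (fun t : ℝ => t • v) (𝓝 0) (𝓝 ((0 : ℝ) • v)) :=
      Continuous.tendsto (by fun_prop) 0
    rw [zero_smul] at this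
    exact this.mono_left nhdsWithin_le_nhds
  obtain ⟨C, hC⟩ := (h.comp_tendsto ht).bound
  have hC' : ∀ᶠ t in 𝓝[≠] (0 : ℝ), ‖MvPolynomial.eval v P‖ ≤ C * ‖v‖ ^ (p + 1) * ‖t‖ := by
    filter_upwards [hC, self_mem_nhdsWithin] with t ht ht0
    have ht0' : (0 : ℝ) < ‖t‖ := norm_pos_iff.2 ht0
    have he := eval_smul_of_isHomogeneous hP t v
    simp only [Function.comp_apply] at ht
    rw [he, norm_mul, norm_pow, norm_pow, norm_norm, norm_smul, mul_pow, pow_succ ‖t‖] at ht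
    have h3 : ‖t‖ ^ p * ‖MvPolynomial.eval v P‖ ≤ ‖t‖ ^ p * (C * ‖v‖ ^ (p + 1) * ‖t‖) := by
      linarith [ht]
    exact le_of_mul_le_mul_left h3 (by positivity)
  have hlim : Tendsto (fun t : ℝ => C * ‖v‖ ^ (p + 1) * ‖t‖) (𝓝[≠] 0) (𝓝 0) := by
    have : Tendsto (fun t : ℝ => C * ‖v‖ ^ (p + 1) * ‖t‖) (𝓝 0)
        (𝓝 (C * ‖v‖ ^ (p + 1) * ‖(0 : ℝ)‖)) :=
      Continuous.tendsto (by fun_prop) 0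
    rw [norm_zero, mul_zero] at this
    exact this.mono_left nhdsWithin_le_nhds
  exact norm_le_zero_iff.1 (ge_of_tendsto hlim hC')

theorem HasExpansion.eq_zero (h : HasExpansion (fun _ => 0) F) : F = 0 := by
  by_contra hF
  obtain ⟨α, hα, hα2⟩ := MvPowerSeries.exists_coeff_ne_zero_and_order
    (MvPowerSeries.ne_zero_iff_order_finite.1 hF)
  set p := α.degree with hp
  have hlow : ∀ β : Fin n →₀ ℕ, β.degree < p → MvPowerSeries.coeff β F = 0 := fun β hβ =>
    MvPowerSeries.coeff_of_lt_order (by rw [← hα2]; exact_mod_cast hβ)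
  -- `p` is the order of `F`, so this truncation is the initial form of `F`.
  have hhom : (F.truncTotal (p + 1)).IsHomogeneous p := by
    intro β hβ
    rw [MvPowerSeries.coeff_truncTotal_eq_ite] at hβ
    split_ifs at hβ with h1
    · have : ¬ β.degree < p := fun h2 => hβ (hlow β h2)
      have h3 : β.degree = p := by omega
      rwa [Finsupp.degree_eq_weight_one (R := ℕ)] at h3
    · exact absurd rfl hβ
  have hz := eq_zero_of_isHomogeneous_of_isBigO hhom (by simpa using (h (p + 1)).neg_left)
  apply hα
  rw [← MvPowerSeries.coeff_truncTotal F (show α.degree < p + 1 by omega), hz]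
  simp

theorem HasExpansion.unique (hF : HasExpansion f F) (hG : HasExpansion f G) : F = G := by
  have := hF.sub hG
  simp only [sub_self] at this
  exact sub_eq_zero.1 this.eq_zero

theorem HasExpansion.isBigO_norm (hf : HasExpansion f F) (h0 : f 0 = 0) :
    f =O[𝓝 0] fun x => ‖x‖ := by
  have h1 := hf 1
  have h2 : (fun x => MvPolynomial.eval x (F.truncTotal 1)) =O[𝓝 0]
      fun x : Fin n → ℝ => ‖x‖ ^ 1 := by
    refine isBigO_eval_of_coeff_eq_zero fun α hα => ?_
    rw [MvPowerSeries.coeff_truncTotal _ hα]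
    have : α = 0 := by
      rw [← Finsupp.degree_eq_zero_iff]
      omega
    rw [this, MvPowerSeries.coeff_zero_eq_constantCoeff_apply, ← hf.apply_zero, h0]
  simpa using h1.add h2

theorem HasExpansion.aeval {g : Fin m → (Fin n → ℝ) → ℝ} {G : Fin m → MvPowerSeries (Fin n) ℝ}
    (hg : ∀ i, HasExpansion (g i) (G i)) (P : MvPolynomial (Fin m) ℝ) :
    HasExpansion (fun x => MvPolynomial.eval (fun i => g i x) P) (MvPolynomial.aeval G P) := by
  induction P using MvPolynomial.induction_on with
  | C a =>
    have := hasExpansion_eval (n := n) (MvPolynomial.C a)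
    simpa [MvPowerSeries.algebraMap_apply] using this
  | add P Q hP hQ => simpa using hP.add hQ
  | mul_X P i hP => simpa using hP.mul (hg i)

theorem hasSubst_of_hasExpansion {g : Fin m → (Fin n → ℝ) → ℝ}
    {G : Fin m → MvPowerSeries (Fin n) ℝ}
    (hg : ∀ i, HasExpansion (g i) (G i)) (hg0 : ∀ i, g i 0 = 0) : MvPowerSeries.HasSubst G :=
  MvPowerSeries.hasSubst_of_constantCoeff_zero fun i => by rw [← (hg i).apply_zero, hg0]

theorem order_le_order_subst {τ : Type*} {G : Fin m → MvPowerSeries τ ℝ}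
    (hG : ∀ i, MvPowerSeries.constantCoeff (G i) = 0) {F : MvPowerSeries (Fin m) ℝ} :
    F.order ≤ (MvPowerSeries.subst G F).order := by
  refine le_trans ?_ (MvPowerSeries.le_order_subst
    (MvPowerSeries.hasSubst_of_constantCoeff_zero hG) F)
  have : (1 : ℕ∞) ≤ ⨅ i, (G i).order :=
    le_iInf fun i => MvPowerSeries.one_le_order_iff_constCoeff_eq_zero.2 (hG i)
  calc F.order = 1 * F.order := (one_mul _).symm
    _ ≤ _ := by gcongr

/-- When the `G_i` vanish at the origin, the coefficients of `F(G)` of degree less than `p` depend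
only on the terms of `F` of degree less than `p`. -/
theorem coeff_aeval_truncTotal {τ : Type*} {G : Fin m → MvPowerSeries τ ℝ}
    (hG : ∀ i, MvPowerSeries.constantCoeff (G i) = 0) {F : MvPowerSeries (Fin m) ℝ} {p : ℕ}
    {α : τ →₀ ℕ} (hα : α.degree < p) :
    MvPowerSeries.coeff α (MvPolynomial.aeval G (F.truncTotal p)) =
      MvPowerSeries.coeff α (MvPowerSeries.subst G F) := by
  rw [← MvPowerSeries.subst_coe, eq_comm, ← sub_eq_zero, ← map_sub,
    ← MvPowerSeries.subst_sub (MvPowerSeries.hasSubst_of_constantCoeff_zero hG)]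
  refine MvPowerSeries.coeff_of_lt_order (lt_of_lt_of_le ?_ (order_le_order_subst hG))
  refine lt_of_lt_of_le (b := (p : ℕ∞)) (by exact_mod_cast hα) ?_
  refine MvPowerSeries.nat_le_order fun β hβ => ?_
  rw [map_sub, MvPolynomial.coeff_coe, MvPowerSeries.coeff_truncTotal _ hβ, sub_self]

theorem HasExpansion.comp {f : (Fin m → ℝ) → ℝ} {F : MvPowerSeries (Fin m) ℝ}
    {g : Fin m → (Fin n → ℝ) → ℝ} {G : Fin m → MvPowerSeries (Fin n) ℝ} (hf : HasExpansion f F)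
    (hg : ∀ i, HasExpansion (g i) (G i)) (hg0 : ∀ i, g i 0 = 0) :
    HasExpansion (fun x => f (fun i => g i x)) (MvPowerSeries.subst G F) := by
  have hG0 : ∀ i, MvPowerSeries.constantCoeff (G i) = 0 := fun i => by
    rw [← (hg i).apply_zero, hg0]
  refine HasExpansion.of_forall_exists fun p => ?_
  refine ⟨(MvPolynomial.aeval G (F.truncTotal p)).truncTotal p, fun α hα => ?_, ?_⟩
  · rw [MvPowerSeries.coeff_truncTotal _ hα, coeff_aeval_truncTotal hG0 hα]
  · have hgO : (fun x => (fun i => g i x)) =O[𝓝 (0 : Fin n → ℝ)] fun x => ‖x‖ :=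
      Asymptotics.isBigO_pi.2 fun i => (hg i).isBigO_norm (hg0 i)
    have hlim : Tendsto (fun x => (fun i => g i x)) (𝓝 (0 : Fin n → ℝ)) (𝓝 0) := by
      refine hgO.trans_tendsto ?_
      have : Tendsto (fun x : Fin n → ℝ => ‖x‖) (𝓝 0) (𝓝 ‖(0 : Fin n → ℝ)‖) :=
        Continuous.tendsto continuous_norm 0
      rwa [norm_zero] at this
    have h1 := ((hf p).comp_tendsto hlim).trans ((hgO.norm_left).pow p)
    have h2 := HasExpansion.aeval hg (F.truncTotal p) p
    refine (h1.add h2).congr_left fun x => ?_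
    simp

end Expansion

end HGerm

namespace HGerm

/-! ### Taylor series of weakly smooth germs -/

section Taylor

variable {n : ℕ} {f g : (Fin n → ℝ) → ℝ}

theorem WeaklySmooth.congr (hf : WeaklySmooth f) (h : f =ᶠ[𝓝 0] g) : WeaklySmooth g :=
  fun p => (hf p).congr_of_eventuallyEq h.symm

theorem WeaklySmooth.eventually_differentiableAt (hf : WeaklySmooth f) :
    ∀ᶠ x in 𝓝 0, DifferentiableAt ℝ f x := by
  filter_upwards [(hf 1).eventually (by simp)] with x hx
  exact hx.differentiableAt (by simp)

theorem weaklySmooth_eval (P : MvPolynomial (Fin n) ℝ) :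
    WeaklySmooth fun x => MvPolynomial.eval x P := fun _ =>
  (show ContDiff ℝ _ fun x : Fin n → ℝ => MvPolynomial.eval x P by
    induction P using MvPolynomial.induction_on with
    | C a => simpa using contDiff_const
    | add P Q hP hQ => simpa using hP.add hQ
    | mul_X P i hP => simpa using hP.mul (contDiff_apply ℝ ℝ i)).contDiffAt

theorem WeaklySmooth.sub (hf : WeaklySmooth f) (hg : WeaklySmooth g) :
    WeaklySmooth fun x => f x - g x := fun p => (hf p).sub (hg p)

theorem WeaklySmooth.add (hf : WeaklySmooth f) (hg : WeaklySmooth g) :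
    WeaklySmooth fun x => f x + g x := fun p => (hf p).add (hg p)

theorem WeaklySmooth.mul (hf : WeaklySmooth f) (hg : WeaklySmooth g) :
    WeaklySmooth fun x => f x * g x := fun p => (hf p).mul (hg p)

theorem WeaklySmooth.comp {m : ℕ} {f : (Fin m → ℝ) → ℝ} {g : Fin m → (Fin n → ℝ) → ℝ}
    (hf : WeaklySmooth f) (hg : ∀ i, WeaklySmooth (g i)) (hg0 : ∀ i, g i 0 = 0) :
    WeaklySmooth fun x => f fun i => g i x := fun p => by
  refine ContDiffAt.comp (𝕜 := ℝ) (g := f) (f := fun x i => g i x) 0 ?_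
    (contDiffAt_pi.2 fun i => hg i p)
  have : (fun i => g i 0) = (0 : Fin m → ℝ) := funext hg0
  rw [this]
  exact hf p

theorem partialDeriv_congr (i : Fin n) (h : f =ᶠ[𝓝 0] g) :
    partialDeriv i f =ᶠ[𝓝 0] partialDeriv i g := by
  filter_upwards [EventuallyEq.fderiv (𝕜 := ℝ) h] with x hx
  simp only [partialDeriv, hx]

theorem iterate_partialDeriv_congr (i : Fin n) (k : ℕ) (h : f =ᶠ[𝓝 0] g) :
    (partialDeriv i)^[k] f =ᶠ[𝓝 0] (partialDeriv i)^[k] g := by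
  induction k with
  | zero => exact h
  | succ k ih =>
    rw [Function.iterate_succ_apply', Function.iterate_succ_apply']
    exact partialDeriv_congr i ih

theorem WeaklySmooth.partialDeriv (hf : WeaklySmooth f) (i : Fin n) :
    WeaklySmooth (partialDeriv i f) := fun p =>
  ((hf (p + 1)).fderiv_right (m := p) (by simp)).clm_apply contDiffAt_const

theorem WeaklySmooth.iterate_partialDeriv (hf : WeaklySmooth f) (i : Fin n) (k : ℕ) :
    WeaklySmooth ((HGerm.partialDeriv i)^[k] f) := by
  induction k with
  | zero => exact hf
  | succ k ih =>
    rw [Function.iterate_succ_apply']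
    exact ih.partialDeriv i

theorem partialDeriv_comm (hf : WeaklySmooth f) (i j : Fin n) :
    partialDeriv i (partialDeriv j f) =ᶠ[𝓝 0] partialDeriv j (partialDeriv i f) := by
  filter_upwards [(hf 2).eventually (by simp)] with x hx
  have hd : DifferentiableAt ℝ (fderiv ℝ f) x :=
    (hx.fderiv_right (m := 1) (by norm_num)).differentiableAt (by simp)
  have key : ∀ a b : Fin n, partialDeriv a (partialDeriv b f) x =
      fderiv ℝ (fderiv ℝ f) x (Pi.single a 1) (Pi.single b 1) := fun a b => by
    unfold partialDeriv
    rw [fderiv_clm_apply hd (differentiableAt_const _)]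
    simp
  rw [key, key]
  exact (hx.isSymmSndFDerivAt (by simp)) _ _

/-- The iterated derivative along the multi-index `α`, restricted to the variables of a list. -/
noncomputable def listPartialDeriv (l : List (Fin n)) (α : Fin n →₀ ℕ) (f : (Fin n → ℝ) → ℝ) :
    (Fin n → ℝ) → ℝ :=
  l.foldr (fun i g => (partialDeriv i)^[α i] g) f

theorem WeaklySmooth.listPartialDeriv (hf : WeaklySmooth f) (l : List (Fin n)) (α : Fin n →₀ ℕ) :
    WeaklySmooth (listPartialDeriv l α f) := by
  induction l with
  | nil => exact hf
  | cons j l ih => exact ih.iterate_partialDeriv j _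

theorem listPartialDeriv_congr (l : List (Fin n)) (α : Fin n →₀ ℕ) (h : f =ᶠ[𝓝 0] g) :
    listPartialDeriv l α f =ᶠ[𝓝 0] listPartialDeriv l α g := by
  induction l with
  | nil => exact h
  | cons j l ih => exact iterate_partialDeriv_congr j _ ih

theorem iterate_partialDeriv_comm (hf : WeaklySmooth f) (i j : Fin n) (k : ℕ) :
    (partialDeriv j)^[k] (partialDeriv i f) =ᶠ[𝓝 0] partialDeriv i ((partialDeriv j)^[k] f) := by
  induction k with
  | zero => rfl
  | succ k ih =>
    rw [Function.iterate_succ_apply', Function.iterate_succ_apply']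
    exact (partialDeriv_congr j ih).trans (partialDeriv_comm (hf.iterate_partialDeriv j k) j i)

theorem listPartialDeriv_comm (hf : WeaklySmooth f) (i : Fin n) (l : List (Fin n))
    (α : Fin n →₀ ℕ) :
    listPartialDeriv l α (partialDeriv i f) =ᶠ[𝓝 0] partialDeriv i (listPartialDeriv l α f) := by
  induction l with
  | nil => rfl
  | cons j l ih =>
    exact (iterate_partialDeriv_congr j _ ih).trans
      (iterate_partialDeriv_comm (hf.listPartialDeriv l α) i j _)

theorem listPartialDeriv_add_single_of_notMem {i : Fin n} {l : List (Fin n)} (hi : i ∉ l)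
    (α : Fin n →₀ ℕ) :
    listPartialDeriv l (α + Finsupp.single i 1) f = listPartialDeriv l α f := by
  induction l with
  | nil => rfl
  | cons j l ih =>
    have hij : i ≠ j := fun h => hi (h ▸ List.mem_cons_self)
    have hil : i ∉ l := fun h => hi (List.mem_cons_of_mem _ h)
    show (partialDeriv j)^[_] (listPartialDeriv l _ f) =
      (partialDeriv j)^[_] (listPartialDeriv l _ f)
    rw [ih hil, Finsupp.add_apply, Finsupp.single_eq_of_ne hij.symm, add_zero]

theorem listPartialDeriv_partialDeriv (hf : WeaklySmooth f) {i : Fin n} {l : List (Fin n)}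
    (hl : l.Nodup) (hi : i ∈ l) (α : Fin n →₀ ℕ) :
    listPartialDeriv l α (partialDeriv i f) =ᶠ[𝓝 0]
      listPartialDeriv l (α + Finsupp.single i 1) f := by
  induction l with
  | nil => simp at hi
  | cons j l ih =>
    show (partialDeriv j)^[_] (listPartialDeriv l _ (partialDeriv i f)) =ᶠ[𝓝 0]
      (partialDeriv j)^[_] (listPartialDeriv l _ f)
    rcases List.mem_cons.1 hi with rfl | h
    · have hil : i ∉ l := (List.nodup_cons.1 hl).1
      rw [listPartialDeriv_add_single_of_notMem hil, Finsupp.add_apply, Finsupp.single_eq_same,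
        Function.iterate_succ_apply]
      exact iterate_partialDeriv_congr i _ (listPartialDeriv_comm hf i l α)
    · have hij : i ≠ j := fun hij => (List.nodup_cons.1 hl).1 (hij ▸ h)
      rw [Finsupp.add_apply, Finsupp.single_eq_of_ne hij.symm, add_zero]
      exact iterate_partialDeriv_congr j _ (ih (List.nodup_cons.1 hl).2 h)

theorem coeff_taylor (f : (Fin n → ℝ) → ℝ) (α : Fin n →₀ ℕ) :
    MvPowerSeries.coeff α (taylor f) =
      iterPartialDeriv α f 0 / ∏ i, ((α i).factorial : ℝ) := rfl

theorem taylor_congr (h : f =ᶠ[𝓝 0] g) : taylor f = taylor g := by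
  ext α
  rw [coeff_taylor, coeff_taylor]
  congr 1
  exact (listPartialDeriv_congr (List.finRange n) α h).eq_of_nhds

theorem coeff_taylor_partialDeriv (hf : WeaklySmooth f) (i : Fin n) (α : Fin n →₀ ℕ) :
    MvPowerSeries.coeff α (taylor (partialDeriv i f)) =
      MvPowerSeries.coeff (α + Finsupp.single i 1) (taylor f) * (α i + 1) := by
  rw [coeff_taylor, coeff_taylor]
  have h : iterPartialDeriv α (partialDeriv i f) 0 =
      iterPartialDeriv (α + Finsupp.single i 1) f 0 :=
    (listPartialDeriv_partialDeriv hf (List.nodup_finRange n) (List.mem_finRange i) α).eq_of_nhds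
  have h2 : ∏ j, (((α + Finsupp.single i 1 : Fin n →₀ ℕ) j).factorial : ℝ) =
      (α i + 1) * ∏ j, ((α j).factorial : ℝ) := by
    rw [← Finset.mul_prod_erase _ _ (Finset.mem_univ i),
      ← Finset.mul_prod_erase Finset.univ (fun j => ((α j).factorial : ℝ)) (Finset.mem_univ i)]
    rw [← mul_assoc]
    congr 1
    · rw [Finsupp.add_apply, Finsupp.single_eq_same, Nat.factorial_succ]
      push_cast
      ring
    · refine Finset.prod_congr rfl fun j hj => ?_
      rw [Finsupp.add_apply, Finsupp.single_eq_of_ne (Finset.ne_of_mem_erase hj), add_zero]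
  rw [h, h2]
  have h3 : ∏ j, ((α j).factorial : ℝ) ≠ 0 :=
    Finset.prod_ne_zero_iff.2 fun j _ => by exact_mod_cast Nat.factorial_ne_zero _
  have h4 : (α i : ℝ) + 1 ≠ 0 := by positivity
  field_simp

theorem partialDeriv_eval (i : Fin n) (P : MvPolynomial (Fin n) ℝ) :
    partialDeriv i (fun x => MvPolynomial.eval x P) =
      fun x => MvPolynomial.eval x (MvPolynomial.pderiv i P) := by
  have hd : ∀ (P : MvPolynomial (Fin n) ℝ) (x : Fin n → ℝ),
      DifferentiableAt ℝ (fun x => MvPolynomial.eval x P) x := fun P x => by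
    induction P using MvPolynomial.induction_on with
    | C a => simp
    | add P Q hP hQ => simpa only [map_add] using hP.fun_add hQ
    | mul_X P i hP =>
      simpa only [map_mul, MvPolynomial.eval_X] using hP.fun_mul (differentiableAt_apply i x)
  funext x
  unfold partialDeriv
  induction P using MvPolynomial.induction_on with
  | C a => simp
  | add P Q hP hQ =>
    simp only [map_add]
    rw [fderiv_fun_add (hd P x) (hd Q x), add_apply, hP, hQ]
  | mul_X P j hP =>
    simp only [map_mul, MvPolynomial.eval_X, Derivation.leibniz, smul_eq_mul, map_add]
    rw [fderiv_fun_mul (hd P x) (differentiableAt_apply j x)]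
    have : fderiv ℝ (fun x : Fin n → ℝ => x j) x (Pi.single i 1) =
        MvPolynomial.eval x (MvPolynomial.pderiv i (MvPolynomial.X j)) := by
      rw [MvPolynomial.pderiv_X, (hasFDerivAt_apply j x).fderiv]
      by_cases h : i = j
      · subst h; simp
      · simp [Ne.symm h]
    simp [hP, this]

/-- Estimates of order `p` on the partial derivatives integrate to an estimate of order `p + 1`. -/
theorem isBigO_pow_succ_of_partialDeriv (hf : WeaklySmooth f) (h0 : f 0 = 0) {p : ℕ}
    (h : ∀ i, partialDeriv i f =O[𝓝 0] fun x => ‖x‖ ^ p) :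
    f =O[𝓝 0] fun x => ‖x‖ ^ (p + 1) := by
  have hD : (fderiv ℝ f) =O[𝓝 0] fun x => ‖x‖ ^ p := by
    have hle : ∀ x, ‖fderiv ℝ f x‖ ≤ ∑ i, ‖partialDeriv i f x‖ := fun x => by
      refine ContinuousLinearMap.opNorm_le_bound _ (by positivity) fun v => ?_
      have hv : v = ∑ i, v i • (Pi.single i 1 : Fin n → ℝ) := by
        rw [← Finset.univ_sum_single v]
        simp [Finset.sum_apply, Pi.single_apply, ← Pi.single_smul]
      conv_lhs => rw [hv, map_sum]
      refine (norm_sum_le _ _).trans ?_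
      rw [Finset.sum_mul]
      refine Finset.sum_le_sum fun i _ => ?_
      rw [map_smul, norm_smul, mul_comm]
      exact mul_le_mul_of_nonneg_left (norm_le_pi_norm v i) (norm_nonneg _)
    have hs : (fun x => ∑ i, ‖partialDeriv i f x‖) =O[𝓝 0] fun x : Fin n → ℝ => ‖x‖ ^ p :=
      Asymptotics.IsBigO.fun_sum fun i _ => (h i).norm_left
    refine Asymptotics.IsBigO.trans (Asymptotics.IsBigO.of_bound 1
      (Eventually.of_forall fun x => ?_)) hs
    rw [one_mul]
    exact (hle x).trans (le_abs_self _)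
  obtain ⟨C, hC⟩ := hD.bound
  obtain ⟨r, hr, hball⟩ := Metric.eventually_nhds_iff_ball.1
    (hC.and hf.eventually_differentiableAt)
  refine Asymptotics.IsBigO.of_bound |C| ?_
  filter_upwards [Metric.ball_mem_nhds (0 : Fin n → ℝ) hr] with x hx
  have hsub : ∀ y ∈ Metric.closedBall (0 : Fin n → ℝ) ‖x‖, y ∈ Metric.ball (0 : Fin n → ℝ) r :=
    fun y hy => by
      rw [mem_closedBall_zero_iff] at hy
      rw [mem_ball_zero_iff] at hx ⊢
      exact hy.trans_lt hx
  have hC0 : ∀ y ∈ Metric.closedBall (0 : Fin n → ℝ) ‖x‖, ‖fderiv ℝ f y‖ ≤ |C| * ‖x‖ ^ p :=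
    fun y hy => by
      have := (hball y (hsub y hy)).1
      rw [norm_pow, norm_norm] at this
      have hy' := mem_closedBall_zero_iff.1 hy
      calc _ ≤ C * ‖y‖ ^ p := this
        _ ≤ |C| * ‖y‖ ^ p := by gcongr; exact le_abs_self C
        _ ≤ _ := by gcongr
  have := (convex_closedBall (0 : Fin n → ℝ) ‖x‖).norm_image_sub_le_of_norm_fderiv_le (𝕜 := ℝ)
    (fun y hy => (hball y (hsub y hy)).2) hC0 (Metric.mem_closedBall_self (norm_nonneg x))
    (mem_closedBall_zero_iff.2 le_rfl)
  rw [h0, sub_zero, sub_zero] at this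
  rw [norm_pow, norm_norm, pow_succ, ← mul_assoc]
  exact this

/-- Taylor's formula, by induction on the order of the estimate: the partial derivatives of the
truncated Taylor series are the truncated Taylor series of the partial derivatives. -/
theorem WeaklySmooth.hasExpansion (hf : WeaklySmooth f) : HasExpansion f (taylor f) := by
  intro p
  induction p generalizing f with
  | zero =>
    have : Tendsto (fun x => f x - MvPolynomial.eval x ((taylor f).truncTotal 0)) (𝓝 0)
        (𝓝 (f 0 - MvPolynomial.eval 0 ((taylor f).truncTotal 0))) :=
      (hf 0).continuousAt.sub (MvPolynomial.continuous_eval _).continuousAt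
    simpa only [pow_zero] using this.isBigO_one ℝ
  | succ p ih =>
    refine isBigO_pow_succ_of_partialDeriv (hf.sub (weaklySmooth_eval _)) ?_ fun i => ?_
    · rw [MvPolynomial.eval_zero, MvPolynomial.constantCoeff_eq,
        MvPowerSeries.coeff_truncTotal _ (by simp), coeff_taylor]
      have : iterPartialDeriv 0 f = f := by
        unfold iterPartialDeriv
        induction List.finRange n with
        | nil => rfl
        | cons a l ih => simp
      simp [this]
    · refine (ih (hf.partialDeriv i)).congr' ?_ EventuallyEq.rfl
      filter_upwards [hf.eventually_differentiableAt,
        (weaklySmooth_eval ((taylor f).truncTotal (p + 1))).eventually_differentiableAt]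
        with x hx hx2
      have h1 : HGerm.partialDeriv i
          (fun x => f x - MvPolynomial.eval x ((taylor f).truncTotal (p + 1))) x =
          HGerm.partialDeriv i f x -
            HGerm.partialDeriv i
              (fun x => MvPolynomial.eval x ((taylor f).truncTotal (p + 1))) x := by
        simp only [HGerm.partialDeriv]
        rw [fderiv_fun_sub hx hx2]
        rfl
      rw [h1, partialDeriv_eval]
      congr 2
      ext α
      rw [MvPolynomial.coeff_pderiv, MvPowerSeries.coeff_truncTotal_eq_ite,
        MvPowerSeries.coeff_truncTotal_eq_ite, coeff_taylor_partialDeriv hf]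
      have : (α + Finsupp.single i 1).degree = α.degree + 1 := by simp
      rw [this]
      by_cases h : α.degree < p
      · rw [if_pos h, if_pos (by omega)]
      · rw [if_neg h, if_neg (by omega), zero_mul]

/-- Taylor series are computed by exhibiting an asymptotic expansion. -/
theorem HasExpansion.taylor_eq {F : MvPowerSeries (Fin n) ℝ} (h : HasExpansion f F)
    (hf : WeaklySmooth f) : taylor f = F :=
  hf.hasExpansion.unique h

end Taylor

end HGerm

namespace HGerm

/-! ### Division by a coordinate -/

/-- Integration over a compact interval preserves `C^p` dependence on a parameter. -/
theorem contDiff_intervalIntegral {E F : Type} [NormedAddCommGroup E] [NormedSpace ℝ E]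
    [ProperSpace E] [NormedAddCommGroup F] [NormedSpace ℝ F] [CompleteSpace F]
    {p : ℕ} {g : E × ℝ → F} (hg : ContDiff ℝ p g) :
    ContDiff ℝ p fun x => ∫ t in (0 : ℝ)..1, g (x, t) := by
  induction p generalizing F with
  | zero =>
    have hc : Continuous g := contDiff_zero (𝕜 := ℝ) |>.1 (by simpa using hg)
    have : Continuous fun x => ∫ t in (0 : ℝ)..1, g (x, t) :=
      intervalIntegral.continuous_parametric_intervalIntegral_of_continuous'
        (f := fun x t => g (x, t))
        (show Continuous (Function.uncurry fun x t => g (x, t)) from hc) 0 1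
    simpa using (contDiff_zero (𝕜 := ℝ)).2 this
  | succ p ih =>
    have hp : ((p + 1 : ℕ) : WithTop ℕ∞) = (p : WithTop ℕ∞) + 1 := by push_cast; rfl
    rw [hp] at hg ⊢
    have hD : ContDiff ℝ p (fderiv ℝ g) := hg.fderiv_right le_rfl
    set g' : E × ℝ → E →L[ℝ] F := fun z => (fderiv ℝ g z).comp (ContinuousLinearMap.inl ℝ E ℝ)
      with hg'
    have hg'c : ContDiff ℝ p g' := hD.clm_comp contDiff_const
    rw [contDiff_succ_iff_hasFDerivAt]
    refine ⟨fun x => ∫ t in (0 : ℝ)..1, g' (x, t), ih hg'c, fun x => ?_⟩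
    have hgc : Continuous g := hg.continuous
    have hg'cont : Continuous g' := hg'c.continuous
    obtain ⟨C, hC⟩ := ((isCompact_closedBall x 1).prod (isCompact_Icc (a := (0 : ℝ)) (b := 1))
      ).exists_bound_of_continuousOn hg'cont.continuousOn
    refine intervalIntegral.hasFDerivAt_integral_of_dominated_of_fderiv_le (𝕜 := ℝ)
      (F := fun x t => g (x, t)) (F' := fun x t => g' (x, t)) (bound := fun _ => C)
      (Metric.closedBall_mem_nhds x one_pos) ?_ ?_ ?_ ?_ ?_ ?_
    · refine Eventually.of_forall fun y => ?_
      exact (show Continuous fun t => g (y, t) by fun_prop).aestronglyMeasurable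
    · exact (show Continuous fun t => g (x, t) by fun_prop).intervalIntegrable _ _
    · exact (show Continuous fun t => g' (x, t) by fun_prop).aestronglyMeasurable
    · refine Eventually.of_forall fun t ht y hy => hC (y, t) ⟨hy, ?_⟩
      rw [Set.uIoc_of_le zero_le_one] at ht
      exact ⟨ht.1.le, ht.2⟩
    · exact intervalIntegrable_const
    · refine Eventually.of_forall fun t _ y _ => ?_
      have h1 : HasFDerivAt g (fderiv ℝ g (y, t)) (y, t) :=
        (hg.differentiable (by simp) (y, t)).hasFDerivAt
      exact h1.comp y (hasFDerivAt_prodMk_left y t)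

variable {n : ℕ} {f g : (Fin n → ℝ) → ℝ}

/-- A germ that is `C^p` near `0` has a representative that is `C^p` everywhere. -/
theorem exists_contDiff_eventuallyEq {p : ℕ} (hf : ContDiffAt ℝ p f 0) :
    ∃ φ : (Fin n → ℝ) → ℝ, ContDiff ℝ p φ ∧ φ =ᶠ[𝓝 0] f := by
  obtain ⟨r, hr, hball⟩ := Metric.eventually_nhds_iff_ball.1 (hf.eventually (by simp))
  let b : ContDiffBump (0 : Fin n → ℝ) := ⟨r / 4, r / 2, by positivity, by linarith⟩
  refine ⟨fun x => b x * f x, contDiff_iff_contDiffAt.2 fun x => ?_, ?_⟩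
  · by_cases hx : x ∈ Metric.ball (0 : Fin n → ℝ) r
    · exact b.contDiff.contDiffAt.mul (hball x hx)
    · have hz : (fun x => b x * f x) =ᶠ[𝓝 x] fun _ => 0 := by
        have : x ∉ tsupport b := by
          rw [b.tsupport_eq]
          intro h
          apply hx
          rw [mem_closedBall_zero_iff] at h
          rw [mem_ball_zero_iff]
          have : b.rOut = r / 2 := rfl
          linarith
        filter_upwards [notMem_tsupport_iff_eventuallyEq.1 this] with y hy
        rw [hy]
        simp
      exact contDiffAt_const.congr_of_eventuallyEq hz
  · filter_upwards [b.eventuallyEq_one] with x hx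
    simp [hx]

/-- Hadamard's lemma: if `φ` is `C^(p+1)`, then `φ - φ|_{x_i = 0}` is `x_i` times a `C^p`
function. -/
theorem exists_contDiff_mul_coordinate {p : ℕ} {φ : (Fin n → ℝ) → ℝ} (hφ : ContDiff ℝ (p + 1) φ)
    (i : Fin n) : ∃ g : (Fin n → ℝ) → ℝ, ContDiff ℝ p g ∧
      ∀ x, φ x - φ (Function.update x i 0) = x i * g x := by
  have hD : ContDiff ℝ p (partialDeriv i φ) :=
    (hφ.fderiv_right (m := p) le_rfl).clm_apply contDiff_const
  have hu : ContDiff ℝ p fun z : (Fin n → ℝ) × ℝ => Function.update z.1 i (z.2 * z.1 i) := by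
    refine contDiff_pi.2 fun j => ?_
    by_cases h : j = i
    · subst h
      simp only [Function.update_self]
      fun_prop
    · simp only [Function.update_of_ne h]
      fun_prop
  refine ⟨fun x => ∫ t in (0 : ℝ)..1, partialDeriv i φ (Function.update x i (t * x i)),
    contDiff_intervalIntegral (hD.comp hu), fun x => ?_⟩
  have hder : ∀ t ∈ Set.uIcc (0 : ℝ) 1, HasDerivAt (fun t => φ (Function.update x i (t * x i)))
      (x i * partialDeriv i φ (Function.update x i (t * x i))) t := fun t _ => by
    have h1 : HasDerivAt (fun t : ℝ => Function.update x i (t * x i)) (Pi.single i (x i)) t := by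
      have h2 : HasDerivAt (fun t : ℝ => t * x i) (x i) t := by
        simpa using (hasDerivAt_id t).mul_const (x i)
      refine hasDerivAt_pi.2 fun j => ?_
      by_cases h : j = i
      · subst h
        simpa using h2
      · simpa [h] using hasDerivAt_const t (x j)
    have h3 := ((hφ.differentiable (by simp)
      (Function.update x i (t * x i))).hasFDerivAt).comp_hasDerivAt t h1
    refine h3.congr_deriv ?_
    have : (Pi.single i (x i) : Fin n → ℝ) = x i • Pi.single i 1 := by
      rw [← Pi.single_smul]; simp
    rw [this, map_smul]
    rfl
  have hint : IntervalIntegrable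
      (fun t => x i * partialDeriv i φ (Function.update x i (t * x i)))
      MeasureTheory.volume 0 1 := by
    refine Continuous.intervalIntegrable ?_ _ _
    refine continuous_const.mul ((hD.continuous.comp hu.continuous).comp
      (g := fun z => _) (f := fun t : ℝ => (x, t)) (by fun_prop))
  have := intervalIntegral.integral_eq_sub_of_hasDerivAt hder hint
  rw [intervalIntegral.integral_const_mul] at this
  rw [this]
  simp

/-- The points off a coordinate hyperplane are dense near `0`, so that continuous functions that
agree there agree. -/
theorem eventuallyEq_of_eventually_ne (i : Fin n)
    (hf : ∀ᶠ x in 𝓝 (0 : Fin n → ℝ), ContinuousAt f x)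
    (hg : ∀ᶠ x in 𝓝 (0 : Fin n → ℝ), ContinuousAt g x)
    (h : ∀ᶠ x in 𝓝 (0 : Fin n → ℝ), x i ≠ 0 → f x = g x) : f =ᶠ[𝓝 0] g := by
  filter_upwards [hf, hg, h.eventually_nhds] with x hfx hgx hx
  by_cases hxi : x i = 0
  · have hlim : Tendsto (fun t : ℝ => Function.update x i t) (𝓝[≠] 0) (𝓝 x) := by
      have h1 : Tendsto (fun t : ℝ => Function.update x i t) (𝓝 0) (𝓝 (Function.update x i 0)) :=
        Continuous.tendsto (by fun_prop) 0
      rw [← hxi, Function.update_eq_self, hxi] at h1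
      exact h1.mono_left nhdsWithin_le_nhds
    have h2 := hfx.tendsto.comp hlim
    have h3 := hgx.tendsto.comp hlim
    refine tendsto_nhds_unique (h2.congr' ?_) h3
    filter_upwards [hlim.eventually hx, self_mem_nhdsWithin] with t ht ht0
    exact ht (by simpa using ht0)
  · exact hx.self_of_nhds hxi

/-- The quotient of `f` by `x_i` for each order of differentiability `p`; the germs obtained for
different `p` agree, but their representatives need not. -/
theorem exists_contDiff_quotient (hf : WeaklySmooth f) (i : Fin n)
    (hzero : ∀ᶠ x in 𝓝 (0 : Fin n → ℝ), x i = 0 → f x = 0) (p : ℕ) :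
    ∃ g : (Fin n → ℝ) → ℝ, ContDiff ℝ p g ∧ ∀ᶠ x in 𝓝 0, f x = x i * g x := by
  obtain ⟨φ, hφ, hφf⟩ := exists_contDiff_eventuallyEq (hf (p + 1))
  obtain ⟨g, hg, hgφ⟩ := exists_contDiff_mul_coordinate (p := p) (by exact_mod_cast hφ) i
  refine ⟨g, hg, ?_⟩
  have hlim : Tendsto (fun x : Fin n → ℝ => Function.update x i 0) (𝓝 0) (𝓝 0) := by
    have : Tendsto (fun x : Fin n → ℝ => Function.update x i 0) (𝓝 0)
        (𝓝 (Function.update (0 : Fin n → ℝ) i 0)) := Continuous.tendsto (by fun_prop) 0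
    rwa [show Function.update (0 : Fin n → ℝ) i 0 = 0 from Function.update_eq_self i 0] at this
  filter_upwards [hφf, hlim.eventually hφf, hlim.eventually hzero] with x h1 h2 h3
  rw [← hgφ x, h1, h2, h3 (by simp), sub_zero]

theorem weaklySmooth_of_quotient (hf : WeaklySmooth f) (i : Fin n)
    (hzero : ∀ᶠ x in 𝓝 (0 : Fin n → ℝ), x i = 0 → f x = 0)
    (hcont : ∀ᶠ x in 𝓝 (0 : Fin n → ℝ), ContinuousAt g x)
    (hquot : ∀ᶠ x in 𝓝 (0 : Fin n → ℝ), x i ≠ 0 → g x = f x / x i) : WeaklySmooth g := by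
  intro p
  obtain ⟨q, hq, hqf⟩ := exists_contDiff_quotient hf i hzero p
  refine hq.contDiffAt.congr_of_eventuallyEq ?_
  refine eventuallyEq_of_eventually_ne i hcont
    (Eventually.of_forall fun x => hq.continuous.continuousAt) ?_
  filter_upwards [hquot, hqf] with x h1 h2 hx
  rw [h1 hx, h2]
  field_simp

/-! ### The algebras of germs -/

variable {H : ℝ → ℝ}

theorem InAlg.weaklySmooth (hH : IsQuasianalyticGenerator H) (hf : InAlg H n f) :
    WeaklySmooth f := by
  induction hf with
  | congr _ hfg ih => exact ih.congr hfg
  | self =>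
    exact fun p => ContDiffAt.comp (𝕜 := ℝ) (g := H) (f := fun x : Fin 1 → ℝ => x 0) 0
      (hH.weaklySmooth p) (contDiff_apply ℝ ℝ 0).contDiffAt
  | poly P => exact weaklySmooth_eval P
  | add _ _ ihf ihg => exact ihf.add ihg
  | mul _ _ ihf ihg => exact ihf.mul ihg
  | div i _ hzero hcont hquot ih => exact weaklySmooth_of_quotient ih i hzero hcont hquot
  | comp _ _ hg0 ihf ihg => exact ihf.comp ihg hg0
  | implicit _ _ _ hφ _ _ _ => exact hφ

/-- The Taylor series of the germs in `𝒜_n(H)`. -/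
def IsAlgSeries (H : ℝ → ℝ) {n : ℕ} (F : MvPowerSeries (Fin n) ℝ) : Prop :=
  ∃ f, InAlg H n f ∧ taylor f = F

section AlgSeries

variable {m : ℕ} {F G : MvPowerSeries (Fin n) ℝ}

theorem InAlg.hasExpansion (hH : IsQuasianalyticGenerator H) (hf : InAlg H n f) :
    HasExpansion f (taylor f) := (hf.weaklySmooth hH).hasExpansion

theorem isAlgSeries_coe (P : MvPolynomial (Fin n) ℝ) :
    IsAlgSeries H (P : MvPowerSeries (Fin n) ℝ) :=
  ⟨_, InAlg.poly P, (hasExpansion_eval P).taylor_eq (weaklySmooth_eval P)⟩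

theorem isAlgSeries_X (i : Fin n) :
    IsAlgSeries H (MvPowerSeries.X i : MvPowerSeries (Fin n) ℝ) := by
  simpa using isAlgSeries_coe (H := H) (MvPolynomial.X i : MvPolynomial (Fin n) ℝ)

theorem isAlgSeries_C (c : ℝ) : IsAlgSeries H (MvPowerSeries.C c : MvPowerSeries (Fin n) ℝ) := by
  simpa using isAlgSeries_coe (H := H) (MvPolynomial.C c : MvPolynomial (Fin n) ℝ)

theorem isAlgSeries_one : IsAlgSeries H (1 : MvPowerSeries (Fin n) ℝ) := by
  simpa using isAlgSeries_coe (H := H) (1 : MvPolynomial (Fin n) ℝ)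

theorem isAlgSeries_zero : IsAlgSeries H (0 : MvPowerSeries (Fin n) ℝ) := by
  simpa using isAlgSeries_coe (H := H) (0 : MvPolynomial (Fin n) ℝ)

theorem IsAlgSeries.add (hH : IsQuasianalyticGenerator H) (hF : IsAlgSeries H F)
    (hG : IsAlgSeries H G) : IsAlgSeries H (F + G) := by
  obtain ⟨f, hf, rfl⟩ := hF
  obtain ⟨g, hg, rfl⟩ := hG
  exact ⟨_, hf.add hg, ((hf.hasExpansion hH).add (hg.hasExpansion hH)).taylor_eq
    ((hf.add hg).weaklySmooth hH)⟩

theorem IsAlgSeries.mul (hH : IsQuasianalyticGenerator H) (hF : IsAlgSeries H F)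
    (hG : IsAlgSeries H G) : IsAlgSeries H (F * G) := by
  obtain ⟨f, hf, rfl⟩ := hF
  obtain ⟨g, hg, rfl⟩ := hG
  exact ⟨_, hf.mul hg, ((hf.hasExpansion hH).mul (hg.hasExpansion hH)).taylor_eq
    ((hf.mul hg).weaklySmooth hH)⟩

theorem IsAlgSeries.neg (hH : IsQuasianalyticGenerator H) (hF : IsAlgSeries H F) :
    IsAlgSeries H (-F) := by
  have := (isAlgSeries_C (H := H) (n := n) (-1)).mul hH hF
  simpa using this

theorem IsAlgSeries.sub (hH : IsQuasianalyticGenerator H) (hF : IsAlgSeries H F)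
    (hG : IsAlgSeries H G) : IsAlgSeries H (F - G) := by
  rw [sub_eq_add_neg]
  exact hF.add hH (hG.neg hH)

theorem IsAlgSeries.pow (hH : IsQuasianalyticGenerator H) (hF : IsAlgSeries H F) (k : ℕ) :
    IsAlgSeries H (F ^ k) := by
  induction k with
  | zero => simpa using isAlgSeries_one
  | succ k ih => simpa only [pow_succ] using ih.mul hH hF

theorem IsAlgSeries.prod (hH : IsQuasianalyticGenerator H) {ι : Type*} {s : Finset ι}
    {F : ι → MvPowerSeries (Fin n) ℝ} (hF : ∀ i ∈ s, IsAlgSeries H (F i)) :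
    IsAlgSeries H (∏ i ∈ s, F i) :=
  Finset.prod_induction F (IsAlgSeries H) (fun _ _ h1 h2 => h1.mul hH h2) isAlgSeries_one hF

theorem InAlg.constantCoeff_taylor (hH : IsQuasianalyticGenerator H) (hf : InAlg H n f) :
    MvPowerSeries.constantCoeff (taylor f) = f 0 := (hf.hasExpansion hH).apply_zero.symm

/-- Chain rule for Taylor series. -/
theorem taylor_comp {f : (Fin m → ℝ) → ℝ} {g : Fin m → (Fin n → ℝ) → ℝ} (hf : WeaklySmooth f)
    (hg : ∀ i, WeaklySmooth (g i)) (hg0 : ∀ i, g i 0 = 0) :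
    taylor (fun x => f fun i => g i x) = MvPowerSeries.subst (fun i => taylor (g i)) (taylor f) :=
  (hf.hasExpansion.comp (fun i => (hg i).hasExpansion) hg0).taylor_eq (hf.comp hg hg0)

theorem IsAlgSeries.subst (hH : IsQuasianalyticGenerator H) {F : MvPowerSeries (Fin m) ℝ}
    {G : Fin m → MvPowerSeries (Fin n) ℝ} (hF : IsAlgSeries H F) (hG : ∀ i, IsAlgSeries H (G i))
    (hG0 : ∀ i, MvPowerSeries.constantCoeff (G i) = 0) :
    IsAlgSeries H (MvPowerSeries.subst G F) := by
  obtain ⟨f, hf, rfl⟩ := hF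
  choose g hg hgG using hG
  have hg0 : ∀ i, g i 0 = 0 := fun i => by
    rw [← (hg i).constantCoeff_taylor hH, hgG, hG0]
  refine ⟨_, hf.comp hg hg0, ?_⟩
  rw [taylor_comp (hf.weaklySmooth hH) (fun i => (hg i).weaklySmooth hH) hg0]
  simp only [hgG]

end AlgSeries

end HGerm

namespace HGerm

variable {H : ℝ → ℝ} {n m : ℕ}

theorem taylor_eval (P : MvPolynomial (Fin n) ℝ) :
    taylor (fun x => MvPolynomial.eval x P) = P :=
  (hasExpansion_eval P).taylor_eq (weaklySmooth_eval P)

/-- Stability under division by a coordinate. Quasianalyticity turns the divisibility of the Taylor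
series into the vanishing of the germ on the coordinate hyperplane. -/
theorem IsAlgSeries.of_X_mul (hH : IsQuasianalyticGenerator H) {i : Fin n}
    {F : MvPowerSeries (Fin n) ℝ} (hF : IsAlgSeries H (MvPowerSeries.X i * F)) :
    IsAlgSeries H F := by
  obtain ⟨f, hf, hfF⟩ := hF
  have hfs := hf.weaklySmooth hH
  -- The composition of `f` with `P` is the restriction of `f` to `x_i = 0`.
  let P : Fin n → MvPolynomial (Fin n) ℝ := fun j => if j = i then 0 else MvPolynomial.X j
  have hP0 : ∀ j, MvPolynomial.eval (0 : Fin n → ℝ) (P j) = 0 := fun j => by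
    by_cases h : j = i <;> simp [P, h]
  have hrestr : InAlg H n fun x => f fun j => MvPolynomial.eval x (P j) :=
    hf.comp (g := fun j x => MvPolynomial.eval x (P j)) (fun j => InAlg.poly (P j)) hP0
  have hzero : (fun x => f fun j => MvPolynomial.eval x (P j)) =ᶠ[𝓝 0]
      fun x => MvPolynomial.eval x 0 := by
    refine hH.quasianalytic n _ _ hrestr (InAlg.poly 0) ?_
    rw [taylor_comp (g := fun j x => MvPolynomial.eval x (P j)) hfs
      (fun j => weaklySmooth_eval (P j)) hP0, taylor_eval, hfF]
    have hs : MvPowerSeries.HasSubst fun j => taylor fun x => MvPolynomial.eval x (P j) :=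
      hasSubst_of_hasExpansion (fun j => (weaklySmooth_eval (P j)).hasExpansion) hP0
    rw [MvPowerSeries.subst_mul hs, MvPowerSeries.subst_X hs, taylor_eval]
    simp [P]
  have hzero' : ∀ᶠ x in 𝓝 (0 : Fin n → ℝ), x i = 0 → f x = 0 := by
    filter_upwards [hzero] with x hx hxi
    rw [map_zero] at hx
    convert hx using 2
    funext j
    by_cases h : j = i
    · subst h; simp [P, hxi]
    · simp [P, h]
  obtain ⟨g, hg, hgf⟩ := exists_contDiff_quotient hfs i hzero' 0
  have hgA : InAlg H n g := by
    refine InAlg.div i hf hzero' (Eventually.of_forall fun x => hg.continuous.continuousAt) ?_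
    filter_upwards [hgf] with x hx hxi
    rw [hx]
    field_simp
  refine ⟨g, hgA, ?_⟩
  have h1 : HasExpansion f (MvPowerSeries.X i * taylor g) := by
    have h2 : HasExpansion (fun x : Fin n → ℝ => x i) (MvPowerSeries.X i) := by
      simpa using hasExpansion_eval (MvPolynomial.X i : MvPolynomial (Fin n) ℝ)
    exact (h2.mul (hgA.hasExpansion hH)).congr (EventuallyEq.symm hgf)
  have h3 : (MvPowerSeries.X i : MvPowerSeries (Fin n) ℝ) ≠ 0 := by
    intro h0
    have := congrArg (MvPowerSeries.coeff (Finsupp.single i 1)) h0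
    simp [MvPowerSeries.coeff_X] at this
  exact mul_left_cancel₀ h3 ((h1.taylor_eq hfs).symm.trans hfF)

theorem coeff_single_taylor {f : (Fin n → ℝ) → ℝ} (hf : WeaklySmooth f) (i : Fin n) :
    MvPowerSeries.coeff (Finsupp.single i 1) (taylor f) = partialDeriv i f 0 := by
  have h1 := coeff_taylor_partialDeriv hf i 0
  rw [MvPowerSeries.coeff_zero_eq_constantCoeff_apply,
    ← (hf.partialDeriv i).hasExpansion.apply_zero] at h1
  simpa using h1.symm

/-- The implicit function theorem for the algebras `𝒜_n(H)`, in terms of Taylor series. -/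
theorem IsAlgSeries.exists_implicit (hH : IsQuasianalyticGenerator H)
    {F : MvPowerSeries (Fin (n + 1)) ℝ} (hF : IsAlgSeries H F)
    (h0 : MvPowerSeries.constantCoeff F = 0)
    (h1 : MvPowerSeries.coeff (Finsupp.single (Fin.last n) 1) F ≠ 0) :
    ∃ h : (Fin n → ℝ) → ℝ, InAlg H n h ∧ h 0 = 0 ∧
      MvPowerSeries.subst (Fin.snoc (α := fun _ => MvPowerSeries (Fin n) ℝ)
        (fun k => MvPowerSeries.X k) (taylor h)) F = 0 := by
  obtain ⟨f, hf, rfl⟩ := hF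
  have hfs := hf.weaklySmooth hH
  have hf0 : f 0 = 0 := by rw [← hf.constantCoeff_taylor hH, h0]
  have hf1 : partialDeriv (Fin.last n) f 0 ≠ 0 := by rwa [← coeff_single_taylor hfs]
  -- The implicit function theorem is stated on a product, which `s` identifies with `ℝ ^ (n + 1)`.
  let s : (Fin n → ℝ) × ℝ → Fin (n + 1) → ℝ := fun z => Fin.snoc (α := fun _ => ℝ) z.1 z.2
  have hs : ContDiff ℝ ⊤ s := by
    refine contDiff_pi.2 fun j => ?_
    induction j using Fin.lastCases with
    | last => simpa [s] using contDiff_snd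
    | cast k =>
      simp only [s, Fin.snoc_castSucc]
      fun_prop
  have hs0 : s 0 = 0 := by
    funext j
    induction j using Fin.lastCases <;> simp [s]
  have hc : ∀ p : ℕ, ContDiffAt ℝ p (f ∘ s) 0 := fun p => by
    refine ContDiffAt.comp 0 ?_ (hs.of_le le_top).contDiffAt
    rw [hs0]
    exact hfs p
  have hinv : (fderiv ℝ (f ∘ s) 0 ∘L ContinuousLinearMap.inr ℝ (Fin n → ℝ) ℝ).IsInvertible := by
    have hd : (fderiv ℝ (f ∘ s) 0 ∘L ContinuousLinearMap.inr ℝ (Fin n → ℝ) ℝ) 1 =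
        partialDeriv (Fin.last n) f 0 := by
      have hsd : HasDerivAt (fun t : ℝ => s (0, t)) (Pi.single (Fin.last n) 1) 0 := by
        refine hasDerivAt_pi.2 fun j => ?_
        induction j using Fin.lastCases with
        | last => simpa [s] using hasDerivAt_id' (0 : ℝ)
        | cast k => simpa [s] using hasDerivAt_const (0 : ℝ) (0 : ℝ)
      have hfd : HasFDerivAt f (fderiv ℝ f 0) (s (0, 0)) := by
        rw [show ((0 : Fin n → ℝ), (0 : ℝ)) = 0 from rfl, hs0]
        exact ((hfs 1).differentiableAt (by simp)).hasFDerivAt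
      have h2 := hfd.comp_hasDerivAt (0 : ℝ) hsd
      have h3 : HasFDerivAt (f ∘ s) (fderiv ℝ (f ∘ s) 0) ((0 : Fin n → ℝ), (0 : ℝ)) :=
        ((hc 1).differentiableAt (by simp)).hasFDerivAt
      have h4 := h3.comp_hasDerivAt (0 : ℝ)
        ((hasFDerivAt_prodMk_right (𝕜 := ℝ) (0 : Fin n → ℝ) (0 : ℝ)).hasDerivAt)
      exact h4.unique h2
    refine ⟨ContinuousLinearEquiv.unitsEquivAut ℝ (Units.mk0 _ hf1), ?_⟩
    ext
    rw [hd]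
    simp
  let φ : (Fin n → ℝ) → ℝ := (hc 1).implicitFunction (by simp) hinv
  have hφs : WeaklySmooth φ := fun p => by
    have := (hc (p + 1)).contDiffAt_implicitFunction (by simp) hinv
    exact this.of_le (by exact_mod_cast Nat.le_succ p)
  have hφ0 : φ 0 = 0 := (hc 1).implicitFunction_apply_self (by simp) hinv
  have hφsol : ∀ᶠ x in 𝓝 (0 : Fin n → ℝ), f (Fin.snoc (α := fun _ => ℝ) x (φ x)) = 0 := by
    filter_upwards [(hc 1).eventually_apply_implicitFunction (by simp) hinv] with x hx
    have : (f ∘ s) 0 = 0 := by rw [Function.comp_apply, hs0, hf0]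
    rw [this] at hx
    exact hx
  have hφA : InAlg H n φ := InAlg.implicit hf hf0 hf1 hφs hφ0 hφsol
  refine ⟨φ, hφA, hφ0, ?_⟩
  let g : Fin (n + 1) → (Fin n → ℝ) → ℝ :=
    fun j x => Fin.snoc (α := fun _ => ℝ) x (φ x) j
  have hX : ∀ k : Fin n, (fun x : Fin n → ℝ => x k) =
      fun x => MvPolynomial.eval x (MvPolynomial.X k) := fun k => by
    funext x
    simp
  have hg : ∀ j, WeaklySmooth (g j) := fun j => by
    induction j using Fin.lastCases with
    | last => simpa [g] using hφs
    | cast k =>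
      simp only [g, Fin.snoc_castSucc, hX]
      exact weaklySmooth_eval _
  have hg0 : ∀ j, g j 0 = 0 := fun j => by
    induction j using Fin.lastCases <;> simp [g, hφ0]
  have hgt : (fun j => taylor (g j)) = Fin.snoc (α := fun _ => MvPowerSeries (Fin n) ℝ)
      (fun k => MvPowerSeries.X k) (taylor φ) := by
    funext j
    induction j using Fin.lastCases with
    | last => simp [g]
    | cast k => simp [g, hX, taylor_eval]
  rw [← hgt, ← taylor_comp hfs hg hg0]
  have hz : (fun x => f fun j => g j x) =ᶠ[𝓝 0] fun x => MvPolynomial.eval x 0 := by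
    filter_upwards [hφsol] with x hx
    rw [map_zero]
    exact hx
  rw [taylor_congr hz, taylor_eval]
  simp

end HGerm

namespace HGerm

variable {H : ℝ → ℝ} {n m : ℕ}

/-! ### Elementary transformations of series -/

/-- A series in the first `n` of `n + 1` variables, seen as a series in all of them. -/
noncomputable abbrev liftSeries : MvPowerSeries (Fin n) ℝ →ₐ[ℝ] MvPowerSeries (Fin (n + 1)) ℝ :=
  MvPowerSeries.rename Fin.castSucc

/-- The components of the blow-up chart `π_{i,j}^l`. -/
noncomputable def blowUpSeries (i j : Fin n) (l : ℝ) : Fin n → MvPowerSeries (Fin n) ℝ :=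
  Function.update MvPowerSeries.X i (MvPowerSeries.X j * (MvPowerSeries.C l + MvPowerSeries.X i))

/-- The components of a Tschirnhausen translation by a germ with Taylor series `h`. -/
noncomputable def tschirnhausenSeries (h : MvPowerSeries (Fin n) ℝ) :
    Fin (n + 1) → MvPowerSeries (Fin (n + 1)) ℝ :=
  Function.update MvPowerSeries.X (Fin.last n) (MvPowerSeries.X (Fin.last n) + liftSeries h)

/-- The components of the shear `L_{i,c}`. -/
noncomputable def shearSeries (i : Fin n) (c : Set.Iio i → ℝ) : Fin n → MvPowerSeries (Fin n) ℝ :=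
  fun k => if hk : k < i then
    MvPowerSeries.X k + MvPowerSeries.C (c ⟨k, hk⟩) * MvPowerSeries.X i else MvPowerSeries.X k

/-- The components of the ramification `r_i^{d,s}`. -/
noncomputable def ramificationSeries (i : Fin n) (d : ℕ) (s : ℤˣ) :
    Fin n → MvPowerSeries (Fin n) ℝ :=
  Function.update MvPowerSeries.X i (MvPowerSeries.C (((s : ℤ) : ℝ)) * MvPowerSeries.X i ^ d)

theorem hasExpansion_coordinate (i : Fin n) :
    HasExpansion (fun x : Fin n → ℝ => x i) (MvPowerSeries.X i) := by
  simpa using hasExpansion_eval (MvPolynomial.X i : MvPolynomial (Fin n) ℝ)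

theorem weaklySmooth_coordinate (i : Fin n) : WeaklySmooth fun x : Fin n → ℝ => x i := by
  simpa using weaklySmooth_eval (MvPolynomial.X i : MvPolynomial (Fin n) ℝ)

theorem inAlg_coordinate (i : Fin n) : InAlg H n fun x : Fin n → ℝ => x i := by
  simpa using InAlg.poly (H := H) (MvPolynomial.X i : MvPolynomial (Fin n) ℝ)

theorem taylor_coordinate (i : Fin n) : taylor (fun x : Fin n → ℝ => x i) = MvPowerSeries.X i :=
  (hasExpansion_coordinate i).taylor_eq (weaklySmooth_coordinate i)

theorem blowUpChart_apply (i j : Fin n) (l : ℝ) (k : Fin n) :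
    (fun x => blowUpChart i j l x k) = fun x => MvPolynomial.eval x
      (Function.update MvPolynomial.X i
        (MvPolynomial.X j * (MvPolynomial.C l + MvPolynomial.X i)) k) := by
  funext x
  by_cases h : k = i
  · subst h; simp [blowUpChart]
  · simp [blowUpChart, h]

theorem shear_apply (i : Fin n) (c : Set.Iio i → ℝ) (k : Fin n) :
    (fun x => shear i c x k) = fun x => MvPolynomial.eval x
      (if hk : k < i then MvPolynomial.X k + MvPolynomial.C (c ⟨k, hk⟩) * MvPolynomial.X i
        else MvPolynomial.X k) := by
  funext x
  by_cases h : k < i <;> simp [shear, h]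

theorem ramification_apply (i : Fin n) (d : ℕ) (s : ℤˣ) (k : Fin n) :
    (fun x => ramification i d s x k) = fun x => MvPolynomial.eval x
      (Function.update MvPolynomial.X i
        (MvPolynomial.C (((s : ℤ) : ℝ)) * MvPolynomial.X i ^ d) k) := by
  funext x
  by_cases h : k = i
  · subst h; simp [ramification]
  · simp [ramification, h]

theorem taylor_blowUpChart (i j : Fin n) (l : ℝ) :
    (fun k => taylor fun x => blowUpChart i j l x k) = blowUpSeries i j l := by
  funext k
  rw [blowUpChart_apply, taylor_eval, blowUpSeries]
  by_cases h : k = i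
  · subst h; simp
  · simp [h]

theorem taylor_shear (i : Fin n) (c : Set.Iio i → ℝ) :
    (fun k => taylor fun x => shear i c x k) = shearSeries i c := by
  funext k
  rw [shear_apply, taylor_eval, shearSeries]
  by_cases h : k < i <;> simp [h]

theorem taylor_ramification (i : Fin n) (d : ℕ) (s : ℤˣ) :
    (fun k => taylor fun x => ramification i d s x k) = ramificationSeries i d s := by
  funext k
  rw [ramification_apply, taylor_eval, ramificationSeries]
  by_cases h : k = i
  · subst h
    rw [Function.update_self, Function.update_self, MvPolynomial.coe_mul, MvPolynomial.coe_pow,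
      MvPolynomial.coe_C, MvPolynomial.coe_X]
  · simp [h]

theorem inAlg_comp_castSucc {h : (Fin n → ℝ) → ℝ} (hh : InAlg H n h) :
    InAlg H (n + 1) fun x => h fun k => x k.castSucc :=
  hh.comp (g := fun k x => x k.castSucc) (fun k => inAlg_coordinate k.castSucc) fun _ => rfl

theorem taylor_comp_castSucc {h : (Fin n → ℝ) → ℝ} (hh : WeaklySmooth h) :
    taylor (fun x : Fin (n + 1) → ℝ => h fun k => x k.castSucc) = liftSeries (taylor h) := by
  rw [taylor_comp (g := fun k x => x k.castSucc) hh (fun k => weaklySmooth_coordinate k.castSucc)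
    fun _ => rfl, MvPowerSeries.rename_eq_subst]
  simp only [taylor_coordinate]
  rfl

theorem inAlg_tschirnhausen {h : (Fin n → ℝ) → ℝ} (hh : InAlg H n h) (k : Fin (n + 1)) :
    InAlg H (n + 1) fun x => tschirnhausen h x k := by
  by_cases hk : k = Fin.last n
  · subst hk
    simpa [tschirnhausen] using (inAlg_coordinate (Fin.last n)).add (inAlg_comp_castSucc hh)
  · simpa [tschirnhausen, hk] using inAlg_coordinate k

theorem taylor_tschirnhausen {h : (Fin n → ℝ) → ℝ} (hh : WeaklySmooth h) :
    (fun k => taylor fun x => tschirnhausen h x k) = tschirnhausenSeries (taylor h) := by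
  funext k
  by_cases hk : k = Fin.last n
  · subst hk
    have h1 : WeaklySmooth fun x : Fin (n + 1) → ℝ => h fun k => x k.castSucc :=
      hh.comp (g := fun k x => x k.castSucc) (fun k => weaklySmooth_coordinate k.castSucc)
        fun _ => rfl
    have h2 := ((hasExpansion_coordinate (Fin.last n)).add h1.hasExpansion).taylor_eq
      ((weaklySmooth_coordinate (Fin.last n)).add h1)
    rw [taylor_comp_castSucc hh] at h2
    simpa [tschirnhausen, tschirnhausenSeries] using h2
  · simp [tschirnhausen, tschirnhausenSeries, hk, taylor_coordinate]

theorem inAlg_blowUpChart (i j : Fin n) (l : ℝ) (k : Fin n) :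
    InAlg H n fun x => blowUpChart i j l x k := by
  rw [blowUpChart_apply]
  exact InAlg.poly _

theorem inAlg_shear (i : Fin n) (c : Set.Iio i → ℝ) (k : Fin n) :
    InAlg H n fun x => shear i c x k := by
  rw [shear_apply]
  exact InAlg.poly _

theorem inAlg_ramification (i : Fin n) (d : ℕ) (s : ℤˣ) (k : Fin n) :
    InAlg H n fun x => ramification i d s x k := by
  rw [ramification_apply]
  exact InAlg.poly _

theorem blowUpChart_zero (i j : Fin n) (l : ℝ) : blowUpChart i j l 0 = 0 := by
  simp [blowUpChart]

namespace ElementaryTree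

theorem inAlg_transformation : {n : ℕ} → (E : ElementaryTree H n) → (e : E.Edge) → (k : Fin n) →
    InAlg H n fun x => E.transformation e x k
  | _, blowUp i j _, l, k => by
    induction l using OnePoint.rec with
    | infty => exact inAlg_blowUpChart j i 0 k
    | coe l => exact inAlg_blowUpChart i j l k
  | _, tschirnhausen _ hh _, _, k => inAlg_tschirnhausen hh k
  | _, shear i c, _, k => inAlg_shear i c k
  | _, ramification i d _, s, k => inAlg_ramification i d s k

theorem transformation_zero : {n : ℕ} → (E : ElementaryTree H n) → (e : E.Edge) →
    E.transformation e 0 = 0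
  | _, blowUp i j _, l => by
    induction l using OnePoint.rec with
    | infty => exact blowUpChart_zero j i 0
    | coe l => exact blowUpChart_zero i j l
  | _, tschirnhausen h _ h0, _ => by
    have h0' : h (fun _ => 0) = 0 := h0
    simp [transformation, HGerm.tschirnhausen, h0']
  | _, shear i c, _ => by
    funext k
    simp [transformation, HGerm.shear]
  | _, ramification i d hd, s => by
    have : d ≠ 0 := by omega
    simp [transformation, HGerm.ramification, this]

/-- The critical variable of an edge as a series, or `1` when there is none. -/
noncomputable def criticalSeries (E : ElementaryTree H n) (e : E.Edge) : MvPowerSeries (Fin n) ℝ :=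
  match E.criticalVariable e with
  | some w => MvPowerSeries.X w
  | none => 1

end ElementaryTree

/-! ### Normal series -/

theorem X_ne_zero (i : Fin n) : (MvPowerSeries.X i : MvPowerSeries (Fin n) ℝ) ≠ 0 := by
  intro h0
  have := congrArg (MvPowerSeries.coeff (Finsupp.single i 1)) h0
  simp [MvPowerSeries.coeff_X] at this

/-- Two substitutions that agree on `X_i = 0` take congruent values modulo `X_i`. -/
theorem X_dvd_subst_sub_subst {i : Fin n} {a b : Fin m → MvPowerSeries (Fin n) ℝ}
    (ha : ∀ k, MvPowerSeries.constantCoeff (a k) = 0)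
    (hb : ∀ k, MvPowerSeries.constantCoeff (b k) = 0)
    (hab : ∀ k, MvPowerSeries.X i ∣ a k - b k) (F : MvPowerSeries (Fin m) ℝ) :
    MvPowerSeries.X i ∣ MvPowerSeries.subst a F - MvPowerSeries.subst b F := by
  rw [MvPowerSeries.X_dvd_iff]
  intro α hα
  have h1 : MvPowerSeries.X i ∣ MvPolynomial.aeval a (F.truncTotal (α.degree + 1)) -
      MvPolynomial.aeval b (F.truncTotal (α.degree + 1)) := by
    induction F.truncTotal (α.degree + 1) using MvPolynomial.induction_on with
    | C c => simp
    | add P Q hP hQ =>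
      rw [map_add, map_add, add_sub_add_comm]
      exact dvd_add hP hQ
    | mul_X P k hP =>
      simp only [map_mul, MvPolynomial.aeval_X]
      rw [show ∀ p q x y : MvPowerSeries (Fin n) ℝ, p * x - q * y = (p - q) * x + q * (x - y) from
        fun p q x y => by ring]
      exact dvd_add (hP.mul_right _) ((hab k).mul_left _)
  rw [map_sub, ← coeff_aeval_truncTotal ha (Nat.lt_succ_self α.degree),
    ← coeff_aeval_truncTotal hb (Nat.lt_succ_self α.degree), ← map_sub]
  exact MvPowerSeries.X_dvd_iff.1 h1 α hα

theorem constantCoeff_update_X {i : Fin n} {F : MvPowerSeries (Fin n) ℝ}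
    (hF : MvPowerSeries.constantCoeff F = 0) (k : Fin n) :
    MvPowerSeries.constantCoeff (Function.update MvPowerSeries.X i F k) = 0 := by
  by_cases h : k = i
  · subst h; simpa using hF
  · simp [h]

/-- Divisibility by `X_i` is the vanishing of a substitution; as substitution is a ring
homomorphism to a domain, `X_i` is prime. -/
theorem X_dvd_iff_subst_eq_zero {i : Fin n} {F : MvPowerSeries (Fin n) ℝ} :
    MvPowerSeries.X i ∣ F ↔ MvPowerSeries.subst
      (Function.update (MvPowerSeries.X : Fin n → MvPowerSeries (Fin n) ℝ) i 0) F = 0 := by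
  have h0 : ∀ k, MvPowerSeries.constantCoeff
      (Function.update (MvPowerSeries.X : Fin n → MvPowerSeries (Fin n) ℝ) i 0 k) = 0 :=
    constantCoeff_update_X (map_zero _)
  have hs := MvPowerSeries.hasSubst_of_constantCoeff_zero h0
  constructor
  · rintro ⟨G, rfl⟩
    rw [MvPowerSeries.subst_mul hs, MvPowerSeries.subst_X hs]
    simp
  · intro h
    have h1 := X_dvd_subst_sub_subst (a := MvPowerSeries.X) (i := i)
      (by simp) h0 (fun k => ?_) F
    · rw [h, sub_zero, MvPowerSeries.subst_self] at h1
      exact h1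
    · by_cases hk : k = i
      · subst hk; simp
      · simp [hk]

theorem X_prime (i : Fin n) : Prime (MvPowerSeries.X i : MvPowerSeries (Fin n) ℝ) := by
  refine ⟨X_ne_zero i, fun h => ?_, fun F G h => ?_⟩
  · have := MvPowerSeries.isUnit_iff_constantCoeff.1 h
    simp at this
  · rw [X_dvd_iff_subst_eq_zero, MvPowerSeries.subst_mul
      (MvPowerSeries.hasSubst_of_constantCoeff_zero (constantCoeff_update_X (map_zero _))),
      mul_eq_zero] at h
    rwa [X_dvd_iff_subst_eq_zero, X_dvd_iff_subst_eq_zero]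

theorem isNormal_of_isUnit {U : MvPowerSeries (Fin n) ℝ} (hU : IsUnit U) : IsNormal U :=
  ⟨0, U, hU, by simp [MvPowerSeries.monomial_zero_eq_C_apply]⟩

theorem isNormal_X (i : Fin n) : IsNormal (MvPowerSeries.X i : MvPowerSeries (Fin n) ℝ) :=
  ⟨Finsupp.single i 1, 1, isUnit_one, by rw [mul_one]; rfl⟩

theorem IsNormal.mul {F G : MvPowerSeries (Fin n) ℝ} (hF : IsNormal F) (hG : IsNormal G) :
    IsNormal (F * G) := by
  obtain ⟨α, U, hU, rfl⟩ := hF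
  obtain ⟨β, V, hV, rfl⟩ := hG
  refine ⟨α + β, U * V, hU.mul hV, ?_⟩
  have : (MvPowerSeries.monomial (α + β) 1 : MvPowerSeries (Fin n) ℝ) =
      MvPowerSeries.monomial α 1 * MvPowerSeries.monomial β 1 := by
    rw [MvPowerSeries.monomial_mul_monomial, one_mul]
  rw [this]
  ring

theorem IsNormal.pow {F : MvPowerSeries (Fin n) ℝ} (hF : IsNormal F) (k : ℕ) :
    IsNormal (F ^ k) := by
  induction k with
  | zero => simpa using isNormal_of_isUnit isUnit_one
  | succ k ih => simpa only [pow_succ] using ih.mul hF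

theorem IsNormal.prod {ι : Type*} {s : Finset ι} {F : ι → MvPowerSeries (Fin n) ℝ}
    (hF : ∀ i ∈ s, IsNormal (F i)) : IsNormal (∏ i ∈ s, F i) :=
  Finset.prod_induction F IsNormal (fun _ _ h1 h2 => h1.mul h2) (isNormal_of_isUnit isUnit_one) hF

theorem IsNormal.ne_zero {F : MvPowerSeries (Fin n) ℝ} (hF : IsNormal F) : F ≠ 0 := by
  obtain ⟨α, U, hU, rfl⟩ := hF
  refine mul_ne_zero (fun h => ?_) hU.ne_zero
  have := congrArg (MvPowerSeries.coeff α) h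
  simp at this

theorem monomial_eq_prod (α : Fin n →₀ ℕ) :
    (MvPowerSeries.monomial α 1 : MvPowerSeries (Fin n) ℝ) = ∏ i, MvPowerSeries.X i ^ α i := by
  have := congrArg (fun P : MvPolynomial (Fin n) ℝ => (P : MvPowerSeries (Fin n) ℝ))
    (MvPolynomial.monomial_eq (s := α) (a := (1 : ℝ)))
  simp only [MvPolynomial.coe_monomial, map_one, one_mul] at this
  rw [this, Finsupp.prod_fintype _ _ (by simp)]
  have h2 := map_prod (MvPolynomial.coeToMvPowerSeries.ringHom (σ := Fin n) (R := ℝ))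
    (fun i => MvPolynomial.X i ^ α i) Finset.univ
  simpa only [MvPolynomial.coeToMvPowerSeries.ringHom_apply, MvPolynomial.coe_pow,
    MvPolynomial.coe_X] using h2

/-- The variables are primes, so the divisors of a normal series are normal. -/
theorem IsNormal.of_dvd {F G : MvPowerSeries (Fin n) ℝ} (hF : IsNormal F) (h : G ∣ F) :
    IsNormal G := by
  obtain ⟨α, U, hU, rfl⟩ := hF
  obtain ⟨K, hK⟩ := h
  induction hd : α.degree generalizing α G K with
  | zero =>
    have : α = 0 := (Finsupp.degree_eq_zero_iff α).1 hd
    subst this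
    refine isNormal_of_isUnit (isUnit_of_mul_isUnit_left (y := K) ?_)
    rw [← hK]
    simpa [MvPowerSeries.monomial_zero_eq_C_apply] using hU
  | succ d ih =>
    have hne : α ≠ 0 := fun h0 => by simp [h0] at hd
    obtain ⟨i, hi⟩ := Finsupp.ne_iff.1 hne
    have hle : Finsupp.single i 1 ≤ α := by
      rw [Finsupp.single_le_iff]
      exact Nat.one_le_iff_ne_zero.2 hi
    obtain ⟨β, rfl⟩ := exists_add_of_le hle
    have hβ : β.degree = d := by
      rw [map_add, Finsupp.degree_single] at hd
      omega
    have hX : (MvPowerSeries.monomial (Finsupp.single i 1 + β) 1 : MvPowerSeries (Fin n) ℝ) =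
        MvPowerSeries.X i * MvPowerSeries.monomial β 1 := by
      rw [MvPowerSeries.X, MvPowerSeries.monomial_mul_monomial, one_mul]
    rw [hX, mul_assoc] at hK
    rcases (X_prime i).dvd_or_dvd (hK ▸ dvd_mul_right _ _) with ⟨G', hG'⟩ | ⟨K', hK'⟩
    · rw [hG', mul_assoc] at hK
      rw [hG']
      exact (isNormal_X i).mul (ih β K (mul_left_cancel₀ (X_ne_zero i) hK) hβ)
    · rw [hK', mul_left_comm G] at hK
      exact ih β K' (mul_left_cancel₀ (X_ne_zero i) hK) hβ

end HGerm

namespace HGerm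

variable {H : ℝ → ℝ} {n m : ℕ}

/-! ### Monomializable series and trees -/

/-- The series that are `*`-monomialized by some admissible tree, described without trees: a series
is monomializable if it is normal, or if some elementary tree makes it so along every edge, even
after multiplication by the critical variable of the edge. -/
inductive Monomializable (H : ℝ → ℝ) {n : ℕ} : MvPowerSeries (Fin n) ℝ → Prop
  | normal {F : MvPowerSeries (Fin n) ℝ} (hF : IsNormal F) : Monomializable H F
  | node {F : MvPowerSeries (Fin n) ℝ} (E : ElementaryTree H n)
      (h : ∀ e, Monomializable H
        (compTransformation F (E.transformation e) * E.criticalSeries e)) : Monomializable H F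

theorem ElementaryTree.constantCoeff_taylor_transformation (hH : IsQuasianalyticGenerator H)
    (E : ElementaryTree H n) (e : E.Edge) (k : Fin n) :
    MvPowerSeries.constantCoeff (taylor fun x => E.transformation e x k) = 0 := by
  rw [(E.inAlg_transformation e k).constantCoeff_taylor hH, E.transformation_zero]
  rfl

theorem ElementaryTree.hasSubst (hH : IsQuasianalyticGenerator H) (E : ElementaryTree H n)
    (e : E.Edge) : MvPowerSeries.HasSubst fun k => taylor fun x => E.transformation e x k :=
  MvPowerSeries.hasSubst_of_constantCoeff_zero (E.constantCoeff_taylor_transformation hH e)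

/-- A divisor of a monomializable series is monomializable, by the same tree. -/
theorem Monomializable.of_dvd (hH : IsQuasianalyticGenerator H) {F G : MvPowerSeries (Fin n) ℝ}
    (hF : Monomializable H F) (h : G ∣ F) : Monomializable H G := by
  induction hF generalizing G with
  | normal hF => exact .normal (hF.of_dvd h)
  | node E _ ih =>
    refine .node E fun e => ih e (mul_dvd_mul ?_ dvd_rfl)
    obtain ⟨K, rfl⟩ := h
    unfold compTransformation
    rw [MvPowerSeries.subst_mul (E.hasSubst hH e)]
    exact dvd_mul_right _ _

namespace AdmissibleTree

theorem exists_heightAtMost (T : AdmissibleTree H n) : ∃ h : Ordinal.{0}, T.HeightAtMost h := by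
  induction T with
  | vertex => exact ⟨0, trivial⟩
  | node E child ih =>
    choose h hh using ih
    refine ⟨Order.succ (⨆ e, h e), fun e => ⟨h e, ?_, hh e⟩⟩
    exact Order.lt_succ_of_le (Ordinal.le_iSup h e)

theorem Branch.weaklySmooth (hH : IsQuasianalyticGenerator H) {T : AdmissibleTree H n}
    (β : T.Branch) :
    β.transformation 0 = 0 ∧ ∀ k, WeaklySmooth fun x => β.transformation x k := by
  induction β with
  | nil => exact ⟨rfl, fun k => weaklySmooth_coordinate k⟩
  | @cons E child e β ih =>
    refine ⟨?_, fun k => ?_⟩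
    · show E.transformation e (β.transformation 0) = 0
      rw [ih.1, E.transformation_zero]
    · exact ((E.inAlg_transformation e k).weaklySmooth hH).comp
        (g := fun j x => β.transformation x j) ih.2 fun j => by rw [ih.1]; rfl

theorem compTransformation_cons (hH : IsQuasianalyticGenerator H) {E : ElementaryTree H n}
    {child : E.Edge → AdmissibleTree H n} (e : E.Edge) (β : (child e).Branch)
    (F : MvPowerSeries (Fin n) ℝ) :
    compTransformation F (Branch.cons (child := child) e β).transformation =
      compTransformation (compTransformation F (E.transformation e)) β.transformation := by
  have hβ := β.weaklySmooth hH
  have hβ0 : ∀ j, β.transformation 0 j = 0 := fun j => by rw [hβ.1]; rfl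
  have hs : MvPowerSeries.HasSubst fun j => taylor fun x => β.transformation x j :=
    hasSubst_of_hasExpansion (fun j => (hβ.2 j).hasExpansion) hβ0
  unfold compTransformation
  rw [MvPowerSeries.subst_comp_subst_apply (E.hasSubst hH e) hs]
  congr 1
  funext k
  exact taylor_comp (g := fun j x => β.transformation x j)
    ((E.inAlg_transformation e k).weaklySmooth hH) hβ.2 hβ0

theorem compTransformation_mul (hH : IsQuasianalyticGenerator H) {T : AdmissibleTree H n}
    (β : T.Branch) (F G : MvPowerSeries (Fin n) ℝ) :
    compTransformation (F * G) β.transformation =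
      compTransformation F β.transformation * compTransformation G β.transformation := by
  have hβ := β.weaklySmooth hH
  exact MvPowerSeries.subst_mul (hasSubst_of_hasExpansion (fun j => (hβ.2 j).hasExpansion)
    fun j => by rw [hβ.1]; rfl) F G

theorem Monomializes.of_dvd (hH : IsQuasianalyticGenerator H) {T : AdmissibleTree H n} {p : ℕ}
    {F : MvPowerSeries (Fin n) ℝ} {G : Fin p → MvPowerSeries (Fin n) ℝ}
    (hT : T.Monomializes ![F]) (h : ∀ k, G k ∣ F) : T.Monomializes G := by
  intro β k
  obtain ⟨K, hK⟩ := h k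
  have := hT β 0
  rw [Matrix.cons_val_zero, hK, compTransformation_mul hH] at this
  exact this.of_dvd (dvd_mul_right _ _)

end AdmissibleTree

/-- Below an edge `ν`, a tree that monomializes the product of `F ∘ ν` and the critical variable
of `ν` monomializes both. -/
theorem Monomializable.exists_tree (hH : IsQuasianalyticGenerator H)
    {F : MvPowerSeries (Fin n) ℝ} (hF : Monomializable H F) :
    ∃ T : AdmissibleTree H n, T.StarMonomializes ![F] := by
  induction hF with
  | @normal F hF =>
    refine ⟨.vertex, fun β k => ?_, trivial⟩
    cases β
    show IsNormal (MvPowerSeries.subst (fun i => taylor fun x : Fin n → ℝ => x i) (![F] k))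
    rw [show (fun i => taylor fun x : Fin n → ℝ => x i) = MvPowerSeries.X from
      funext taylor_coordinate, MvPowerSeries.subst_self]
    simpa using hF
  | @node F E _ ih =>
    choose child hchild using ih
    refine ⟨.node E child, fun β k => ?_, fun e => ⟨fun w hw => ?_, (hchild e).2⟩⟩
    · cases β with
      | cons e β =>
        rw [AdmissibleTree.compTransformation_cons hH]
        exact (hchild e).1.of_dvd hH
          (G := fun _ => compTransformation (![F] k) (E.transformation e))
          (fun _ => by simp) β k
    · refine (hchild e).1.of_dvd hH fun k => ?_
      have : E.criticalSeries e = MvPowerSeries.X w := by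
        simp [ElementaryTree.criticalSeries, hw]
      rw [this]
      simp

section Rules

variable {F : MvPowerSeries (Fin n) ℝ}

theorem Monomializable.of_blowUp {i j : Fin n} (hij : i ≠ j)
    (h : ∀ l : ℝ, Monomializable H (MvPowerSeries.subst (blowUpSeries i j l) F * MvPowerSeries.X j))
    (h' : Monomializable H (MvPowerSeries.subst (blowUpSeries j i 0) F * MvPowerSeries.X i)) :
    Monomializable H F := by
  refine .node (.blowUp i j hij) fun e => ?_
  induction e using OnePoint.rec with
  | infty => rw [← taylor_blowUpChart] at h'; exact h'
  | coe l => have := h l; rw [← taylor_blowUpChart] at this; exact this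

theorem Monomializable.of_shear (i : Fin n) (c : Set.Iio i → ℝ)
    (h : Monomializable H (MvPowerSeries.subst (shearSeries i c) F)) : Monomializable H F := by
  refine .node (.shear i c) fun e => ?_
  rw [← taylor_shear, ← mul_one (MvPowerSeries.subst _ F)] at h
  exact h

theorem Monomializable.of_ramification (i : Fin n) {d : ℕ} (hd : 1 ≤ d)
    (h : ∀ s, Monomializable H (MvPowerSeries.subst (ramificationSeries i d s) F)) :
    Monomializable H F := by
  have key : ∀ s, Monomializable H
      (compTransformation F (HGerm.ramification i d s) * 1) := fun s => by
    rw [mul_one, compTransformation, taylor_ramification]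
    exact h s
  exact .node (.ramification i d hd) key

theorem Monomializable.of_tschirnhausen (hH : IsQuasianalyticGenerator H)
    {F : MvPowerSeries (Fin (n + 1)) ℝ} {h : (Fin n → ℝ) → ℝ} (hh : InAlg H n h) (h0 : h 0 = 0)
    (hF : Monomializable H (MvPowerSeries.subst (tschirnhausenSeries (taylor h)) F)) :
    Monomializable H F := by
  refine .node (.tschirnhausen h hh h0) fun e => ?_
  rw [← taylor_tschirnhausen (hh.weaklySmooth hH), ← mul_one (MvPowerSeries.subst _ F)] at hF
  exact hF

end Rules

end HGerm

namespace HGerm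

variable {H : ℝ → ℝ} {n m : ℕ}

/-! ### Restriction of series to lines -/

/-- The restriction of a series to the line spanned by `v`, that is `F(v_1 T, …, v_n T)`. -/
noncomputable def lineRestrict (v : Fin n → ℝ) (F : MvPowerSeries (Fin n) ℝ) : PowerSeries ℝ :=
  MvPowerSeries.subst (fun k => PowerSeries.C (v k) * PowerSeries.X) F

theorem constantCoeff_line (v : Fin n → ℝ) (k : Fin n) :
    MvPowerSeries.constantCoeff (PowerSeries.C (v k) * PowerSeries.X : PowerSeries ℝ) = 0 := by
  show PowerSeries.constantCoeff (PowerSeries.C (v k) * PowerSeries.X : PowerSeries ℝ) = 0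
  simp

theorem hasSubst_line (v : Fin n → ℝ) : MvPowerSeries.HasSubst
    (fun k => (PowerSeries.C (v k) * PowerSeries.X : PowerSeries ℝ)) :=
  MvPowerSeries.hasSubst_of_constantCoeff_zero (constantCoeff_line v)

theorem coeff_lineRestrict (v : Fin n → ℝ) (F : MvPowerSeries (Fin n) ℝ) (j : ℕ) :
    PowerSeries.coeff j (lineRestrict v F) =
      ∑ α ∈ (F.truncTotal (j + 1)).support with α.degree = j,
        MvPowerSeries.coeff α F * ∏ k, v k ^ α k := by
  have h1 : PowerSeries.coeff j (lineRestrict v F) = PowerSeries.coeff j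
      (MvPolynomial.aeval (fun k => (PowerSeries.C (v k) * PowerSeries.X : PowerSeries ℝ))
        (F.truncTotal (j + 1))) :=
    (coeff_aeval_truncTotal (constantCoeff_line v) (by simp)).symm
  rw [h1, MvPolynomial.aeval_def, MvPolynomial.eval₂_eq', map_sum, Finset.sum_filter]
  refine Finset.sum_congr rfl fun α hα => ?_
  have hlt : α.degree < j + 1 := by
    by_contra h
    exact MvPolynomial.mem_support_iff.1 hα (MvPowerSeries.coeff_truncTotal_eq_zero _ (by omega))
  rw [MvPowerSeries.coeff_truncTotal _ hlt]
  have h2 : ∏ k, (PowerSeries.C (v k) * PowerSeries.X : PowerSeries ℝ) ^ α k =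
      PowerSeries.C (∏ k, v k ^ α k) * PowerSeries.X ^ α.degree := by
    simp only [mul_pow]
    rw [Finset.prod_mul_distrib, Finset.prod_pow_eq_pow_sum, Finsupp.degree_eq_sum, map_prod]
    simp
  rw [h2, show algebraMap ℝ (PowerSeries ℝ) (MvPowerSeries.coeff α F) =
    PowerSeries.C (MvPowerSeries.coeff α F) from rfl, ← mul_assoc, ← map_mul,
    PowerSeries.coeff_C_mul, PowerSeries.coeff_X_pow]
  by_cases h : α.degree = j
  · simp [h]
  · simp [h, Ne.symm h]

theorem coeff_lineRestrict_single (i : Fin n) (μ : ℝ) (F : MvPowerSeries (Fin n) ℝ) (j : ℕ) :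
    PowerSeries.coeff j (lineRestrict (Pi.single i μ) F) =
      μ ^ j * MvPowerSeries.coeff (Finsupp.single i j) F := by
  rw [coeff_lineRestrict, Finset.sum_eq_single (Finsupp.single i j)]
  · rw [Finset.prod_eq_single i]
    · simp [mul_comm]
    · intro k _ hk
      simp [Finsupp.single_eq_of_ne hk]
    · simp
  · intro α hα hne
    obtain ⟨-, hd⟩ := Finset.mem_filter.1 hα
    have : ∃ k ≠ i, α k ≠ 0 := by
      by_contra! hcon
      apply hne
      have h1 : α = Finsupp.single i (α i) := by
        ext k
        by_cases hk : k = i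
        · subst hk; simp
        · rw [hcon k hk, Finsupp.single_eq_of_ne hk]
      rw [h1, Finsupp.degree_single] at hd
      rw [h1, hd]
    obtain ⟨k, hk, hαk⟩ := this
    rw [Finset.prod_eq_zero (Finset.mem_univ k), mul_zero]
    rw [Pi.single_eq_of_ne hk, zero_pow hαk]
  · intro hnot
    have : MvPowerSeries.coeff (Finsupp.single i j) F = 0 := by
      by_contra h
      apply hnot
      rw [Finset.mem_filter, MvPolynomial.mem_support_iff,
        MvPowerSeries.coeff_truncTotal _ (by simp)]
      exact ⟨h, by simp⟩
    rw [this, zero_mul]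

theorem lineRestrict_subst (v : Fin n → ℝ) {a : Fin m → MvPowerSeries (Fin n) ℝ}
    (ha : ∀ k, MvPowerSeries.constantCoeff (a k) = 0) (F : MvPowerSeries (Fin m) ℝ) :
    lineRestrict v (MvPowerSeries.subst a F) =
      MvPowerSeries.subst (fun k => lineRestrict v (a k)) F :=
  MvPowerSeries.subst_comp_subst_apply (MvPowerSeries.hasSubst_of_constantCoeff_zero ha)
    (hasSubst_line v) F

theorem lineRestrict_add (v : Fin n → ℝ) (F G : MvPowerSeries (Fin n) ℝ) :
    lineRestrict v (F + G) = lineRestrict v F + lineRestrict v G :=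
  MvPowerSeries.subst_add (hasSubst_line v) F G

theorem lineRestrict_mul (v : Fin n → ℝ) (F G : MvPowerSeries (Fin n) ℝ) :
    lineRestrict v (F * G) = lineRestrict v F * lineRestrict v G :=
  MvPowerSeries.subst_mul (hasSubst_line v) F G

theorem lineRestrict_pow (v : Fin n → ℝ) (F : MvPowerSeries (Fin n) ℝ) (k : ℕ) :
    lineRestrict v (F ^ k) = lineRestrict v F ^ k :=
  MvPowerSeries.subst_pow (hasSubst_line v) F k

theorem lineRestrict_sum {ι : Type*} (v : Fin n → ℝ) (s : Finset ι)
    (F : ι → MvPowerSeries (Fin n) ℝ) :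
    lineRestrict v (∑ i ∈ s, F i) = ∑ i ∈ s, lineRestrict v (F i) := by
  have := map_sum (MvPowerSeries.substAlgHom (R := ℝ) (hasSubst_line v)) F s
  simp only [MvPowerSeries.coe_substAlgHom] at this
  exact this

theorem lineRestrict_X (v : Fin n → ℝ) (k : Fin n) :
    lineRestrict v (MvPowerSeries.X k) = PowerSeries.C (v k) * PowerSeries.X :=
  MvPowerSeries.subst_X (hasSubst_line v) k

theorem lineRestrict_C (v : Fin n → ℝ) (c : ℝ) :
    lineRestrict v (MvPowerSeries.C c) = PowerSeries.C c :=
  MvPowerSeries.subst_C c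

theorem subst_zero_eq_C (F : MvPowerSeries (Fin n) ℝ) :
    MvPowerSeries.subst (fun _ => (0 : PowerSeries ℝ)) F =
      PowerSeries.C (MvPowerSeries.constantCoeff F) := by
  have h := MvPowerSeries.subst_zero_eq_C_constantCoeff (τ := Unit) (S := ℝ) (f := F)
  refine Eq.trans h ?_
  simp
  rfl

theorem subst_liftSeries {τ : Type*} {a : Fin (n + 1) → MvPowerSeries τ ℝ}
    (ha : ∀ k, MvPowerSeries.constantCoeff (a k) = 0) (F : MvPowerSeries (Fin n) ℝ) :
    MvPowerSeries.subst a (liftSeries F) = MvPowerSeries.subst (fun k => a k.castSucc) F := by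
  have hX : MvPowerSeries.HasSubst
      (MvPowerSeries.X ∘ Fin.castSucc : Fin n → MvPowerSeries (Fin (n + 1)) ℝ) :=
    MvPowerSeries.hasSubst_of_constantCoeff_zero (by simp)
  have hs := MvPowerSeries.hasSubst_of_constantCoeff_zero ha
  rw [MvPowerSeries.rename_eq_subst, MvPowerSeries.subst_comp_subst_apply hX hs]
  congr 1
  funext k
  exact MvPowerSeries.subst_X hs _

theorem liftSeries_subst {a : Fin m → MvPowerSeries (Fin n) ℝ}
    (ha : ∀ k, MvPowerSeries.constantCoeff (a k) = 0) (F : MvPowerSeries (Fin m) ℝ) :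
    liftSeries (MvPowerSeries.subst a F) = MvPowerSeries.subst (fun k => liftSeries (a k)) F := by
  have hX : MvPowerSeries.HasSubst
      (MvPowerSeries.X ∘ Fin.castSucc : Fin n → MvPowerSeries (Fin (n + 1)) ℝ) :=
    MvPowerSeries.hasSubst_of_constantCoeff_zero (by simp)
  simp only [MvPowerSeries.rename_eq_subst]
  exact MvPowerSeries.subst_comp_subst_apply (MvPowerSeries.hasSubst_of_constantCoeff_zero ha) hX F

theorem liftSeries_X (k : Fin n) : liftSeries (MvPowerSeries.X k) =
    (MvPowerSeries.X k.castSucc : MvPowerSeries (Fin (n + 1)) ℝ) :=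
  MvPowerSeries.rename_X _ k

theorem liftSeries_eq_subst (F : MvPowerSeries (Fin n) ℝ) :
    liftSeries F = MvPowerSeries.subst
      (fun k : Fin n => (MvPowerSeries.X k.castSucc : MvPowerSeries (Fin (n + 1)) ℝ)) F :=
  MvPowerSeries.rename_eq_subst _ F

theorem constantCoeff_liftSeries (F : MvPowerSeries (Fin n) ℝ) :
    MvPowerSeries.constantCoeff (liftSeries F) = MvPowerSeries.constantCoeff F :=
  MvPowerSeries.constantCoeff_rename _ F

theorem lineRestrict_liftSeries (μ : ℝ) (F : MvPowerSeries (Fin n) ℝ) :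
    lineRestrict (Pi.single (Fin.last n) μ) (liftSeries F) =
      PowerSeries.C (MvPowerSeries.constantCoeff F) := by
  rw [lineRestrict, subst_liftSeries (constantCoeff_line _), ← subst_zero_eq_C]
  congr 1
  funext k
  rw [Pi.single_eq_of_ne (Fin.castSucc_lt_last k).ne]
  simp

theorem IsAlgSeries.lift (hH : IsQuasianalyticGenerator H) {F : MvPowerSeries (Fin n) ℝ}
    (hF : IsAlgSeries H F) : IsAlgSeries H (liftSeries F) := by
  rw [MvPowerSeries.rename_eq_subst]
  exact hF.subst hH (fun k => isAlgSeries_X k.castSucc) (by simp)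

theorem constantCoeff_subst_of_zero {τ : Type*} {a : Fin n → MvPowerSeries τ ℝ}
    (ha : ∀ k, MvPowerSeries.constantCoeff (a k) = 0) (F : MvPowerSeries (Fin n) ℝ) :
    MvPowerSeries.constantCoeff (MvPowerSeries.subst a F) = MvPowerSeries.constantCoeff F := by
  have hs := MvPowerSeries.hasSubst_of_constantCoeff_zero ha
  have h1 := MvPowerSeries.constantCoeff_subst_eq_zero hs ha
    (f := F - MvPowerSeries.C (MvPowerSeries.constantCoeff F)) (by simp)
  rw [MvPowerSeries.subst_sub hs, MvPowerSeries.subst_C, map_sub] at h1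
  simpa [sub_eq_zero] using h1

/-- After a suitable shear, the restriction of a non-zero series to the last axis is non-zero. -/
theorem exists_shear_coeff_ne_zero {F : MvPowerSeries (Fin (n + 1)) ℝ} (hF : F ≠ 0) :
    ∃ (c : Set.Iio (Fin.last n) → ℝ) (d : ℕ), MvPowerSeries.coeff (Finsupp.single (Fin.last n) d)
      (MvPowerSeries.subst (shearSeries (Fin.last n) c) F) ≠ 0 := by
  obtain ⟨α, hα, -⟩ := MvPowerSeries.exists_coeff_ne_zero_and_order
    (MvPowerSeries.ne_zero_iff_order_finite.1 hF)
  set d := α.degree with hd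
  let P : MvPolynomial (Fin (n + 1)) ℝ :=
    ∑ β ∈ (F.truncTotal (d + 1)).support with β.degree = d,
      MvPolynomial.monomial β (MvPowerSeries.coeff β F)
  have hPv : ∀ v, MvPolynomial.eval v P = PowerSeries.coeff d (lineRestrict v F) := fun v => by
    rw [coeff_lineRestrict, map_sum]
    refine Finset.sum_congr rfl fun β _ => ?_
    rw [MvPolynomial.eval_monomial, Finsupp.prod_fintype _ _ (by simp)]
  have hPhom : P.IsHomogeneous d := by
    refine MvPolynomial.IsHomogeneous.sum _ _ _ fun β hβ => ?_
    exact MvPolynomial.isHomogeneous_monomial _ (Finset.mem_filter.1 hβ).2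
  have hP : P ≠ 0 := by
    intro h0
    have h1 := congrArg (MvPolynomial.coeff α) h0
    rw [MvPolynomial.coeff_sum, Finset.sum_eq_single α] at h1
    · exact hα (by simpa using h1)
    · intro β _ hβ
      rw [MvPolynomial.coeff_monomial, if_neg hβ]
    · intro hnot
      exfalso
      apply hnot
      rw [Finset.mem_filter, MvPolynomial.mem_support_iff,
        MvPowerSeries.coeff_truncTotal _ (by omega)]
      exact ⟨hα, rfl⟩
  obtain ⟨v, hv⟩ : ∃ v, MvPolynomial.eval v (P * MvPolynomial.X (Fin.last n)) ≠ 0 := by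
    by_contra! hcon
    exact mul_ne_zero hP (MvPolynomial.X_ne_zero _)
      (MvPolynomial.funext fun v => by rw [hcon v, map_zero])
  rw [map_mul, MvPolynomial.eval_X] at hv
  have hvl := right_ne_zero_of_mul hv
  have hvP := left_ne_zero_of_mul hv
  let w : Fin (n + 1) → ℝ := (v (Fin.last n))⁻¹ • v
  have hwP : MvPolynomial.eval w P ≠ 0 := by
    rw [eval_smul_of_isHomogeneous hPhom]
    exact mul_ne_zero (pow_ne_zero _ (inv_ne_zero hvl)) hvP
  have hwl : w (Fin.last n) = 1 := by simp [w, hvl]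
  refine ⟨fun k => w k, d, ?_⟩
  have hc0 : ∀ k, MvPowerSeries.constantCoeff
      (shearSeries (Fin.last n) (fun k : Set.Iio (Fin.last n) => w k) k) = 0 := fun k => by
    by_cases hk : k < Fin.last n <;> simp [shearSeries, hk]
  have h1 := coeff_lineRestrict_single (Fin.last n) 1
    (MvPowerSeries.subst (shearSeries (Fin.last n) (fun k : Set.Iio (Fin.last n) => w k)) F) d
  rw [one_pow, one_mul, lineRestrict_subst _ hc0] at h1
  rw [← h1]
  have h2 : (fun k => lineRestrict (Pi.single (Fin.last n) (1 : ℝ))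
      (shearSeries (Fin.last n) (fun k : Set.Iio (Fin.last n) => w k) k)) =
      fun k => PowerSeries.C (w k) * PowerSeries.X := by
    funext k
    by_cases hk : k < Fin.last n
    · simp only [shearSeries, hk, dif_pos, lineRestrict_add, lineRestrict_mul, lineRestrict_X,
        lineRestrict_C, Pi.single_eq_of_ne hk.ne, Pi.single_eq_same]
      simp
    · have : k = Fin.last n := le_antisymm (Fin.le_last k) (not_lt.1 hk)
      subst this
      simp [shearSeries, lineRestrict_X, hwl]
  rw [h2]
  rw [hPv] at hwP
  exact hwP

/-! ### Expansion in powers of the last variable -/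

theorem IsAlgSeries.of_X_pow_mul (hH : IsQuasianalyticGenerator H) {i : Fin n} {d : ℕ}
    {F : MvPowerSeries (Fin n) ℝ} (hF : IsAlgSeries H (MvPowerSeries.X i ^ d * F)) :
    IsAlgSeries H F := by
  induction d with
  | zero => simpa using hF
  | succ d ih =>
    rw [pow_succ', mul_assoc] at hF
    exact ih (hF.of_X_mul hH)

/-- The difference of `F` and its restriction to `X_n = 0` is divisible by `X_n`. -/
theorem IsAlgSeries.exists_eq_lift_add (hH : IsQuasianalyticGenerator H)
    {F : MvPowerSeries (Fin (n + 1)) ℝ} (hF : IsAlgSeries H F) :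
    ∃ (a : MvPowerSeries (Fin n) ℝ) (V : MvPowerSeries (Fin (n + 1)) ℝ), IsAlgSeries H a ∧
      IsAlgSeries H V ∧ F = liftSeries a + MvPowerSeries.X (Fin.last n) * V := by
  let s : Fin (n + 1) → MvPowerSeries (Fin n) ℝ :=
    Fin.snoc (α := fun _ => MvPowerSeries (Fin n) ℝ) (fun k => MvPowerSeries.X k) 0
  have hs0 : ∀ k, MvPowerSeries.constantCoeff (s k) = 0 := fun k => by
    induction k using Fin.lastCases <;> simp [s]
  have hsA : ∀ k, IsAlgSeries H (s k) := fun k => by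
    induction k using Fin.lastCases with
    | last => simpa [s] using isAlgSeries_zero
    | cast k => simpa [s] using isAlgSeries_X k
  have ha : IsAlgSeries H (MvPowerSeries.subst s F) := hF.subst hH hsA hs0
  have hdvd : MvPowerSeries.X (Fin.last n) ∣ F - liftSeries (MvPowerSeries.subst s F) := by
    rw [liftSeries_subst hs0]
    have h1 := X_dvd_subst_sub_subst (i := Fin.last n) (a := MvPowerSeries.X)
      (b := fun k => liftSeries (s k)) (by simp)
      (fun k => by rw [constantCoeff_liftSeries, hs0]) (fun k => ?_) F
    · rwa [MvPowerSeries.subst_self] at h1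
    · induction k using Fin.lastCases with
      | last => simp [s]
      | cast k => simp [s]
  obtain ⟨V, hV⟩ := hdvd
  refine ⟨_, V, ha, ?_, ?_⟩
  · have := hF.sub hH (ha.lift hH)
    rw [hV] at this
    exact this.of_X_mul hH
  · rw [← hV]
    ring

theorem IsAlgSeries.exists_expansion (hH : IsQuasianalyticGenerator H)
    {F : MvPowerSeries (Fin (n + 1)) ℝ} (hF : IsAlgSeries H F) (d : ℕ) :
    ∃ (a : ℕ → MvPowerSeries (Fin n) ℝ) (V : MvPowerSeries (Fin (n + 1)) ℝ),
      (∀ i, IsAlgSeries H (a i)) ∧ IsAlgSeries H V ∧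
      F = ∑ i ∈ Finset.range d, liftSeries (a i) * MvPowerSeries.X (Fin.last n) ^ i +
        MvPowerSeries.X (Fin.last n) ^ d * V := by
  induction d with
  | zero => exact ⟨fun _ => 0, F, fun _ => isAlgSeries_zero, hF, by simp⟩
  | succ d ih =>
    obtain ⟨a, V, ha, hV, hFd⟩ := ih
    obtain ⟨b, W, hb, hW, hVb⟩ := hV.exists_eq_lift_add hH
    refine ⟨Function.update a d b, W, fun i => ?_, hW, ?_⟩
    · by_cases h : i = d
      · subst h; simpa using hb
      · simpa [h] using ha i
    · rw [Finset.sum_range_succ, Function.update_self, Finset.sum_congr rfl fun i hi => by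
        rw [Function.update_of_ne (Finset.mem_range.1 hi).ne]]
      conv_lhs => rw [hFd, hVb]
      ring

end HGerm

namespace HGerm

variable {H : ℝ → ℝ} {n m : ℕ}

/-! ### Tschirnhausen preparation -/

theorem constantCoeff_tschirnhausenSeries {h : MvPowerSeries (Fin n) ℝ}
    (h0 : MvPowerSeries.constantCoeff h = 0) (k : Fin (n + 1)) :
    MvPowerSeries.constantCoeff (tschirnhausenSeries h k) = 0 :=
  constantCoeff_update_X (by simp [h0]) k

/-- In the expansion of `F(x', y + z)` in powers of `z`, where `F` has order `d + 1` along the last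
axis, the coefficient of `z ^ d` vanishes at the origin but its derivative along `y` does not, and
the remainder is a unit. The three facts are read off on the lines `x' = 0`, `y = μ z`. -/
theorem coeff_of_shifted_expansion {F : MvPowerSeries (Fin (n + 1)) ℝ} {d : ℕ}
    (hlow : ∀ j ≤ d, MvPowerSeries.coeff (Finsupp.single (Fin.last n) j) F = 0)
    (htop : MvPowerSeries.coeff (Finsupp.single (Fin.last n) (d + 1)) F ≠ 0)
    {s : Fin (n + 1) → MvPowerSeries (Fin (n + 2)) ℝ}
    (hs : ∀ k : Fin n, s k.castSucc = MvPowerSeries.X k.castSucc.castSucc)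
    (hsl : s (Fin.last n) =
      MvPowerSeries.X (Fin.last n).castSucc + MvPowerSeries.X (Fin.last (n + 1)))
    {c : ℕ → MvPowerSeries (Fin (n + 1)) ℝ} {V : MvPowerSeries (Fin (n + 2)) ℝ}
    (hG : MvPowerSeries.subst s F =
      ∑ i ∈ Finset.range (d + 1), liftSeries (c i) * MvPowerSeries.X (Fin.last (n + 1)) ^ i +
        MvPowerSeries.X (Fin.last (n + 1)) ^ (d + 1) * V) :
    MvPowerSeries.constantCoeff (c d) = 0 ∧
      MvPowerSeries.coeff (Finsupp.single (Fin.last n) 1) (c d) ≠ 0 ∧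
      MvPowerSeries.constantCoeff V ≠ 0 := by
  have hs0 : ∀ k, MvPowerSeries.constantCoeff (s k) = 0 := fun k => by
    induction k using Fin.lastCases with
    | last => simp [hsl]
    | cast k => simp [hs]
  -- the coefficient of degree `j` on the line `x' = 0`, `y = μ z`
  have key : ∀ (μ : ℝ) (j : ℕ), j ≤ d + 1 →
      (μ + 1) ^ j * MvPowerSeries.coeff (Finsupp.single (Fin.last n) j) F =
        (∑ i ∈ Finset.range (d + 1), if i ≤ j then
          μ ^ (j - i) * MvPowerSeries.coeff (Finsupp.single (Fin.last n) (j - i)) (c i) else 0) +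
        if d + 1 ≤ j then MvPowerSeries.constantCoeff V else 0 := by
    intro μ j hj
    let v : Fin (n + 2) → ℝ := Fin.snoc (α := fun _ => ℝ) (Pi.single (Fin.last n) μ) 1
    have h1 : lineRestrict v (MvPowerSeries.subst s F) =
        lineRestrict (Pi.single (Fin.last n) (μ + 1)) F := by
      rw [lineRestrict_subst v hs0, lineRestrict]
      congr 1
      funext k
      induction k using Fin.lastCases with
      | last => simp [hsl, lineRestrict_add, lineRestrict_X, v, add_mul]
      | cast k => simp [hs, lineRestrict_X, v, (Fin.castSucc_lt_last k).ne]
    have h2 : ∀ C : MvPowerSeries (Fin (n + 1)) ℝ, lineRestrict v (liftSeries C) =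
        lineRestrict (Pi.single (Fin.last n) μ) C := fun C => by
      rw [lineRestrict, subst_liftSeries (constantCoeff_line v)]
      simp only [v, Fin.snoc_castSucc]
      rfl
    have h3 := congrArg (PowerSeries.coeff j) (congrArg (lineRestrict v) hG)
    rw [h1, coeff_lineRestrict_single, lineRestrict_add, lineRestrict_sum, map_add, map_sum] at h3
    have hXl : lineRestrict v (MvPowerSeries.X (Fin.last (n + 1))) = PowerSeries.X := by
      simp [lineRestrict_X, v]
    simp only [lineRestrict_mul, lineRestrict_pow, h2, hXl, PowerSeries.coeff_mul_X_pow',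
      PowerSeries.coeff_X_pow_mul', coeff_lineRestrict_single] at h3
    rw [h3]
    congr 1
    split_ifs with h4
    · have h5 : j - (d + 1) = 0 := by omega
      rw [h5, PowerSeries.coeff_zero_eq_constantCoeff_apply]
      exact constantCoeff_subst_of_zero (constantCoeff_line v) V
    · rfl
  -- For `j = d + 1` both sides are polynomials in `μ`, and their linear terms can be compared.
  set w := MvPowerSeries.coeff (Finsupp.single (Fin.last n) (d + 1)) F with hw
  have hpoly : Polynomial.C w * (Polynomial.X + 1) ^ (d + 1) =
      (∑ i ∈ Finset.range (d + 1), Polynomial.X ^ (d + 1 - i) * Polynomial.C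
        (MvPowerSeries.coeff (Finsupp.single (Fin.last n) (d + 1 - i)) (c i))) +
      Polynomial.C (MvPowerSeries.constantCoeff V) := by
    refine Polynomial.funext fun μ => ?_
    have := key μ (d + 1) le_rfl
    rw [if_pos le_rfl, Finset.sum_congr rfl fun i hi =>
      if_pos (Finset.mem_range.1 hi).le] at this
    simp only [Polynomial.eval_mul, Polynomial.eval_C, Polynomial.eval_pow, Polynomial.eval_add,
      Polynomial.eval_X, Polynomial.eval_one, Polynomial.eval_finsetSum]
    rw [← this, mul_comm]
  refine ⟨?_, ?_, ?_⟩
  · have h1 := key 0 d (Nat.le_succ d)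
    rw [hlow d le_rfl, mul_zero, if_neg (by omega), add_zero,
      Finset.sum_eq_single d (fun i hi hne => ?_) (by simp)] at h1
    · simpa using h1.symm
    · have : i < d + 1 := Finset.mem_range.1 hi
      rw [if_pos (by omega), zero_pow (by omega), zero_mul]
  · have h1 := congrArg (fun P => Polynomial.coeff P 1) hpoly
    simp only [Polynomial.coeff_C_mul, Polynomial.coeff_X_add_one_pow, Polynomial.coeff_add,
      Polynomial.finsetSum_coeff, Polynomial.coeff_mul_C, Polynomial.coeff_X_pow,
      Polynomial.coeff_C_succ, add_zero, Nat.choose_one_right] at h1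
    rw [Finset.sum_eq_single d (fun i hi hne => ?_) (by simp)] at h1
    · have h2 : d + 1 - d = 1 := by omega
      rw [h2, if_pos rfl, one_mul] at h1
      rw [← h1]
      exact mul_ne_zero htop (by positivity)
    · have : i < d + 1 := Finset.mem_range.1 hi
      rw [if_neg (by omega), zero_mul]
  · have h1 := key 0 (d + 1) le_rfl
    rw [if_pos le_rfl, Finset.sum_eq_zero fun i hi => ?_] at h1
    · rw [zero_add, one_pow, one_mul, zero_add] at h1
      rwa [← h1]
    · have : i < d + 1 := Finset.mem_range.1 hi
      rw [if_pos (by omega), zero_pow (by omega), zero_mul]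

/-- A series of order `d + 1` along the last axis becomes, after a Tschirnhausen translation, a
series without term of degree `d` in its last variable. -/
theorem IsAlgSeries.exists_tschirnhausen (hH : IsQuasianalyticGenerator H)
    {F : MvPowerSeries (Fin (n + 1)) ℝ} (hF : IsAlgSeries H F) {d : ℕ}
    (hlow : ∀ j ≤ d, MvPowerSeries.coeff (Finsupp.single (Fin.last n) j) F = 0)
    (htop : MvPowerSeries.coeff (Finsupp.single (Fin.last n) (d + 1)) F ≠ 0) :
    ∃ h : (Fin n → ℝ) → ℝ, InAlg H n h ∧ h 0 = 0 ∧
      ∃ (a : ℕ → MvPowerSeries (Fin n) ℝ) (U : MvPowerSeries (Fin (n + 1)) ℝ),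
        (∀ i, IsAlgSeries H (a i)) ∧ IsUnit U ∧
        MvPowerSeries.subst (tschirnhausenSeries (taylor h)) F =
          ∑ i ∈ Finset.range d, liftSeries (a i) * MvPowerSeries.X (Fin.last n) ^ i +
            MvPowerSeries.X (Fin.last n) ^ (d + 1) * U := by
  -- With the variables `(x', y, z)`, the substitution `s` turns `F` into `F(x', y + z)`.
  let s : Fin (n + 1) → MvPowerSeries (Fin (n + 2)) ℝ :=
    Fin.snoc (α := fun _ => MvPowerSeries (Fin (n + 2)) ℝ)
      (fun k => MvPowerSeries.X k.castSucc.castSucc)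
      (MvPowerSeries.X (Fin.last n).castSucc + MvPowerSeries.X (Fin.last (n + 1)))
  have hs0 : ∀ k, MvPowerSeries.constantCoeff (s k) = 0 := fun k => by
    induction k using Fin.lastCases <;> simp [s]
  have hsA : ∀ k, IsAlgSeries H (s k) := fun k => by
    induction k using Fin.lastCases with
    | last => simpa [s] using (isAlgSeries_X _).add hH (isAlgSeries_X _)
    | cast k => simpa [s] using isAlgSeries_X _
  obtain ⟨c, V, hc, hV, hG⟩ := (hF.subst hH hsA hs0).exists_expansion hH (d + 1)
  obtain ⟨hc0, hc1, hV0⟩ := coeff_of_shifted_expansion hlow htop (fun k => by simp [s])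
    (by simp [s]) hG
  obtain ⟨h, hh, h0, hsol⟩ := (hc d).exists_implicit hH hc0 hc1
  have hT0 : MvPowerSeries.constantCoeff (taylor h) = 0 := by rw [hh.constantCoeff_taylor hH, h0]
  -- The coefficient of `z ^ d` vanishes on `y = h(x')`; `q` and `t` restrict to this hypersurface.
  let q : Fin (n + 1) → MvPowerSeries (Fin n) ℝ :=
    Fin.snoc (α := fun _ => MvPowerSeries (Fin n) ℝ) (fun k => MvPowerSeries.X k) (taylor h)
  have hq0 : ∀ k, MvPowerSeries.constantCoeff (q k) = 0 := fun k => by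
    induction k using Fin.lastCases <;> simp [q, hT0]
  have hqA : ∀ k, IsAlgSeries H (q k) := fun k => by
    induction k using Fin.lastCases with
    | last => simpa [q] using ⟨h, hh, rfl⟩
    | cast k => simpa [q] using isAlgSeries_X _
  let t : Fin (n + 2) → MvPowerSeries (Fin (n + 1)) ℝ :=
    Fin.snoc (α := fun _ => MvPowerSeries (Fin (n + 1)) ℝ) (fun k => liftSeries (q k))
      (MvPowerSeries.X (Fin.last n))
  have ht0 : ∀ k, MvPowerSeries.constantCoeff (t k) = 0 := fun k => by
    induction k using Fin.lastCases with
    | last => simp [t]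
    | cast k =>
      simp only [t, Fin.snoc_castSucc]
      rw [constantCoeff_liftSeries, hq0]
  have hts := MvPowerSeries.hasSubst_of_constantCoeff_zero ht0
  refine ⟨h, hh, h0, fun i => MvPowerSeries.subst q (c i), MvPowerSeries.subst t V,
    fun i => (hc i).subst hH hqA hq0, ?_, ?_⟩
  · rw [MvPowerSeries.isUnit_iff_constantCoeff, constantCoeff_subst_of_zero ht0]
    exact hV0.isUnit
  · have h1 : MvPowerSeries.subst (tschirnhausenSeries (taylor h)) F =
        MvPowerSeries.subst t (MvPowerSeries.subst s F) := by
      rw [MvPowerSeries.subst_comp_subst_apply (MvPowerSeries.hasSubst_of_constantCoeff_zero hs0)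
        hts]
      congr 1
      funext k
      induction k using Fin.lastCases with
      | last =>
        simp only [s, Fin.snoc_last]
        rw [MvPowerSeries.subst_add hts, MvPowerSeries.subst_X hts, MvPowerSeries.subst_X hts]
        simp [t, q, tschirnhausenSeries, add_comm]
      | cast k =>
        simp only [s, Fin.snoc_castSucc]
        rw [MvPowerSeries.subst_X hts]
        simp [t, q, tschirnhausenSeries, (Fin.castSucc_lt_last k).ne]
    have h2 : ∀ C : MvPowerSeries (Fin (n + 1)) ℝ, MvPowerSeries.subst t (liftSeries C) =
        liftSeries (MvPowerSeries.subst q C) := fun C => by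
      rw [subst_liftSeries ht0, liftSeries_subst hq0]
      simp only [t, Fin.snoc_castSucc]
    have h3 : MvPowerSeries.subst t
        (MvPowerSeries.X (Fin.last (n + 1)) : MvPowerSeries (Fin (n + 2)) ℝ) =
        (MvPowerSeries.X (Fin.last n) : MvPowerSeries (Fin (n + 1)) ℝ) := by
      rw [MvPowerSeries.subst_X hts]
      simp [t]
    have hq : MvPowerSeries.subst q (c d) = 0 := hsol
    rw [h1, hG, Finset.sum_range_succ, ← MvPowerSeries.coe_substAlgHom (R := ℝ) hts]
    simp only [map_add, map_sum, map_mul, map_pow, MvPowerSeries.coe_substAlgHom, h2, h3, hq]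
    simp

end HGerm

namespace HGerm

variable {H : ℝ → ℝ} {n m : ℕ}

/-! ### Elementary trees in an additional variable -/

/-- A substitution of the first `n` variables, extended by the identity on the last one. -/
noncomputable def extendSeries (a : Fin n → MvPowerSeries (Fin n) ℝ) :
    Fin (n + 1) → MvPowerSeries (Fin (n + 1)) ℝ :=
  Fin.snoc (α := fun _ => MvPowerSeries (Fin (n + 1)) ℝ) (fun k => liftSeries (a k))
    (MvPowerSeries.X (Fin.last n))

@[simp] theorem extendSeries_castSucc (a : Fin n → MvPowerSeries (Fin n) ℝ) (k : Fin n) :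
    extendSeries a k.castSucc = liftSeries (a k) := by simp [extendSeries]

@[simp] theorem extendSeries_last (a : Fin n → MvPowerSeries (Fin n) ℝ) :
    extendSeries a (Fin.last n) = MvPowerSeries.X (Fin.last n) := by simp [extendSeries]

theorem constantCoeff_extendSeries {a : Fin n → MvPowerSeries (Fin n) ℝ}
    (ha : ∀ k, MvPowerSeries.constantCoeff (a k) = 0) (k : Fin (n + 1)) :
    MvPowerSeries.constantCoeff (extendSeries a k) = 0 := by
  induction k using Fin.lastCases with
  | last => simp
  | cast k => rw [extendSeries_castSucc, constantCoeff_liftSeries, ha]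

theorem isAlgSeries_extendSeries (hH : IsQuasianalyticGenerator H)
    {a : Fin n → MvPowerSeries (Fin n) ℝ} (ha : ∀ k, IsAlgSeries H (a k)) (k : Fin (n + 1)) :
    IsAlgSeries H (extendSeries a k) := by
  induction k using Fin.lastCases with
  | last => simpa using isAlgSeries_X _
  | cast k => simpa using (ha k).lift hH

theorem subst_extendSeries_lift {a : Fin n → MvPowerSeries (Fin n) ℝ}
    (ha : ∀ k, MvPowerSeries.constantCoeff (a k) = 0) (F : MvPowerSeries (Fin n) ℝ) :
    MvPowerSeries.subst (extendSeries a) (liftSeries F) = liftSeries (MvPowerSeries.subst a F) := by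
  rw [subst_liftSeries (constantCoeff_extendSeries ha), liftSeries_subst ha]
  simp only [extendSeries_castSucc]

theorem extendSeries_update (i : Fin n) (G : MvPowerSeries (Fin n) ℝ) :
    extendSeries (Function.update MvPowerSeries.X i G) =
      Function.update MvPowerSeries.X i.castSucc (liftSeries G) := by
  funext k
  induction k using Fin.lastCases with
  | last => simp [(Fin.castSucc_lt_last i).ne']
  | cast k =>
    by_cases h : k = i
    · subst h; simp
    · simp [h]

theorem extendSeries_blowUpSeries (i j : Fin n) (l : ℝ) :
    extendSeries (blowUpSeries i j l) = blowUpSeries i.castSucc j.castSucc l := by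
  rw [blowUpSeries, extendSeries_update]
  simp [blowUpSeries]

theorem extendSeries_ramificationSeries (i : Fin n) (d : ℕ) (s : ℤˣ) :
    extendSeries (ramificationSeries i d s) = ramificationSeries i.castSucc d s := by
  rw [ramificationSeries, extendSeries_update]
  simp [ramificationSeries]

theorem extendSeries_shearSeries (i : Fin n) (c : Set.Iio i → ℝ) :
    extendSeries (shearSeries i c) = shearSeries i.castSucc
      (fun k => c ⟨⟨k.1.1, (show k.1.1 < i.1 from k.2).trans i.2⟩, k.2⟩) := by
  funext k
  induction k using Fin.lastCases with
  | last =>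
    have : ¬ Fin.last n < i.castSucc := not_lt.2 (Fin.le_last _)
    simp [shearSeries, this]
  | cast k =>
    by_cases h : k < i
    · simp [shearSeries, h]
    · simp [shearSeries, h]

theorem constantCoeff_shearSeries (i : Fin n) (c : Set.Iio i → ℝ) (k : Fin n) :
    MvPowerSeries.constantCoeff (shearSeries i c k) = 0 := by
  by_cases hk : k < i <;> simp [shearSeries, hk]

/-- The shear that adds `c` times the last variable to the previous one. -/
noncomputable def lastShearCoeff (n : ℕ) (c : ℝ) (k : Set.Iio (Fin.last (n + 1))) : ℝ :=
  if k.1 = (Fin.last n).castSucc then c else 0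

/-- The translation `x_{n-1} ↦ x_{n-1} + h(x_1, …, x_{n-2})` is the commutator of the
Tschirnhausen translation `x_n ↦ x_n + h` and of the shear `x_{n-1} ↦ x_{n-1} + x_n`. -/
theorem subst_commutator {h : MvPowerSeries (Fin n) ℝ} (h0 : MvPowerSeries.constantCoeff h = 0)
    (G : MvPowerSeries (Fin (n + 2)) ℝ) :
    MvPowerSeries.subst (tschirnhausenSeries (liftSeries h))
      (MvPowerSeries.subst (shearSeries (Fin.last (n + 1)) (lastShearCoeff n 1))
        (MvPowerSeries.subst (tschirnhausenSeries (liftSeries (-h)))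
          (MvPowerSeries.subst (shearSeries (Fin.last (n + 1)) (lastShearCoeff n (-1))) G))) =
      MvPowerSeries.subst (extendSeries (tschirnhausenSeries h)) G := by
  have hA := constantCoeff_tschirnhausenSeries (h := liftSeries h)
    (by rw [constantCoeff_liftSeries, h0])
  have hA' := constantCoeff_tschirnhausenSeries (h := liftSeries (-h))
    (by rw [constantCoeff_liftSeries, map_neg, h0, neg_zero])
  have hB := constantCoeff_shearSeries (Fin.last (n + 1)) (lastShearCoeff n 1)
  have hB' := constantCoeff_shearSeries (Fin.last (n + 1)) (lastShearCoeff n (-1))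
  have sA := MvPowerSeries.hasSubst_of_constantCoeff_zero hA
  have sA' := MvPowerSeries.hasSubst_of_constantCoeff_zero hA'
  have sB := MvPowerSeries.hasSubst_of_constantCoeff_zero hB
  have sB' := MvPowerSeries.hasSubst_of_constantCoeff_zero hB'
  set η : MvPowerSeries (Fin (n + 2)) ℝ := liftSeries (liftSeries h) with hη
  have hfix : ∀ {a : Fin (n + 2) → MvPowerSeries (Fin (n + 2)) ℝ},
      (∀ k, MvPowerSeries.constantCoeff (a k) = 0) →
      (∀ k : Fin n, a k.castSucc.castSucc = MvPowerSeries.X k.castSucc.castSucc) →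
      MvPowerSeries.subst a η = η := fun {a} ha hax => by
    have hX : ∀ k : Fin n, MvPowerSeries.constantCoeff
        (MvPowerSeries.X k.castSucc : MvPowerSeries (Fin (n + 1)) ℝ) = 0 := by simp
    rw [hη, subst_liftSeries ha, subst_liftSeries (fun k => ha k.castSucc), liftSeries_eq_subst h,
      liftSeries_subst hX]
    simp only [hax, liftSeries_X]
  have vA : ∀ k, tschirnhausenSeries (liftSeries h) k =
    if k = Fin.last (n + 1) then MvPowerSeries.X (Fin.last (n + 1)) + η else MvPowerSeries.X k :=
    fun k => by
      by_cases hk : k = Fin.last (n + 1)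
      · subst hk; simp [tschirnhausenSeries, hη]
      · simp [tschirnhausenSeries, hk]
  have vA' : ∀ k, tschirnhausenSeries (liftSeries (-h)) k =
    if k = Fin.last (n + 1) then MvPowerSeries.X (Fin.last (n + 1)) - η else MvPowerSeries.X k :=
    fun k => by
      by_cases hk : k = Fin.last (n + 1)
      · subst hk; simp [tschirnhausenSeries, hη, sub_eq_add_neg]
      · simp [tschirnhausenSeries, hk]
  have vB : ∀ c k, shearSeries (Fin.last (n + 1)) (lastShearCoeff n c) k =
    if k = (Fin.last n).castSucc then MvPowerSeries.X (Fin.last n).castSucc +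
      MvPowerSeries.C c * MvPowerSeries.X (Fin.last (n + 1)) else MvPowerSeries.X k :=
    fun c k => by
      by_cases hk : k = (Fin.last n).castSucc
      · subst hk; simp [shearSeries, lastShearCoeff, Fin.castSucc_lt_last]
      · by_cases hl : k < Fin.last (n + 1) <;> simp [shearSeries, lastShearCoeff, hk, hl]
  have hne : (Fin.last n).castSucc ≠ Fin.last (n + 1) := (Fin.castSucc_lt_last _).ne
  have hcc : ∀ k : Fin n, k.castSucc.castSucc ≠ (Fin.last n).castSucc := fun k h =>
    (Fin.castSucc_lt_last k).ne (Fin.castSucc_injective _ h)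
  have hcl : ∀ k : Fin n, k.castSucc.castSucc ≠ Fin.last (n + 1) := fun k =>
    (Fin.castSucc_lt_last _).ne
  have eA := hfix hA fun k => by rw [vA, if_neg (hcl k)]
  have eB := hfix hB fun k => by rw [vB, if_neg (hcc k)]
  have h1 := fun k => (constantCoeff_subst_of_zero hA' _).trans (hB' k)
  have h2 := fun k => (constantCoeff_subst_of_zero hB _).trans (h1 k)
  rw [MvPowerSeries.subst_comp_subst_apply sB' sA', MvPowerSeries.subst_comp_subst_apply
    (MvPowerSeries.hasSubst_of_constantCoeff_zero h1) sB, MvPowerSeries.subst_comp_subst_apply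
    (MvPowerSeries.hasSubst_of_constantCoeff_zero h2) sA]
  congr 1
  funext k
  induction k using Fin.lastCases with
  | last =>
    rw [vB, if_neg hne.symm, MvPowerSeries.subst_X sA', vA', if_pos rfl, MvPowerSeries.subst_sub sB,
      eB, MvPowerSeries.subst_X sB, vB, if_neg hne.symm, MvPowerSeries.subst_sub sA, eA,
      MvPowerSeries.subst_X sA, vA, if_pos rfl, extendSeries_last]
    ring
  | cast k =>
    induction k using Fin.lastCases with
    | last =>
      rw [vB, if_pos rfl, MvPowerSeries.subst_add sA', MvPowerSeries.subst_mul sA',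
        MvPowerSeries.subst_C, MvPowerSeries.subst_X sA', MvPowerSeries.subst_X sA', vA', vA',
        if_neg hne, if_pos rfl, MvPowerSeries.subst_add sB, MvPowerSeries.subst_mul sB,
        MvPowerSeries.subst_C, MvPowerSeries.subst_sub sB, MvPowerSeries.subst_X sB,
        MvPowerSeries.subst_X sB, eB, vB, vB, if_pos rfl, if_neg hne.symm,
        MvPowerSeries.subst_add sA, MvPowerSeries.subst_add sA, MvPowerSeries.subst_mul sA,
        MvPowerSeries.subst_mul sA, MvPowerSeries.subst_C, MvPowerSeries.subst_C,
        MvPowerSeries.subst_sub sA, eA, MvPowerSeries.subst_X sA, MvPowerSeries.subst_X sA,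
        vA, vA, if_neg hne, if_pos rfl, extendSeries_castSucc,
        tschirnhausenSeries, Function.update_self, map_add liftSeries, liftSeries_X, ← hη, map_one,
        map_neg, map_one]
      ring
    | cast k =>
      rw [vB, if_neg (hcc k), MvPowerSeries.subst_X sA', vA', if_neg (hcl k),
        MvPowerSeries.subst_X sB, vB, if_neg (hcc k), MvPowerSeries.subst_X sA, vA,
        if_neg (hcl k), extendSeries_castSucc]
      simp [tschirnhausenSeries, (Fin.castSucc_lt_last k).ne]

/-- An elementary tree in `n` variables acts on series in `n + 1` variables as a chain of elementary
trees. -/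
theorem Monomializable.of_extendSeries (hH : IsQuasianalyticGenerator H) :
    {n : ℕ} → (E : ElementaryTree H n) → (G : MvPowerSeries (Fin (n + 1)) ℝ) →
    (∀ e, Monomializable H (MvPowerSeries.subst
      (extendSeries fun k => taylor fun x => E.transformation e x k) G *
        liftSeries (E.criticalSeries e))) → Monomializable H G
  | _, .blowUp i j hij, G, h => by
    refine .of_blowUp (i := i.castSucc) (j := j.castSucc)
      (fun h => hij (Fin.castSucc_injective _ h)) (fun l => ?_) ?_
    · have : Monomializable H (MvPowerSeries.subst
        (extendSeries fun k => taylor fun x => blowUpChart i j l x k) G *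
          liftSeries (MvPowerSeries.X j)) := h (OnePoint.some l)
      rwa [taylor_blowUpChart, extendSeries_blowUpSeries, liftSeries_X] at this
    · have : Monomializable H (MvPowerSeries.subst
        (extendSeries fun k => taylor fun x => blowUpChart j i 0 x k) G *
          liftSeries (MvPowerSeries.X i)) := h OnePoint.infty
      rwa [taylor_blowUpChart, extendSeries_blowUpSeries, liftSeries_X] at this
  | _, .tschirnhausen (n := n) t ht t0, G, h => by
    have h1 : Monomializable H (MvPowerSeries.subst
        (extendSeries fun k => taylor fun x => HGerm.tschirnhausen t x k) G * liftSeries 1) :=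
      h ()
    have ts := ht.weaklySmooth hH
    have hT0 : MvPowerSeries.constantCoeff (taylor t) = 0 := by rw [ht.constantCoeff_taylor hH, t0]
    rw [taylor_tschirnhausen ts, map_one, mul_one, ← subst_commutator hT0] at h1
    have hn : InAlg H n fun x => t x * MvPolynomial.eval x (MvPolynomial.C (-1)) :=
      ht.mul (InAlg.poly _)
    have hnT : taylor (fun x => t x * MvPolynomial.eval x (MvPolynomial.C (-1))) = -taylor t := by
      rw [((ht.hasExpansion hH).mul (hasExpansion_eval (MvPolynomial.C (-1)))).taylor_eq
        (hn.weaklySmooth hH), MvPolynomial.coe_C]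
      simp
    refine .of_shear (Fin.last (n + 1)) (lastShearCoeff n (-1))
      (.of_tschirnhausen hH (inAlg_comp_castSucc hn) ?_
        (.of_shear (Fin.last (n + 1)) (lastShearCoeff n 1)
          (.of_tschirnhausen hH (inAlg_comp_castSucc ht) ?_ ?_)))
    · have : t (fun _ => 0) = 0 := t0
      simp [this]
    · exact t0
    · rw [taylor_comp_castSucc ts, taylor_comp_castSucc (hn.weaklySmooth hH), hnT]
      exact h1
  | _, .shear i c, G, h => by
    have h1 : Monomializable H (MvPowerSeries.subst
        (extendSeries fun k => taylor fun x => HGerm.shear i c x k) G * liftSeries 1) := h ()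
    rw [taylor_shear, map_one, mul_one, extendSeries_shearSeries] at h1
    exact .of_shear _ _ h1
  | _, .ramification i d hd, G, h => by
    refine .of_ramification i.castSucc hd fun s => ?_
    have h1 : Monomializable H (MvPowerSeries.subst
        (extendSeries fun k => taylor fun x => HGerm.ramification i d s x k) G * liftSeries 1) :=
      h s
    rwa [taylor_ramification, map_one, mul_one, extendSeries_ramificationSeries] at h1

theorem ElementaryTree.isAlgSeries_criticalSeries (E : ElementaryTree H n) (e : E.Edge) :
    IsAlgSeries H (E.criticalSeries e) := by
  unfold ElementaryTree.criticalSeries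
  split
  · exact isAlgSeries_X _
  · exact isAlgSeries_one

/-- A tree that monomializes a series `A` in the first `n` variables can be continued: if a relation
between `A` and a series `F` in `n + 1` variables is preserved by substitutions in the first `n`
variables, then `A * F` is monomializable as soon as it is so when `A` is normal. -/
theorem Monomializable.lift (hH : IsQuasianalyticGenerator H)
    {R : MvPowerSeries (Fin n) ℝ → MvPowerSeries (Fin (n + 1)) ℝ → Prop}
    (hstable : ∀ A F (a : Fin n → MvPowerSeries (Fin n) ℝ) (K : MvPowerSeries (Fin n) ℝ),
      (∀ k, IsAlgSeries H (a k)) → (∀ k, MvPowerSeries.constantCoeff (a k) = 0) →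
      IsAlgSeries H K → R A F →
      R (MvPowerSeries.subst a A * K) (MvPowerSeries.subst (extendSeries a) F))
    (hnormal : ∀ A F, IsNormal A → R A F → Monomializable H (liftSeries A * F))
    {A : MvPowerSeries (Fin n) ℝ} (hA : Monomializable H A)
    {F : MvPowerSeries (Fin (n + 1)) ℝ} (hR : R A F) : Monomializable H (liftSeries A * F) := by
  induction hA generalizing F with
  | normal hA => exact hnormal _ _ hA hR
  | node E _ ih =>
    refine .of_extendSeries hH E _ fun e => ?_
    have h0 := E.constantCoeff_taylor_transformation hH e
    have h1 := ih e (hstable _ _ _ _ (fun k => ⟨_, E.inAlg_transformation e k, rfl⟩) h0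
      (E.isAlgSeries_criticalSeries e) hR)
    rw [MvPowerSeries.subst_mul (MvPowerSeries.hasSubst_of_constantCoeff_zero
      (constantCoeff_extendSeries h0)), subst_extendSeries_lift h0]
    rw [map_mul, mul_right_comm] at h1
    exact h1

end HGerm

namespace HGerm

variable {H : ℝ → ℝ} {n m : ℕ}

/-! ### Monomials and substitution -/

theorem monomial_add (α β : Fin n →₀ ℕ) :
    (MvPowerSeries.monomial (α + β) 1 : MvPowerSeries (Fin n) ℝ) =
      MvPowerSeries.monomial α 1 * MvPowerSeries.monomial β 1 := by
  rw [MvPowerSeries.monomial_mul_monomial, one_mul]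

theorem monomial_single (k : Fin n) (e : ℕ) :
    (MvPowerSeries.monomial (Finsupp.single k e) 1 : MvPowerSeries (Fin n) ℝ) =
      MvPowerSeries.X k ^ e := (MvPowerSeries.X_pow_eq k e).symm

theorem monomial_nsmul (e : ℕ) (α : Fin n →₀ ℕ) :
    (MvPowerSeries.monomial (e • α) 1 : MvPowerSeries (Fin n) ℝ) =
      MvPowerSeries.monomial α 1 ^ e := by
  induction e with
  | zero => simp [MvPowerSeries.monomial_zero_eq_C_apply]
  | succ e ih => rw [succ_nsmul, monomial_add, ih, pow_succ]

theorem subst_monomial_one {a : Fin n → MvPowerSeries (Fin m) ℝ}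
    (ha : ∀ k, MvPowerSeries.constantCoeff (a k) = 0) (α : Fin n →₀ ℕ) :
    MvPowerSeries.subst a (MvPowerSeries.monomial α 1 : MvPowerSeries (Fin n) ℝ) =
      ∏ i, a i ^ α i := by
  have hs := MvPowerSeries.hasSubst_of_constantCoeff_zero ha
  rw [monomial_eq_prod, ← MvPowerSeries.coe_substAlgHom (R := ℝ) hs]
  simp only [map_prod, map_pow, MvPowerSeries.substAlgHom_X]

theorem isUnit_subst {a : Fin n → MvPowerSeries (Fin m) ℝ}
    (ha : ∀ k, MvPowerSeries.constantCoeff (a k) = 0) {U : MvPowerSeries (Fin n) ℝ}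
    (hU : IsUnit U) : IsUnit (MvPowerSeries.subst a U) := by
  rw [MvPowerSeries.isUnit_iff_constantCoeff, constantCoeff_subst_of_zero ha]
  exact MvPowerSeries.isUnit_iff_constantCoeff.1 hU

theorem IsNormal.subst {a : Fin n → MvPowerSeries (Fin m) ℝ}
    (ha : ∀ k, MvPowerSeries.constantCoeff (a k) = 0) (ha' : ∀ k, IsNormal (a k))
    {F : MvPowerSeries (Fin n) ℝ} (hF : IsNormal F) : IsNormal (MvPowerSeries.subst a F) := by
  obtain ⟨α, U, hU, rfl⟩ := hF
  rw [MvPowerSeries.subst_mul (MvPowerSeries.hasSubst_of_constantCoeff_zero ha),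
    subst_monomial_one ha]
  exact (IsNormal.prod fun i _ => (ha' i).pow _).mul (isNormal_of_isUnit (isUnit_subst ha hU))

theorem IsNormal.lift {F : MvPowerSeries (Fin n) ℝ} (hF : IsNormal F) :
    IsNormal (liftSeries F) := by
  rw [liftSeries_eq_subst]
  exact hF.subst (by simp) fun k => isNormal_X _

/-- If the difference of two normal series is zero or normal, then their exponents are
comparable. -/
theorem le_or_le_of_isNormal_sub {α β : Fin n →₀ ℕ} {U V : MvPowerSeries (Fin n) ℝ}
    (hU : IsUnit U) (hV : IsUnit V)
    (h : MvPowerSeries.monomial α 1 * U - MvPowerSeries.monomial β 1 * V = 0 ∨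
      IsNormal (MvPowerSeries.monomial α 1 * U - MvPowerSeries.monomial β 1 * V)) :
    α ≤ β ∨ β ≤ α := by
  have hU0 := (MvPowerSeries.isUnit_iff_constantCoeff.1 hU).ne_zero
  have hV0 := (MvPowerSeries.isUnit_iff_constantCoeff.1 hV).ne_zero
  by_contra! hcon
  obtain ⟨hαβ, hβα⟩ := hcon
  -- If not, `α` and `β` are exponents of the difference, so its exponent `γ` as a normal series
  -- is below both of them; but every exponent of the difference is above `α` or above `β`.
  have hα : MvPowerSeries.coeff α
      (MvPowerSeries.monomial α 1 * U - MvPowerSeries.monomial β 1 * V) ≠ 0 := by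
    simpa [MvPowerSeries.coeff_monomial_mul, hβα] using hU0
  have hβ : MvPowerSeries.coeff β
      (MvPowerSeries.monomial α 1 * U - MvPowerSeries.monomial β 1 * V) ≠ 0 := by
    simpa [MvPowerSeries.coeff_monomial_mul, hαβ] using hV0
  rcases h with h | ⟨γ, W, hW, h⟩
  · rw [h] at hα
    simp at hα
  · have hW0 := (MvPowerSeries.isUnit_iff_constantCoeff.1 hW).ne_zero
    have hγ : MvPowerSeries.coeff γ
        (MvPowerSeries.monomial α 1 * U - MvPowerSeries.monomial β 1 * V) ≠ 0 := by
      rw [h]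
      simpa [MvPowerSeries.coeff_monomial_mul] using hW0
    rw [h, MvPowerSeries.coeff_monomial_mul] at hα hβ
    have h1 : γ ≤ α := by by_contra h1; simp [h1] at hα
    have h2 : γ ≤ β := by by_contra h2; simp [h2] at hβ
    rw [map_sub, MvPowerSeries.coeff_monomial_mul, MvPowerSeries.coeff_monomial_mul] at hγ
    by_cases h3 : α ≤ γ
    · exact hαβ (h3.trans h2)
    · by_cases h4 : β ≤ γ
      · exact hβα (h4.trans h1)
      · simp [h3, h4] at hγ

/-! ### Ramification of several variables -/

/-- The substitution that ramifies the variables in `s`, with the signs `ε`. -/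
noncomputable def multiRamificationSeries (s : Finset (Fin n)) (N : ℕ) (ε : Fin n → ℤˣ) :
    Fin n → MvPowerSeries (Fin n) ℝ := fun k =>
  if k ∈ s then MvPowerSeries.C (((ε k : ℤ) : ℝ)) * MvPowerSeries.X k ^ N else MvPowerSeries.X k

theorem constantCoeff_multiRamificationSeries (s : Finset (Fin n)) {N : ℕ} (hN : 1 ≤ N)
    (ε : Fin n → ℤˣ) (k : Fin n) :
    MvPowerSeries.constantCoeff (multiRamificationSeries s N ε k) = 0 := by
  have : N ≠ 0 := by omega
  by_cases h : k ∈ s <;> simp [multiRamificationSeries, h, this]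

theorem isAlgSeries_multiRamificationSeries (hH : IsQuasianalyticGenerator H) (s : Finset (Fin n))
    (N : ℕ) (ε : Fin n → ℤˣ) (k : Fin n) : IsAlgSeries H (multiRamificationSeries s N ε k) := by
  by_cases h : k ∈ s
  · rw [multiRamificationSeries, if_pos h]
    exact (isAlgSeries_C _).mul hH ((isAlgSeries_X k).pow hH N)
  · simpa [multiRamificationSeries, h] using isAlgSeries_X k

theorem Monomializable.of_multiRamification (s : Finset (Fin n)) {N : ℕ} (hN : 1 ≤ N)
    {F : MvPowerSeries (Fin n) ℝ}
    (h : ∀ ε, Monomializable H (MvPowerSeries.subst (multiRamificationSeries s N ε) F)) :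
    Monomializable H F := by
  induction s using Finset.induction_on with
  | empty =>
    have := h fun _ => 1
    rw [show multiRamificationSeries ∅ N (fun _ => 1) = MvPowerSeries.X from
      funext fun k => by simp [multiRamificationSeries], MvPowerSeries.subst_self] at this
    exact this
  | insert k s hk ih =>
    refine ih fun ε => .of_ramification k hN fun σ => ?_
    have hr : ∀ j, MvPowerSeries.constantCoeff (ramificationSeries k N σ j) = 0 :=
      constantCoeff_update_X (by simp [show N ≠ 0 by omega])
    have hrs := MvPowerSeries.hasSubst_of_constantCoeff_zero hr
    rw [MvPowerSeries.subst_comp_subst_apply (MvPowerSeries.hasSubst_of_constantCoeff_zero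
      (constantCoeff_multiRamificationSeries s hN ε)) hrs]
    convert h (Function.update ε k σ) using 2
    funext j
    by_cases hj : j = k
    · subst hj
      rw [multiRamificationSeries, if_neg hk, MvPowerSeries.subst_X hrs, ramificationSeries,
        Function.update_self, multiRamificationSeries, if_pos (Finset.mem_insert_self _ _),
        Function.update_self]
    · by_cases hjs : j ∈ s
      · simp only [multiRamificationSeries, hjs, if_true, Finset.mem_insert, or_true,
          Function.update_of_ne hj]
        rw [MvPowerSeries.subst_mul hrs, MvPowerSeries.subst_pow hrs, MvPowerSeries.subst_C,
          MvPowerSeries.subst_X hrs, ramificationSeries, Function.update_of_ne hj]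
      · rw [multiRamificationSeries, if_neg hjs, MvPowerSeries.subst_X hrs, ramificationSeries,
          Function.update_of_ne hj, multiRamificationSeries, if_neg (by simp [hj, hjs])]

theorem extendSeries_multiRamificationSeries (N : ℕ) (ε : Fin (n + 1) → ℤˣ) :
    multiRamificationSeries (Finset.univ.erase (Fin.last n)) N ε =
      extendSeries (multiRamificationSeries Finset.univ N fun k => ε k.castSucc) := by
  funext k
  induction k using Fin.lastCases with
  | last => simp [multiRamificationSeries]
  | cast k => simp [multiRamificationSeries, (Fin.castSucc_lt_last k).ne]

theorem subst_multiRamificationSeries_monomial {N : ℕ} (hN : 1 ≤ N) (ε : Fin n → ℤˣ)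
    (α : Fin n →₀ ℕ) (U : MvPowerSeries (Fin n) ℝ) (hU : IsUnit U) :
    ∃ V, IsUnit V ∧ MvPowerSeries.subst (multiRamificationSeries Finset.univ N ε)
      (MvPowerSeries.monomial α 1 * U) = MvPowerSeries.monomial (N • α) 1 * V := by
  have h0 := constantCoeff_multiRamificationSeries Finset.univ hN ε
  refine ⟨MvPowerSeries.C (∏ i, (((ε i : ℤ) : ℝ)) ^ α i) *
    MvPowerSeries.subst (multiRamificationSeries Finset.univ N ε) U, IsUnit.mul ?_
      (isUnit_subst h0 hU), ?_⟩
  · refine IsUnit.map MvPowerSeries.C (Ne.isUnit (Finset.prod_ne_zero_iff.2 fun i _ => ?_))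
    exact pow_ne_zero _ (by simp)
  · rw [MvPowerSeries.subst_mul (MvPowerSeries.hasSubst_of_constantCoeff_zero h0),
      subst_monomial_one h0, monomial_nsmul, monomial_eq_prod, ← mul_assoc, map_prod]
    congr 1
    rw [← Finset.prod_pow, ← Finset.prod_mul_distrib]
    refine Finset.prod_congr rfl fun i _ => ?_
    simp only [multiRamificationSeries, Finset.mem_univ, if_true, map_pow]
    ring

end HGerm

namespace HGerm

variable {H : ℝ → ℝ} {n m : ℕ}

/-! ### Decrease of the order by blow-ups -/

theorem constantCoeff_blowUpSeries (i j : Fin n) (l : ℝ) (k : Fin n) :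
    MvPowerSeries.constantCoeff (blowUpSeries i j l k) = 0 :=
  constantCoeff_update_X (by simp) k

theorem isAlgSeries_blowUpSeries (hH : IsQuasianalyticGenerator H) (i j : Fin n) (l : ℝ)
    (k : Fin n) : IsAlgSeries H (blowUpSeries i j l k) := by
  by_cases h : k = i
  · subst h
    simpa [blowUpSeries] using
      (isAlgSeries_X j).mul hH ((isAlgSeries_C l).add hH (isAlgSeries_X k))
  · simpa [blowUpSeries, h] using isAlgSeries_X k

/-- A substitution that changes only the last variable does not change series in the others. -/
theorem subst_liftSeries_of_fixed {a : Fin (n + 1) → MvPowerSeries (Fin (n + 1)) ℝ}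
    (ha : ∀ k, MvPowerSeries.constantCoeff (a k) = 0)
    (ha' : ∀ k : Fin n, a k.castSucc = MvPowerSeries.X k.castSucc) (F : MvPowerSeries (Fin n) ℝ) :
    MvPowerSeries.subst a (liftSeries F) = liftSeries F := by
  rw [subst_liftSeries ha, liftSeries_eq_subst]
  simp only [ha']

theorem subst_sum_mul_pow {a : Fin (n + 1) → MvPowerSeries (Fin (n + 1)) ℝ}
    (ha : ∀ k, MvPowerSeries.constantCoeff (a k) = 0) (d e : ℕ)
    (b : ℕ → MvPowerSeries (Fin (n + 1)) ℝ) (U : MvPowerSeries (Fin (n + 1)) ℝ) :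
    MvPowerSeries.subst a (∑ i ∈ Finset.range d, b i * MvPowerSeries.X (Fin.last n) ^ i +
        MvPowerSeries.X (Fin.last n) ^ e * U) =
      ∑ i ∈ Finset.range d, MvPowerSeries.subst a (b i) * a (Fin.last n) ^ i +
        a (Fin.last n) ^ e * MvPowerSeries.subst a U := by
  have hs := MvPowerSeries.hasSubst_of_constantCoeff_zero ha
  rw [← MvPowerSeries.coe_substAlgHom (R := ℝ) hs]
  simp only [map_add, map_sum, map_mul, map_pow, MvPowerSeries.substAlgHom_X]

theorem lineRestrict_sum_mul_pow (d e : ℕ) (b : ℕ → MvPowerSeries (Fin n) ℝ)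
    (T U : MvPowerSeries (Fin (n + 1)) ℝ) :
    lineRestrict (Pi.single (Fin.last n) 1)
        (∑ i ∈ Finset.range d, liftSeries (b i) * T ^ i + T ^ e * U) =
      ∑ i ∈ Finset.range d, PowerSeries.C (MvPowerSeries.constantCoeff (b i)) *
          lineRestrict (Pi.single (Fin.last n) 1) T ^ i +
        lineRestrict (Pi.single (Fin.last n) 1) T ^ e *
          lineRestrict (Pi.single (Fin.last n) 1) U := by
  simp only [lineRestrict_add, lineRestrict_sum, lineRestrict_mul, lineRestrict_pow,
    lineRestrict_liftSeries]

theorem coeff_C_add_X_pow (l : ℝ) (i j : ℕ) :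
    PowerSeries.coeff j ((PowerSeries.C l + PowerSeries.X : PowerSeries ℝ) ^ i) =
      l ^ (i - j) * i.choose j := by
  rw [← Polynomial.coeff_X_add_C_pow, ← Polynomial.coeff_coe]
  simp [add_comm]

/-- In a chart `x_n = x_k (l + x_n)` with `l ≠ 0`, the absence of a term of degree `d` makes the
order along the last axis at most `d`: the coefficient of degree `d` is `(d + 1) l U(0)`. -/
theorem coeff_translated_ne_zero {d : ℕ} {l : ℝ} (hl : l ≠ 0) (b : ℕ → MvPowerSeries (Fin n) ℝ)
    {U : MvPowerSeries (Fin (n + 1)) ℝ} (hU : IsUnit U) (k : Fin n) :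
    MvPowerSeries.coeff (Finsupp.single (Fin.last n) d)
      (∑ i ∈ Finset.range d, liftSeries (b i) *
          (MvPowerSeries.C l + MvPowerSeries.X (Fin.last n)) ^ i +
        (MvPowerSeries.C l + MvPowerSeries.X (Fin.last n)) ^ (d + 1) *
          MvPowerSeries.subst (blowUpSeries (Fin.last n) k.castSucc l) U) ≠ 0 := by
  have h1 := coeff_lineRestrict_single (Fin.last n) 1
    (∑ i ∈ Finset.range d, liftSeries (b i) *
          (MvPowerSeries.C l + MvPowerSeries.X (Fin.last n)) ^ i +
        (MvPowerSeries.C l + MvPowerSeries.X (Fin.last n)) ^ (d + 1) *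
          MvPowerSeries.subst (blowUpSeries (Fin.last n) k.castSucc l) U) d
  rw [one_pow, one_mul] at h1
  have hT : lineRestrict (Pi.single (Fin.last n) 1)
      (MvPowerSeries.C l + MvPowerSeries.X (Fin.last n) : MvPowerSeries (Fin (n + 1)) ℝ) =
        PowerSeries.C l + PowerSeries.X := by
    simp [lineRestrict_add, lineRestrict_C, lineRestrict_X]
  have hU' : lineRestrict (Pi.single (Fin.last n) 1)
      (MvPowerSeries.subst (blowUpSeries (Fin.last n) k.castSucc l) U) =
        PowerSeries.C (MvPowerSeries.constantCoeff U) := by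
    rw [lineRestrict_subst _ (constantCoeff_blowUpSeries _ _ l), ← subst_zero_eq_C]
    congr 1
    funext j
    induction j using Fin.lastCases with
    | last =>
      simp [blowUpSeries, lineRestrict_mul, lineRestrict_X, (Fin.castSucc_lt_last k).ne]
    | cast j =>
      simp [blowUpSeries, lineRestrict_X, (Fin.castSucc_lt_last j).ne]
  rw [← h1, lineRestrict_sum_mul_pow, hT, hU', map_add, map_sum, Finset.sum_eq_zero fun i hi => ?_,
    zero_add, PowerSeries.coeff_mul_C, coeff_C_add_X_pow]
  · refine mul_ne_zero (mul_ne_zero (pow_ne_zero _ hl) ?_)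
      (MvPowerSeries.isUnit_iff_constantCoeff.1 hU).ne_zero
    exact_mod_cast (Nat.choose_pos (Nat.le_succ d)).ne'
  · rw [PowerSeries.coeff_C_mul, coeff_C_add_X_pow,
      Nat.choose_eq_zero_of_lt (Finset.mem_range.1 hi)]
    simp

/-- Let `F = ∑_{i < d} x' ^ ((d + 1 - i) β) b_i(x') x_n ^ i + x_n ^ (d + 1) U` with `U` and some
`b_i` invertible. Blow-ups of `x_n` and the variables occurring in `x' ^ β` lead to normal series or
to series of order at most `d` along the last axis. -/
theorem Monomializable.of_prepared (hH : IsQuasianalyticGenerator H) {d : ℕ}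
    (hQ : ∀ (A : MvPowerSeries (Fin n) ℝ) (F : MvPowerSeries (Fin (n + 1)) ℝ), IsAlgSeries H A →
      A ≠ 0 → IsAlgSeries H F →
      (∃ j ≤ d, MvPowerSeries.coeff (Finsupp.single (Fin.last n) j) F ≠ 0) →
      Monomializable H (liftSeries A * F))
    (β : Fin n →₀ ℕ) {A : MvPowerSeries (Fin n) ℝ} (hA : IsAlgSeries H A) (hA' : IsNormal A)
    {b : ℕ → MvPowerSeries (Fin n) ℝ} (hb : ∃ i < d, IsUnit (b i))
    {U : MvPowerSeries (Fin (n + 1)) ℝ} (hU : IsUnit U)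
    (hF : IsAlgSeries H (∑ i ∈ Finset.range d,
      liftSeries (MvPowerSeries.monomial ((d + 1 - i) • β) 1 * b i) *
        MvPowerSeries.X (Fin.last n) ^ i + MvPowerSeries.X (Fin.last n) ^ (d + 1) * U)) :
    Monomializable H (liftSeries A * (∑ i ∈ Finset.range d,
      liftSeries (MvPowerSeries.monomial ((d + 1 - i) • β) 1 * b i) *
        MvPowerSeries.X (Fin.last n) ^ i + MvPowerSeries.X (Fin.last n) ^ (d + 1) * U)) := by
  induction hdeg : β.degree generalizing β A U with
  | zero =>
    have hβ : β = 0 := (Finsupp.degree_eq_zero_iff β).1 hdeg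
    subst hβ
    obtain ⟨i₀, hi₀, hbi⟩ := hb
    refine hQ _ _ hA hA'.ne_zero hF ⟨i₀, hi₀.le, ?_⟩
    have h1 := coeff_lineRestrict_single (Fin.last n) 1 (∑ i ∈ Finset.range d,
      liftSeries (MvPowerSeries.monomial ((d + 1 - i) • (0 : Fin n →₀ ℕ)) 1 * b i) *
        MvPowerSeries.X (Fin.last n) ^ i + MvPowerSeries.X (Fin.last n) ^ (d + 1) * U) i₀
    rw [one_pow, one_mul] at h1
    rw [← h1, lineRestrict_sum_mul_pow, lineRestrict_X, Pi.single_eq_same, map_one, one_mul,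
      map_add, map_sum, PowerSeries.coeff_X_pow_mul', if_neg (by omega), add_zero,
      Finset.sum_eq_single i₀ (fun i _ hi => ?_) (by simp [hi₀])]
    · rw [PowerSeries.coeff_C_mul, PowerSeries.coeff_X_pow_self, mul_one]
      simpa [MvPowerSeries.monomial_zero_eq_C_apply] using
        (MvPowerSeries.isUnit_iff_constantCoeff.1 hbi).ne_zero
    · rw [PowerSeries.coeff_C_mul, PowerSeries.coeff_X_pow, if_neg hi.symm, mul_zero]
  | succ N ih =>
    have hne : β ≠ 0 := fun h0 => by simp [h0] at hdeg
    obtain ⟨k, hk⟩ := Finsupp.ne_iff.1 hne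
    obtain ⟨γ, rfl⟩ := exists_add_of_le
      (Finsupp.single_le_iff.2 (Nat.one_le_iff_ne_zero.2 hk) : Finsupp.single k 1 ≤ β)
    have hγ : γ.degree = N := by
      rw [map_add, Finsupp.degree_single] at hdeg
      omega
    have hmon : ∀ i, (MvPowerSeries.monomial ((d + 1 - i) • (Finsupp.single k 1 + γ)) 1 * b i :
        MvPowerSeries (Fin n) ℝ) =
        MvPowerSeries.X k ^ (d + 1 - i) * (MvPowerSeries.monomial ((d + 1 - i) • γ) 1 * b i) :=
      fun i => by rw [smul_add, monomial_add, Finsupp.smul_single_one, monomial_single, mul_assoc]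
    refine .of_blowUp (Fin.castSucc_lt_last k).ne' (fun l => ?_) (.normal ?_)
    -- In the chart `x_n = x_k (l + x_n)`, the series `F` becomes `x_k ^ (d + 1) G`. With the
    -- critical variable `x_k`, this accounts for the factor `x_k ^ (d + 2)` that `A` acquires.
    · have h0 := constantCoeff_blowUpSeries (Fin.last n) k.castSucc l
      have hfix : ∀ C : MvPowerSeries (Fin n) ℝ, MvPowerSeries.subst
          (blowUpSeries (Fin.last n) k.castSucc l) (liftSeries C) = liftSeries C :=
        subst_liftSeries_of_fixed h0 fun j => by
          simp [blowUpSeries, (Fin.castSucc_lt_last j).ne]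
      have hlast : blowUpSeries (Fin.last n) k.castSucc l (Fin.last n) =
          MvPowerSeries.X k.castSucc * (MvPowerSeries.C l + MvPowerSeries.X (Fin.last n)) := by
        simp [blowUpSeries]
      set G : MvPowerSeries (Fin (n + 1)) ℝ := ∑ i ∈ Finset.range d,
        liftSeries (MvPowerSeries.monomial ((d + 1 - i) • γ) 1 * b i) *
          (MvPowerSeries.C l + MvPowerSeries.X (Fin.last n)) ^ i +
        (MvPowerSeries.C l + MvPowerSeries.X (Fin.last n)) ^ (d + 1) *
          MvPowerSeries.subst (blowUpSeries (Fin.last n) k.castSucc l) U with hG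
      have hFG : MvPowerSeries.subst (blowUpSeries (Fin.last n) k.castSucc l)
          (∑ i ∈ Finset.range d,
            liftSeries (MvPowerSeries.monomial ((d + 1 - i) • (Finsupp.single k 1 + γ)) 1 * b i) *
              MvPowerSeries.X (Fin.last n) ^ i + MvPowerSeries.X (Fin.last n) ^ (d + 1) * U) =
          MvPowerSeries.X k.castSucc ^ (d + 1) * G := by
        rw [subst_sum_mul_pow h0, hlast, hG, mul_add (MvPowerSeries.X k.castSucc ^ (d + 1)),
          Finset.mul_sum]
        congr 1
        · refine Finset.sum_congr rfl fun i hi => ?_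
          have hi' : d + 1 = (d + 1 - i) + i := by have := Finset.mem_range.1 hi; omega
          rw [hfix, hmon, map_mul, map_pow, liftSeries_X, mul_pow]
          conv_rhs => rw [hi', pow_add]
          rw [← hi']
          ring
        · rw [mul_pow, mul_assoc]
      have hGA : IsAlgSeries H G := by
        have := hF.subst hH (isAlgSeries_blowUpSeries hH (Fin.last n) k.castSucc l) h0
        rw [hFG] at this
        exact this.of_X_pow_mul hH
      have hA2 : IsAlgSeries H (A * MvPowerSeries.X k ^ (d + 2)) :=
        hA.mul hH ((isAlgSeries_X k).pow hH _)
      have hA2' : IsNormal (A * MvPowerSeries.X k ^ (d + 2)) := hA'.mul ((isNormal_X k).pow _)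
      rw [MvPowerSeries.subst_mul (MvPowerSeries.hasSubst_of_constantCoeff_zero h0), hfix, hFG]
      have hgoal : Monomializable H (liftSeries (A * MvPowerSeries.X k ^ (d + 2)) * G) := by
        by_cases hl : l = 0
        · subst hl
          simp only [map_zero, zero_add] at hG
          rw [hG] at hGA ⊢
          exact ih γ hA2 hA2' (isUnit_subst h0 hU) hGA hγ
        · exact hQ _ _ hA2 hA2'.ne_zero hGA ⟨d, le_rfl, coeff_translated_ne_zero hl _ hU k⟩
      rw [map_mul, map_pow, liftSeries_X] at hgoal
      convert hgoal using 1
      ring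
    -- In the chart `x_k = x_n x_k`, the series `F` becomes `x_n ^ (d + 1)` times the unit `W`.
    · have h0 := constantCoeff_blowUpSeries k.castSucc (Fin.last n) 0
      have hs := MvPowerSeries.hasSubst_of_constantCoeff_zero h0
      have hlast : blowUpSeries k.castSucc (Fin.last n) 0 (Fin.last n) =
          MvPowerSeries.X (Fin.last n) := by
        simp [blowUpSeries, (Fin.castSucc_lt_last k).ne']
      have hkv : blowUpSeries k.castSucc (Fin.last n) 0 k.castSucc =
          MvPowerSeries.X (Fin.last n) * MvPowerSeries.X k.castSucc := by
        simp [blowUpSeries]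
      have hnormal : ∀ j, IsNormal (blowUpSeries k.castSucc (Fin.last n) 0 j) := fun j => by
        by_cases hj : j = k.castSucc
        · subst hj
          rw [hkv]
          exact (isNormal_X _).mul (isNormal_X _)
        · simpa [blowUpSeries, hj] using isNormal_X j
      set W : MvPowerSeries (Fin (n + 1)) ℝ := ∑ i ∈ Finset.range d,
        MvPowerSeries.X k.castSucc ^ (d + 1 - i) *
          MvPowerSeries.subst (blowUpSeries k.castSucc (Fin.last n) 0)
            (liftSeries (MvPowerSeries.monomial ((d + 1 - i) • γ) 1 * b i)) +
        MvPowerSeries.subst (blowUpSeries k.castSucc (Fin.last n) 0) U with hW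
      have hFW : MvPowerSeries.subst (blowUpSeries k.castSucc (Fin.last n) 0)
          (∑ i ∈ Finset.range d,
            liftSeries (MvPowerSeries.monomial ((d + 1 - i) • (Finsupp.single k 1 + γ)) 1 * b i) *
              MvPowerSeries.X (Fin.last n) ^ i + MvPowerSeries.X (Fin.last n) ^ (d + 1) * U) =
          MvPowerSeries.X (Fin.last n) ^ (d + 1) * W := by
        rw [subst_sum_mul_pow h0, hlast, hW, mul_add, Finset.mul_sum]
        congr 1
        refine Finset.sum_congr rfl fun i hi => ?_
        have hi' : d + 1 = (d + 1 - i) + i := by have := Finset.mem_range.1 hi; omega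
        rw [hmon, map_mul, map_pow, liftSeries_X, MvPowerSeries.subst_mul hs,
          MvPowerSeries.subst_pow hs, MvPowerSeries.subst_X hs, hkv, mul_pow]
        conv_rhs => rw [hi', pow_add]
        rw [← hi']
        ring
      have hWu : IsUnit W := by
        rw [MvPowerSeries.isUnit_iff_constantCoeff, hW, map_add, map_sum,
          Finset.sum_eq_zero fun i hi => ?_, zero_add, constantCoeff_subst_of_zero h0]
        · exact MvPowerSeries.isUnit_iff_constantCoeff.1 hU
        · have : d + 1 - i ≠ 0 := by have := Finset.mem_range.1 hi; omega
          rw [map_mul, map_pow, MvPowerSeries.constantCoeff_X, zero_pow this, zero_mul]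
      rw [MvPowerSeries.subst_mul hs, hFW]
      exact ((hA'.lift.subst h0 hnormal).mul
        (((isNormal_X _).pow _).mul (isNormal_of_isUnit hWu))).mul (isNormal_X _)

end HGerm

namespace HGerm

variable {H : ℝ → ℝ} {n m : ℕ}

/-! ### Induction on the order along the last axis -/

/-- The series `F` is `X_n ^ (d + 1)` times a unit plus a polynomial in `X_n` of degree `< d` with
coefficients `a_0, …, a_{d - 1}` in the other variables. The series `A` is a multiple of each `a_i`
and of the differences of the powers of the `a_i` that have weight `(d + 1)!`, where the weight of
`a_i` is `d + 1 - i`; a coefficient or a difference that vanishes imposes no condition. -/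
def IsPrepared (H : ℝ → ℝ) (d : ℕ) (A : MvPowerSeries (Fin n) ℝ)
    (F : MvPowerSeries (Fin (n + 1)) ℝ) : Prop :=
  IsAlgSeries H A ∧ IsAlgSeries H F ∧
    ∃ (a : ℕ → MvPowerSeries (Fin n) ℝ) (U : MvPowerSeries (Fin (n + 1)) ℝ), IsUnit U ∧
      F = ∑ i ∈ Finset.range d, liftSeries (a i) * MvPowerSeries.X (Fin.last n) ^ i +
        MvPowerSeries.X (Fin.last n) ^ (d + 1) * U ∧
      (∀ i < d, a i = 0 ∨ a i ∣ A) ∧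
      ∀ i < d, ∀ j < d,
        a i ^ ((d + 1).factorial / (d + 1 - i)) - a j ^ ((d + 1).factorial / (d + 1 - j)) = 0 ∨
        a i ^ ((d + 1).factorial / (d + 1 - i)) - a j ^ ((d + 1).factorial / (d + 1 - j)) ∣ A

theorem IsPrepared.subst (hH : IsQuasianalyticGenerator H) {d : ℕ} {A : MvPowerSeries (Fin n) ℝ}
    {F : MvPowerSeries (Fin (n + 1)) ℝ} (h : IsPrepared H d A F)
    {a : Fin n → MvPowerSeries (Fin n) ℝ} {K : MvPowerSeries (Fin n) ℝ}
    (ha : ∀ k, IsAlgSeries H (a k)) (ha0 : ∀ k, MvPowerSeries.constantCoeff (a k) = 0)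
    (hK : IsAlgSeries H K) :
    IsPrepared H d (MvPowerSeries.subst a A * K) (MvPowerSeries.subst (extendSeries a) F) := by
  obtain ⟨hA, hF, b, U, hU, rfl, hb, hbb⟩ := h
  have h0 := constantCoeff_extendSeries ha0
  have hs := MvPowerSeries.hasSubst_of_constantCoeff_zero ha0
  have key : ∀ D : MvPowerSeries (Fin n) ℝ, D = 0 ∨ D ∣ A →
      MvPowerSeries.subst a D = 0 ∨ MvPowerSeries.subst a D ∣ MvPowerSeries.subst a A * K := by
    intro D hD
    rw [← MvPowerSeries.coe_substAlgHom (R := ℝ) hs]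
    rcases hD with rfl | hD
    · exact .inl (map_zero _)
    · exact .inr ((map_dvd _ hD).mul_right K)
  refine ⟨(hA.subst hH ha ha0).mul hH hK, hF.subst hH (isAlgSeries_extendSeries hH ha) h0,
    fun i => MvPowerSeries.subst a (b i), MvPowerSeries.subst (extendSeries a) U,
    isUnit_subst h0 hU, ?_, fun i hi => key _ (hb i hi), fun i hi j hj => ?_⟩
  · rw [subst_sum_mul_pow h0]
    simp only [subst_extendSeries_lift ha0, extendSeries_last]
  · have := key _ (hbb i hi j hj)
    rwa [MvPowerSeries.subst_sub hs, MvPowerSeries.subst_pow hs, MvPowerSeries.subst_pow hs] at this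

/-- If `A` is normal, its divisors `a_i` are normal. The divisors `a_i ^ e_i - a_j ^ e_j` are normal
too, so the exponents of the `a_i ^ e_i` are pairwise comparable and one of them is the least. -/
theorem exists_least_weighted_exponent {d : ℕ} {A : MvPowerSeries (Fin n) ℝ} (hA : IsNormal A)
    {a : ℕ → MvPowerSeries (Fin n) ℝ} (ha : ∃ i < d, a i ≠ 0) (hdvd : ∀ i < d, a i = 0 ∨ a i ∣ A)
    {e : ℕ → ℕ} (hdiff : ∀ i < d, ∀ j < d,
      a i ^ e i - a j ^ e j = 0 ∨ a i ^ e i - a j ^ e j ∣ A) :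
    ∃ (α : ℕ → Fin n →₀ ℕ) (u : ℕ → MvPowerSeries (Fin n) ℝ),
      (∀ i < d, a i ≠ 0 → IsUnit (u i) ∧ a i = MvPowerSeries.monomial (α i) 1 * u i) ∧
      ∃ i₀ < d, a i₀ ≠ 0 ∧ ∀ i < d, a i ≠ 0 → e i₀ • α i₀ ≤ e i • α i := by
  have hex : ∀ i, ∃ (α : Fin n →₀ ℕ) (u : MvPowerSeries (Fin n) ℝ), i < d → a i ≠ 0 →
      IsUnit u ∧ a i = MvPowerSeries.monomial α 1 * u := fun i => by
    by_cases h : i < d ∧ a i ≠ 0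
    · obtain ⟨α, u, hu, h'⟩ := hA.of_dvd ((hdvd i h.1).resolve_left h.2)
      exact ⟨α, u, fun _ _ => ⟨hu, h'⟩⟩
    · exact ⟨0, 0, fun h1 h2 => absurd ⟨h1, h2⟩ h⟩
  choose α u hα using hex
  classical
  obtain ⟨i₁, hi₁, hai₁⟩ := ha
  obtain ⟨i₀, hi₀, hmin⟩ := Finset.exists_minimalFor (fun i => e i • α i)
    ({i ∈ Finset.range d | a i ≠ 0}) ⟨i₁, by simp [hi₁, hai₁]⟩
  simp only [Finset.mem_filter, Finset.mem_range] at hi₀ hmin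
  refine ⟨α, u, hα, i₀, hi₀.1, hi₀.2, fun i hi hai => ?_⟩
  have hpow : ∀ j < d, a j ≠ 0 → a j ^ e j =
      MvPowerSeries.monomial (e j • α j) 1 * u j ^ e j := fun j hj haj => by
    conv_lhs => rw [(hα j hj haj).2]
    rw [mul_pow, monomial_nsmul]
  have h := hdiff i₀ hi₀.1 i hi
  rw [hpow _ hi₀.1 hi₀.2, hpow _ hi hai] at h
  rcases le_or_le_of_isNormal_sub ((hα _ hi₀.1 hi₀.2).1.pow _) ((hα _ hi hai).1.pow _)
    (h.imp_right hA.of_dvd) with h | h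
  · exact h
  · exact hmin ⟨hi, hai⟩ h

/-- When `A` is normal, all coefficients of a prepared series are normal and the exponents of their
powers of weight `(d + 1)!` are comparable. A ramification of order `(d + 1)!` of the first `n`
variables makes the least of these exponents divisible as required for the blow-ups. -/
theorem Monomializable.of_isPrepared (hH : IsQuasianalyticGenerator H) {d : ℕ}
    (hQ : ∀ (A : MvPowerSeries (Fin n) ℝ) (F : MvPowerSeries (Fin (n + 1)) ℝ), IsAlgSeries H A →
      A ≠ 0 → IsAlgSeries H F →
      (∃ j ≤ d, MvPowerSeries.coeff (Finsupp.single (Fin.last n) j) F ≠ 0) →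
      Monomializable H (liftSeries A * F))
    {A : MvPowerSeries (Fin n) ℝ} (hA' : IsNormal A) {F : MvPowerSeries (Fin (n + 1)) ℝ}
    (h : IsPrepared H d A F) : Monomializable H (liftSeries A * F) := by
  obtain ⟨hA, hF, a, U, hU, hFa, hdvd, hdiff⟩ := h
  by_cases hzero : ∃ i < d, a i ≠ 0
  swap
  · push Not at hzero
    rw [hFa, Finset.sum_eq_zero fun i hi => by rw [hzero i (Finset.mem_range.1 hi), map_zero,
      zero_mul], zero_add]
    exact .normal (hA'.lift.mul (((isNormal_X _).pow _).mul (isNormal_of_isUnit hU)))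
  obtain ⟨α, u, hα, i₀, hi₀, hai₀, hmin⟩ :=
    exists_least_weighted_exponent hA' hzero hdvd hdiff
  have hN : 1 ≤ (d + 1).factorial := Nat.factorial_pos _
  have hdiv : ∀ i < d, (d + 1 - i) * ((d + 1).factorial / (d + 1 - i)) = (d + 1).factorial :=
    fun i hi => Nat.mul_div_cancel' (Nat.dvd_factorial (by omega) (by omega))
  generalize (d + 1).factorial = N at *
  refine .of_multiRamification (Finset.univ.erase (Fin.last n)) hN fun ε => ?_
  rw [extendSeries_multiRamificationSeries]
  set r := multiRamificationSeries Finset.univ N fun k : Fin n => ε k.castSucc with hr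
  have r0 : ∀ k, MvPowerSeries.constantCoeff (r k) = 0 :=
    constantCoeff_multiRamificationSeries _ hN _
  have rA : ∀ k, IsAlgSeries H (r k) := isAlgSeries_multiRamificationSeries hH _ _ _
  have re0 := constantCoeff_extendSeries r0
  have hb : ∀ i, ∃ b, i < d → (i = i₀ → IsUnit b) ∧ MvPowerSeries.subst r (a i) =
      MvPowerSeries.monomial ((d + 1 - i) • (N / (d + 1 - i₀)) • α i₀) 1 * b := fun i => by
    by_cases hi : i < d
    swap
    · exact ⟨0, fun h => absurd h hi⟩
    by_cases hai : a i = 0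
    · refine ⟨0, fun _ => ⟨fun h => absurd (h ▸ hai) hai₀, ?_⟩⟩
      rw [hai, mul_zero, ← MvPowerSeries.coe_substAlgHom (R := ℝ)
        (MvPowerSeries.hasSubst_of_constantCoeff_zero r0), map_zero]
    obtain ⟨V, hV, hV'⟩ := subst_multiRamificationSeries_monomial hN
      (fun k : Fin n => ε k.castSucc) (α i) (u i) (hα i hi hai).1
    rw [← (hα i hi hai).2, ← hr] at hV'
    obtain ⟨γ, hγ⟩ := exists_add_of_le (hmin i hi hai)
    have hγ' : N • α i = (d + 1 - i) • (N / (d + 1 - i₀)) • α i₀ + (d + 1 - i) • γ := by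
      rw [← smul_add, ← hγ, smul_smul, hdiv i hi]
    refine ⟨MvPowerSeries.monomial ((d + 1 - i) • γ) 1 * V, fun _ => ⟨fun h => ?_, ?_⟩⟩
    · subst h
      have : γ = 0 := by simpa using hγ
      simpa [this, MvPowerSeries.monomial_zero_eq_C_apply] using hV
    · rw [hV', hγ', monomial_add, mul_assoc]
  choose b hb using hb
  have hFr : MvPowerSeries.subst (extendSeries r) F = ∑ i ∈ Finset.range d,
      liftSeries (MvPowerSeries.monomial ((d + 1 - i) • (N / (d + 1 - i₀)) • α i₀) 1 * b i) *
        MvPowerSeries.X (Fin.last n) ^ i + MvPowerSeries.X (Fin.last n) ^ (d + 1) *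
          MvPowerSeries.subst (extendSeries r) U := by
    rw [hFa, subst_sum_mul_pow re0, extendSeries_last]
    congr 1
    refine Finset.sum_congr rfl fun i hi => ?_
    rw [subst_extendSeries_lift r0, (hb i (Finset.mem_range.1 hi)).2]
  have hFA := hF.subst hH (isAlgSeries_extendSeries hH rA) re0
  rw [MvPowerSeries.subst_mul (MvPowerSeries.hasSubst_of_constantCoeff_zero re0),
    subst_extendSeries_lift r0, hFr]
  rw [hFr] at hFA
  refine .of_prepared hH hQ _ (hA.subst hH rA r0) (hA'.subst r0 fun k => ?_)
    ⟨i₀, hi₀, (hb i₀ hi₀).1 rfl⟩ (isUnit_subst re0 hU) hFA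
  rw [hr, multiRamificationSeries, if_pos (Finset.mem_univ _)]
  refine (isNormal_of_isUnit (IsUnit.map MvPowerSeries.C (Ne.isUnit ?_))).mul ((isNormal_X k).pow _)
  simp

/-- Induction on the order of `F` along the last axis. If it is `d + 1`, a Tschirnhausen translation
removes the term of degree `d`. The factor `A` is then multiplied by all the series in the first `n`
variables that have to be normal, and a tree that monomializes this product, provided by the
induction hypothesis on `n`, is lifted to one more variable. -/
theorem Monomializable.of_coeff_ne_zero (hH : IsQuasianalyticGenerator H)
    (hn : ∀ A : MvPowerSeries (Fin n) ℝ, IsAlgSeries H A → A ≠ 0 → Monomializable H A) (d : ℕ)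
    {A : MvPowerSeries (Fin n) ℝ} {F : MvPowerSeries (Fin (n + 1)) ℝ} (hA : IsAlgSeries H A)
    (hA0 : A ≠ 0) (hF : IsAlgSeries H F)
    (hd : ∃ j ≤ d, MvPowerSeries.coeff (Finsupp.single (Fin.last n) j) F ≠ 0) :
    Monomializable H (liftSeries A * F) := by
  induction d generalizing A F with
  | zero =>
    obtain ⟨j, hj, h⟩ := hd
    obtain rfl : j = 0 := by omega
    refine Monomializable.lift hH (R := fun _ F => IsUnit F)
      (fun _ F a _ _ ha0 _ hF => isUnit_subst (constantCoeff_extendSeries ha0) hF)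
      (fun A F hA hF => .normal (hA.lift.mul (isNormal_of_isUnit hF))) (hn A hA hA0) ?_
    rw [MvPowerSeries.isUnit_iff_constantCoeff]
    simpa using h
  | succ d ih =>
    by_cases hlow : ∃ j ≤ d, MvPowerSeries.coeff (Finsupp.single (Fin.last n) j) F ≠ 0
    · exact ih hA hA0 hF hlow
    have htop : MvPowerSeries.coeff (Finsupp.single (Fin.last n) (d + 1)) F ≠ 0 := by
      obtain ⟨j, hj, h⟩ := hd
      by_cases hjd : j ≤ d
      · exact absurd ⟨j, hjd, h⟩ hlow
      · rwa [show j = d + 1 by omega] at h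
    push Not at hlow
    obtain ⟨t, ht, t0, a, U, ha, hU, hFa⟩ := hF.exists_tschirnhausen hH hlow htop
    have ht0 : MvPowerSeries.constantCoeff (taylor t) = 0 := by
      rw [ht.constantCoeff_taylor hH, t0]
    have hτ := constantCoeff_tschirnhausenSeries ht0
    have hτA : ∀ k, IsAlgSeries H (tschirnhausenSeries (taylor t) k) := fun k => by
      by_cases hk : k = Fin.last n
      · subst hk
        simpa [tschirnhausenSeries] using
          (isAlgSeries_X _).add hH (IsAlgSeries.lift hH ⟨t, ht, rfl⟩)
      · simpa [tschirnhausenSeries, hk] using isAlgSeries_X k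
    refine .of_tschirnhausen hH ht t0 ?_
    rw [MvPowerSeries.subst_mul (MvPowerSeries.hasSubst_of_constantCoeff_zero hτ),
      subst_liftSeries_of_fixed hτ fun k => by
        simp [tschirnhausenSeries, (Fin.castSucc_lt_last k).ne]]
    have hFA := hF.subst hH hτA hτ
    classical
    -- Replacing the zero factors by `1` keeps the products nonzero.
    let c : MvPowerSeries (Fin n) ℝ → MvPowerSeries (Fin n) ℝ := fun D => if D = 0 then 1 else D
    let D : ℕ → ℕ → MvPowerSeries (Fin n) ℝ := fun i j =>
      a i ^ ((d + 1).factorial / (d + 1 - i)) - a j ^ ((d + 1).factorial / (d + 1 - j))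
    have hD : ∀ i j, IsAlgSeries H (D i j) := fun i j =>
      ((ha i).pow hH _).sub hH ((ha j).pow hH _)
    have hc : ∀ D, IsAlgSeries H D → IsAlgSeries H (c D) := fun D hD => by
      by_cases h : D = 0
      · simpa [c, h] using isAlgSeries_one
      · simpa [c, h] using hD
    have hc0 : ∀ D, c D ≠ 0 := fun D => by
      by_cases h : D = 0 <;> simp [c, h]
    have hcd : ∀ D B, c D ∣ B → D = 0 ∨ D ∣ B := fun D B hB => by
      by_cases h : D = 0
      · exact .inl h
      · right; simpa [c, h] using hB
    let P := ∏ i ∈ Finset.range d, c (a i)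
    let Q := ∏ i ∈ Finset.range d, ∏ j ∈ Finset.range d, c (D i j)
    have hPQ : IsAlgSeries H (P * Q) := (IsAlgSeries.prod hH fun i _ => hc _ (ha i)).mul hH
      (IsAlgSeries.prod hH fun i _ => IsAlgSeries.prod hH fun j _ => hc _ (hD i j))
    have hPQ0 : P * Q ≠ 0 := mul_ne_zero (Finset.prod_ne_zero_iff.2 fun i _ => hc0 _)
      (Finset.prod_ne_zero_iff.2 fun i _ => Finset.prod_ne_zero_iff.2 fun j _ => hc0 _)
    have hprep : IsPrepared H d (A * (P * Q))
        (MvPowerSeries.subst (tschirnhausenSeries (taylor t)) F) := by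
      refine ⟨hA.mul hH hPQ, hFA, a, U, hU, hFa, fun i hi => hcd _ _ ?_,
        fun i hi j hj => hcd (D i j) _ ?_⟩
      · exact ((Finset.dvd_prod_of_mem _ (Finset.mem_range.2 hi)).mul_right Q).mul_left A
      · exact (((Finset.dvd_prod_of_mem (fun j => c (D i j)) (Finset.mem_range.2 hj)).trans
          (Finset.dvd_prod_of_mem (fun i => ∏ j ∈ Finset.range d, c (D i j))
            (Finset.mem_range.2 hi))).mul_left P).mul_left A
    have hmon : Monomializable H (liftSeries (A * (P * Q)) *
        MvPowerSeries.subst (tschirnhausenSeries (taylor t)) F) :=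
      Monomializable.lift hH (R := IsPrepared H d)
        (fun A F a K hαA ha0 hK h => h.subst hH hαA ha0 hK)
        (fun A F hA h => .of_isPrepared hH (fun A F hA hA0 hF hd => ih hA hA0 hF hd) hA h)
        (hn _ (hA.mul hH hPQ) (mul_ne_zero hA0 hPQ0)) hprep
    refine hmon.of_dvd hH (mul_dvd_mul ?_ dvd_rfl)
    rw [map_mul]
    exact dvd_mul_right _ _

/-- Induction on `n`: a shear makes the order of `F` along the last axis finite. -/
theorem IsAlgSeries.monomializable (hH : IsQuasianalyticGenerator H)
    {F : MvPowerSeries (Fin n) ℝ} (hF : IsAlgSeries H F) (hF0 : F ≠ 0) : Monomializable H F := by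
  induction n with
  | zero =>
    refine .normal (isNormal_of_isUnit (MvPowerSeries.isUnit_iff_constantCoeff.2 (Ne.isUnit ?_)))
    intro h
    refine hF0 (MvPowerSeries.ext fun α => ?_)
    rw [Subsingleton.elim α 0]
    simpa using h
  | succ n ih =>
    obtain ⟨c, d, hd⟩ := exists_shear_coeff_ne_zero hF0
    refine .of_shear (Fin.last n) c ?_
    have hA : ∀ k, IsAlgSeries H (shearSeries (Fin.last n) c k) := fun k => by
      by_cases hk : k < Fin.last n
      · simpa [shearSeries, hk] using
          (isAlgSeries_X _).add hH ((isAlgSeries_C _).mul hH (isAlgSeries_X _))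
      · simpa [shearSeries, hk] using isAlgSeries_X k
    simpa using Monomializable.of_coeff_ne_zero hH (fun A hA hA0 => ih hA hA0) d isAlgSeries_one
      one_ne_zero (hF.subst hH hA (constantCoeff_shearSeries _ _)) ⟨d, le_rfl, hd⟩

end HGerm

theorem mainTheorem6 (H : ℝ → ℝ) (hH : HGerm.IsQuasianalyticGenerator H) (n p : ℕ)
    (F : Fin p → MvPowerSeries (Fin n) ℝ)
    (hF : ∀ k, ∃ f : (Fin n → ℝ) → ℝ, HGerm.InAlg H n f ∧ HGerm.taylor f = F k)
    (hF0 : ∀ k, F k ≠ 0) :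
    ∃ (h : Ordinal.{0}) (T : HGerm.AdmissibleTree H n),
      T.HeightAtMost h ∧ T.StarMonomializes F := by
  have hprod : HGerm.IsAlgSeries H (∏ k, F k) := HGerm.IsAlgSeries.prod hH fun k _ => hF k
  obtain ⟨T, hT⟩ := (hprod.monomializable hH
    (Finset.prod_ne_zero_iff.2 fun k _ => hF0 k)).exists_tree hH
  obtain ⟨h, hh⟩ := T.exists_heightAtMost
  exact ⟨h, T, hh, hT.1.of_dvd hH fun k => Finset.dvd_prod_of_mem _ (Finset.mem_univ k), hT.2⟩
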